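/- Let $n\ge 3$ and $\lambda>0$. Write $\mathbb S^{k}$ for the unit sphere of $\mathbb R^{k+1}$, $\omega_{k}=2\pi^{(k+1)/2}/\Gamma(\tfrac{k+1}{2})$ for its volume, and $$\Lambda^{-1}(y)=\Big(\tfrac{2y}{1+|y|^2},\tfrac{-1+|y|^2}{1+|y|^2}\Big)\in\mathbb S^{n-1},\qquad y\in\mathbb R^{n-1},$$ for the inverse stereographic projection. Let $\Sigma_\lambda=\{x\in\mathbb R^n: x_n^2+(x_1^2+\dots+x_{n-1}^2)\cosh^2\lambda=1\}$ and, for $\psi\in\mathbb S^{n-2}$ and $c>0$, let $$\mathrm S_{\psi,c}=\{\Lambda^{-1}(c\psi+c(\tanh\lambda)\,\omega):\omega\in\mathbb S^{n-2}\}.$$ Let $(Y^m_l)_{1\le l\le d_m}$ be, for every $m\ge0$, an orthonormal basis in $L^2(\mathbb S^{n-2})$ of the $d_m$-dimensional space of spherical harmonics of degree $m$ on $\mathbb S^{n-2}$. Let $f:\mathbb S^{n-1}\to\mathbb C$ be continuous and such that $$f^{**}(x)=\frac{f(\Lambda^{-1}(x))}{|x|^{n-2}(1+|x|^2)^{n-2}}$$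 belongs to $L^1(\mathbb R^{n-1}\setminus\{0\})$. Let $(Sf)(\mathrm S_{\psi,c})=\int_{\mathrm S_{\psi,c}}f\,d\mathrm S_{\psi,c}$ be the integral of $f$ over $\mathrm S_{\psi,c}$ with respect to $(n-2)$-dimensional surface measure, and define for $r,c>0$ $$f_{m,l}(r)=\int_{\mathbb S^{n-2}}f(\Lambda^{-1}(r\zeta))\,\overline{Y^m_l(\zeta)}\,d\zeta,\qquad \mathcal K_{m,l}(c)=\frac{1}{(2c\tanh\lambda)^{n-2}\,\omega_{n-3}}\int_{\mathbb S^{n-2}}(Sf)(\mathrm S_{\psi,c})\,\overline{Y^m_l(\psi)}\,d\psi ,$$ so that $\sum_{m,l}f_{m,l}(r)Y^m_l(\zeta)$ is the spherical harmonic expansion of $f\circ\Lambda^{-1}$. Let $C^{\nu}_m$ denote the Gegenbauer polynomial of degree $m$ and order $\nu$, normalized by $C^\nu_m(1)=1$ (so $C^0_m$ is the Chebyshev polynomial $T_m$), put $t=\tanh\lambda$, and let $$h_{m,\lambda}(x)=2^{4-n}\,t^{3-n}\,x\,C_m^{\frac{n-3}{2}}\!\Big(\frac{x^2+1-t^2}{2x}\Big)\big((1+t-x)(1+t+x)(x-1+t)(x+1-t)\big)^{\frac{n-4}{2}}$$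 for $1-t\le x\le 1+t$, and $h_{m,\lambda}(x)=0$ for all other $x$. Let $\mathcal MF(s)=\int_0^\infty y^{s-1}F(y)\,dy$ be the Mellin transform. Then: (a) The sets $\mathrm S_{\psi,c}$ ($\psi\in\mathbb S^{n-2}$, $c>0$) are exactly the intersections of $\mathbb S^{n-1}$ with hyperplanes tangent to $\Sigma_\lambda$ that contain more than one point. (b) Let $m\ge0$, $1\le l\le d_m$ and $\varrho\in(0,1)$. The integrals defining $\mathcal M(\mathcal K_{m,l})(s)$ and $\mathcal M(h_{m,\lambda})(1-s)$ converge absolutely for all $s$ with $\Re s=\varrho$, and $\mathcal M(h_{m,\lambda})(1-s)\ne0$ for almost every such $s$. For every $r>0$ $$f_{m,l}(r)=\frac{(1+r^2)^{n-2}}{2\pi i}\int_{\varrho-i\infty}^{\varrho+i\infty}r^{-s}\,\frac{\mathcal M(\mathcal K_{m,l})(s)}{\mathcal M(h_{m,\lambda})(1-s)}\,ds ,$$ where the integral is understood in the following sense. With $I(T)=\frac{1}{2\pi i}\int_{\varrho-iT}^{\varrho+iT}r^{-s}\frac{\mathcal M(\mathcal K_{m,l})(s)}{\mathcal M(h_{m,\lambda})(1-s)}ds$: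 (i) if $u\mapsto (f_{m,l}(u)-f_{m,l}(r))/(u-r)$ is integrable in a neighbourhood of $r$ (for instance, if $f_{m,l}$ is differentiable at $r$ or Hölder continuous near $r$), then $(1+r^2)^{n-2}I(T)\to f_{m,l}(r)$ as $T\to\infty$; (ii) for every $r>0$ without exception, the integral is Cesàro summable to this value, i.e. $(1+r^2)^{n-2}\,\frac1T\int_0^T I(\tau)\,d\tau\to f_{m,l}(r)$ as $T\to\infty$; in particular, the formula holds in the ordinary sense at every $r$ where $\lim_{T\to\infty}I(T)$ exists. -/

import Mathlib

open MeasureTheory Metric Set Filter Topology Polynomial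
open scoped ComplexConjugate

namespace SpheroidTransform

/-! Throughout, `d = n - 1`: the unit sphere `S^{n-1}` lies in `ℝ^{d+1}`, the stereographic image is
`ℝ^d`, whose unit sphere is `S^{n-2} = S^{d-1}`.  The distinguished axis is the last one. -/

/-- The standard volume `ω_k = 2 π^{(k+1)/2} / Γ((k+1)/2)` of the unit sphere `S^k`. -/
noncomputable def sphereVolume (k : ℕ) : ℝ :=
  2 * Real.pi ^ (((k : ℝ) + 1) / 2) / Real.Gamma (((k : ℝ) + 1) / 2)

/-- The spheroid `x_n² + (x_1² + ⋯ + x_{n-1}²) cosh² λ = 1`. -/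
def spheroid (d : ℕ) (lam : ℝ) : Set (EuclideanSpace ℝ (Fin (d + 1))) :=
  {x | x (Fin.last d) ^ 2 + (∑ i : Fin d, x i.castSucc ^ 2) * Real.cosh lam ^ 2 = 1}

/-- The hyperplane through `p` orthogonal to half the gradient at `p` of the quadratic form
that defines the spheroid. -/
def tangentHyperplane {d : ℕ} (lam : ℝ) (p : EuclideanSpace ℝ (Fin (d + 1))) :
    Set (EuclideanSpace ℝ (Fin (d + 1))) :=
  {x | p (Fin.last d) * (x (Fin.last d) - p (Fin.last d)) +
    Real.cosh lam ^ 2 * ∑ i : Fin d, p i.castSucc * (x i.castSucc - p i.castSucc) = 0}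

/-- The subspheres cut out of the unit sphere by the hyperplanes tangent to the spheroid.  The two
tangent hyperplanes at the poles meet the unit sphere in a single point only and give no
subsphere. -/
def tangentSubspheres (d : ℕ) (lam : ℝ) : Set (Set (EuclideanSpace ℝ (Fin (d + 1)))) :=
  {T | ∃ p ∈ spheroid d lam, T = sphere 0 1 ∩ tangentHyperplane lam p ∧ T.Nontrivial}

/-- The inverse stereographic projection `Λ⁻¹`. -/
noncomputable def stereoInv {d : ℕ} (y : EuclideanSpace ℝ (Fin d)) :
    EuclideanSpace ℝ (Fin (d + 1)) :=
  WithLp.toLp 2 (Fin.snoc (α := fun _ => ℝ) (fun i => 2 * y i / (1 + ‖y‖ ^ 2))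
    ((-1 + ‖y‖ ^ 2) / (1 + ‖y‖ ^ 2)))

/-- The subsphere `S_{ψ,c} = {Λ⁻¹(c ψ + c (tanh λ) ω) : ω ∈ S^{n-2}}`. -/
noncomputable def subsphere {d : ℕ} (lam : ℝ) (ψ : sphere (0 : EuclideanSpace ℝ (Fin d)) 1)
    (c : ℝ) : Set (EuclideanSpace ℝ (Fin (d + 1))) :=
  range fun ω : sphere (0 : EuclideanSpace ℝ (Fin d)) 1 =>
    stereoInv (c • (ψ : EuclideanSpace ℝ (Fin d)) +
      (c * Real.tanh lam) • (ω : EuclideanSpace ℝ (Fin d)))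

/-- The spherical transform: the integral of `f` over an `(n-2)`-dimensional subsphere `T` of
`S^{n-1}` with respect to surface measure (`μHE[k]` is the `k`-dimensional Hausdorff measure,
normalized to agree with Lebesgue measure on `ℝ^k`). -/
noncomputable def sphericalTransform {d : ℕ} (f : EuclideanSpace ℝ (Fin (d + 1)) → ℂ)
    (T : Set (EuclideanSpace ℝ (Fin (d + 1)))) : ℂ :=
  ∫ x in T, f x ∂μHE[d - 1]

/-- `f**(x) = f(Λ⁻¹ x) / (|x|^{n-2} (1 + |x|²)^{n-2})`. -/
noncomputable def fStarStar {d : ℕ} (f : EuclideanSpace ℝ (Fin (d + 1)) → ℂ)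
    (x : EuclideanSpace ℝ (Fin d)) : ℂ :=
  f (stereoInv x) / ((‖x‖ ^ (d - 1) * (1 + ‖x‖ ^ 2) ^ (d - 1) : ℝ) : ℂ)

/-! ### Spherical harmonics on the unit sphere of `ℝ^d` -/

/-- The Laplacian on polynomials. -/
noncomputable def polyLaplacian (d : ℕ) :
    MvPolynomial (Fin d) ℂ →ₗ[ℂ] MvPolynomial (Fin d) ℂ :=
  ∑ i : Fin d, (MvPolynomial.pderiv (R := ℂ) i).toLinearMap ∘ₗ
    (MvPolynomial.pderiv (R := ℂ) i).toLinearMap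

/-- Restriction of a polynomial to the unit sphere. -/
noncomputable def restrictToSphere (d : ℕ) :
    MvPolynomial (Fin d) ℂ →ₗ[ℂ] (sphere (0 : EuclideanSpace ℝ (Fin d)) 1 → ℂ) :=
  LinearMap.pi fun ζ => (MvPolynomial.aeval fun i : Fin d =>
    (((ζ : EuclideanSpace ℝ (Fin d)) i : ℝ) : ℂ)).toLinearMap

/-- Spherical harmonics of degree `m`: restrictions to the unit sphere of homogeneous harmonic
polynomials of degree `m`. -/
noncomputable def sphericalHarmonics (d m : ℕ) :
    Submodule ℂ (sphere (0 : EuclideanSpace ℝ (Fin d)) 1 → ℂ) :=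
  (MvPolynomial.homogeneousSubmodule (Fin d) ℂ m ⊓ LinearMap.ker (polyLaplacian d)).map
    (restrictToSphere d)

/-- The dimension `d_m` of the space of spherical harmonics of degree `m`. -/
noncomputable def harmonicDim (d m : ℕ) : ℕ := Module.finrank ℂ (sphericalHarmonics d m)

/-- `Y m 0, …, Y m (d_m - 1)` is an orthonormal basis of the spherical harmonics of degree `m`, for
every `m` (`volume.toSphere` is the surface measure of the unit sphere). -/
structure IsSphericalHarmonicBasis {d : ℕ}
    (Y : ∀ m : ℕ, Fin (harmonicDim d m) → sphere (0 : EuclideanSpace ℝ (Fin d)) 1 → ℂ) : Prop where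
  mem : ∀ m l, Y m l ∈ sphericalHarmonics d m
  norm_eq_one : ∀ m l,
    ∫ ζ, Y m l ζ * conj (Y m l ζ) ∂(volume : Measure (EuclideanSpace ℝ (Fin d))).toSphere = 1
  orthogonal : ∀ m l m' l', (⟨m, l⟩ : Σ m, Fin (harmonicDim d m)) ≠ ⟨m', l'⟩ →
    ∫ ζ, Y m l ζ * conj (Y m' l' ζ) ∂(volume : Measure (EuclideanSpace ℝ (Fin d))).toSphere = 0

/-- The coefficient at `Y` in the spherical harmonic expansion of `ζ ↦ (f ∘ Λ⁻¹)(r ζ)`. -/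
noncomputable def harmonicCoeff {d : ℕ} (f : EuclideanSpace ℝ (Fin (d + 1)) → ℂ)
    (Y : sphere (0 : EuclideanSpace ℝ (Fin d)) 1 → ℂ) (r : ℝ) : ℂ :=
  ∫ ζ, f (stereoInv (r • (ζ : EuclideanSpace ℝ (Fin d)))) * conj (Y ζ)
    ∂(volume : Measure (EuclideanSpace ℝ (Fin d))).toSphere

/-- The normalized harmonic coefficient
`K(c) = 1 / ((2 c tanh λ)^{n-2} ω_{n-3}) ∫_{S^{n-2}} (Sf)(S_{ψ,c}) conj(Y(ψ)) dψ` of the data. -/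
noncomputable def dataCoeff {d : ℕ} (lam : ℝ) (f : EuclideanSpace ℝ (Fin (d + 1)) → ℂ)
    (Y : sphere (0 : EuclideanSpace ℝ (Fin d)) 1 → ℂ) (c : ℝ) : ℂ :=
  1 / (((2 * c * Real.tanh lam) ^ (d - 1) * sphereVolume (d - 2) : ℝ) : ℂ) *
    ∫ ψ, sphericalTransform f (subsphere lam ψ c) * conj (Y ψ)
      ∂(volume : Measure (EuclideanSpace ℝ (Fin d))).toSphere

/-! ### Gegenbauer polynomials and the kernel -/

/-- The Gegenbauer polynomials of order `ν > -1/2`, normalized to have the value `1` at `1`, through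
their three-term recurrence.  (For `ν = 0` these are the Chebyshev polynomials `T_l`.) -/
noncomputable def gegenbauer (ν : ℝ) : ℕ → ℝ[X]
  | 0 => 1
  | 1 => X
  | l + 2 => C ((l + 1 + 2 * ν)⁻¹) *
      (C (2 * (l + 1 + ν)) * X * gegenbauer ν (l + 1) - C (l + 1 : ℝ) * gegenbauer ν l)

theorem gegenbauer_rec {ν : ℝ} (hν : -(1 / 2) < ν) (l : ℕ) :
    ((l : ℝ[X]) + 1 + 2 * C ν) * gegenbauer ν (l + 2) =
      2 * ((l : ℝ[X]) + 1 + C ν) * X * gegenbauer ν (l + 1) - ((l : ℝ[X]) + 1) * gegenbauer ν l := by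
  have hne : (l : ℝ) + 1 + 2 * ν ≠ 0 := by
    have : (0 : ℝ) ≤ l := l.cast_nonneg
    linarith
  have h1 : ((l : ℝ[X]) + 1 + 2 * C ν) = C ((l : ℝ) + 1 + 2 * ν) := by
    simp only [C_add, C_mul, map_natCast, map_ofNat, C_1]
  have h2 : (2 * ((l : ℝ[X]) + 1 + C ν)) = C (2 * ((l : ℝ) + 1 + ν)) := by
    simp only [C_add, C_mul, map_natCast, map_ofNat, C_1]
  have h3 : ((l : ℝ[X]) + 1) = C ((l : ℝ) + 1) := by simp
  rw [h1, h2, h3, gegenbauer, ← mul_assoc, ← C_mul, mul_inv_cancel₀ hne, C_1, one_mul]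

theorem gegenbauer_deriv {ν : ℝ} (hν : -(1 / 2) < ν) (l : ℕ) :
    (1 - X ^ 2) * derivative (gegenbauer ν l) =
        ((l : ℝ[X]) + 2 * C ν) * (X * gegenbauer ν l - gegenbauer ν (l + 1)) ∧
      (1 - X ^ 2) * derivative (gegenbauer ν (l + 1)) =
        ((l : ℝ[X]) + 1) * (gegenbauer ν l - X * gegenbauer ν (l + 1)) := by
  induction l with
  | zero => simp [gegenbauer]; ring
  | succ l ih =>
    obtain ⟨hB, hA⟩ := ih
    have hr := gegenbauer_rec hν l
    have hne : ((l : ℝ[X]) + 1 + 2 * C ν) ≠ 0 := by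
      have : ((l : ℝ[X]) + 1 + 2 * C ν) = C ((l : ℝ) + 1 + 2 * ν) := by
        simp only [C_add, C_mul, map_natCast, map_ofNat, C_1]
      rw [this, Ne, C_eq_zero]
      have : (0 : ℝ) ≤ l := l.cast_nonneg
      linarith
    have hr' := congrArg derivative hr
    simp only [derivative_mul, derivative_sub, derivative_add, derivative_natCast, derivative_one,
      derivative_C, derivative_X, derivative_ofNat, zero_mul, mul_zero, add_zero, zero_add,
      mul_one] at hr'
    constructor
    · push_cast
      linear_combination hA + hr
    · apply mul_left_cancel₀ hne
      push_cast
      linear_combination (1 - X ^ 2) * hr' + 2 * ((l : ℝ[X]) + 1 + C ν) * X * hA -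
        ((l : ℝ[X]) + 1) * hB + (l + 2) * X * hr

theorem gegenbauer_ode {ν : ℝ} (hν : -(1 / 2) < ν) (l : ℕ) :
    (1 - X ^ 2) * derivative (derivative (gegenbauer ν l)) -
        (2 * C ν + 1) * X * derivative (gegenbauer ν l) =
      -((l : ℝ[X]) * ((l : ℝ[X]) + 2 * C ν)) * gegenbauer ν l := by
  have hne : (1 - X ^ 2 : ℝ[X]) ≠ 0 := by
    intro h
    have := congrArg (eval 0) h
    simp at this
  obtain ⟨hB, hA⟩ := gegenbauer_deriv hν l
  have hB' := congrArg derivative hB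
  simp only [derivative_mul, derivative_sub, derivative_add, derivative_natCast, derivative_one,
      derivative_C, derivative_X, derivative_ofNat, derivative_X_pow, zero_mul, mul_zero, add_zero,
      zero_add, one_mul] at hB'
  push_cast at hB'
  apply mul_left_cancel₀ hne
  simp only [map_ofNat, pow_one] at hB'
  linear_combination (1 - X ^ 2) * hB' +
    (2 * X + ((l : ℝ[X]) + 2 * C ν) * X - (2 * C ν + 1) * X) * hB - ((l : ℝ[X]) + 2 * C ν) * hA

theorem gegenbauer_weight_integrable {ν : ℝ} (hν : -(1 / 2) < ν) (p : ℝ[X]) :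
    IntervalIntegrable (fun t : ℝ => p.eval t * (1 - t ^ 2) ^ (ν - 1 / 2)) volume (-1) 1 := by
  apply IntervalIntegrable.continuousOn_mul _ p.continuous.continuousOn
  have key : IntervalIntegrable (fun t : ℝ => (1 - t ^ 2) ^ (ν - 1 / 2)) volume (-1) 0 := by
    have h1 : IntervalIntegrable (fun t : ℝ => (t + 1) ^ (ν - 1 / 2)) volume (-1) 0 := by
      have := (intervalIntegral.intervalIntegrable_rpow' (a := 0) (b := 1)
        (r := ν - 1 / 2) (by linarith)).comp_add_right 1
      simpa using this
    have h2 : ContinuousOn (fun t : ℝ => (1 - t) ^ (ν - 1 / 2)) (Set.uIcc (-1) 0) := by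
      apply ContinuousOn.rpow_const (by fun_prop)
      intro t ht
      rw [Set.uIcc_of_le (by norm_num)] at ht
      left; linarith [ht.2]
    refine (h1.mul_continuousOn h2).congr ?_
    intro t ht
    rw [Set.uIoc_of_le (by norm_num)] at ht
    simp only
    rw [← Real.mul_rpow (by linarith [ht.1]) (by linarith [ht.2])]
    ring_nf
  refine key.trans ?_
  have := (IntervalIntegrable.iff_comp_neg).1 key
  simpa using this.symm

theorem gegenbauer_weight_parts {ν : ℝ} (hν : -(1 / 2) < ν) (p : ℝ[X]) :
    ∫ t in (-1 : ℝ)..1, ((1 - X ^ 2) * derivative p - (2 * C ν + 1) * X * p).eval t *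
      (1 - t ^ 2) ^ (ν - 1 / 2) = 0 := by
  have h := intervalIntegral.integral_eq_sub_of_hasDerivAt_of_le (a := -1) (b := 1)
    (f := fun t : ℝ => (1 - t ^ 2) ^ (ν + 1 / 2) * p.eval t)
    (f' := fun t : ℝ => ((1 - X ^ 2) * derivative p - (2 * C ν + 1) * X * p).eval t *
      (1 - t ^ 2) ^ (ν - 1 / 2)) (by norm_num) ?_ ?_ (gegenbauer_weight_integrable hν _)
  · rw [h]
    have : ν + 1 / 2 ≠ 0 := by linarith
    norm_num [Real.zero_rpow this]
  · apply ContinuousOn.mul _ p.continuous.continuousOn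
    apply ContinuousOn.rpow_const (by fun_prop)
    intro t ht; right; linarith
  · intro t ht
    have hpos : 0 < 1 - t ^ 2 := by nlinarith [ht.1, ht.2]
    have h0 : HasDerivAt (fun t : ℝ => 1 - t ^ 2) (-(2 * t)) t := by
      simpa using (hasDerivAt_pow 2 t).const_sub 1
    have h1 := (h0.rpow_const (p := ν + 1 / 2) (Or.inl hpos.ne')).mul (p.hasDerivAt t)
    refine h1.congr_deriv ?_
    have h2 : (1 - t ^ 2) ^ (ν + 1 / 2) = (1 - t ^ 2) ^ (ν - 1 / 2) * (1 - t ^ 2) := by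
      rw [← Real.rpow_add_one hpos.ne']; ring_nf
    rw [h2, show ν + 1 / 2 - 1 = ν - 1 / 2 by ring]
    simp
    ring

theorem gegenbauer_orthogonal {ν : ℝ} (hν : -(1 / 2) < ν) {l k : ℕ} (hlk : l ≠ k) :
    ∫ t in (-1 : ℝ)..1, (gegenbauer ν l).eval t * (gegenbauer ν k).eval t *
      (1 - t ^ 2) ^ (ν - 1 / 2) = 0 := by
  have h := gegenbauer_weight_parts hν (derivative (gegenbauer ν l) * gegenbauer ν k -
    gegenbauer ν l * derivative (gegenbauer ν k))
  have e : (1 - X ^ 2) * derivative (derivative (gegenbauer ν l) * gegenbauer ν k -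
      gegenbauer ν l * derivative (gegenbauer ν k)) - (2 * C ν + 1) * X *
      (derivative (gegenbauer ν l) * gegenbauer ν k -
      gegenbauer ν l * derivative (gegenbauer ν k)) =
      C (((k : ℝ) - l) * (k + l + 2 * ν)) * (gegenbauer ν l * gegenbauer ν k) := by
    simp only [derivative_mul, derivative_sub, C_mul, C_add, C_sub, map_natCast, map_ofNat]
    linear_combination gegenbauer ν k * gegenbauer_ode hν l - gegenbauer ν l * gegenbauer_ode hν k
  rw [e] at h
  simp only [eval_mul, eval_C, mul_assoc, intervalIntegral.integral_const_mul] at h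
  have hne : (k : ℝ) - l ≠ 0 := sub_ne_zero.2 (by exact_mod_cast hlk.symm)
  have hne' : (k : ℝ) + (l + 2 * ν) ≠ 0 := by
    have : (1 : ℝ) ≤ k + l := by
      have : 1 ≤ k + l := by omega
      exact_mod_cast this
    linarith
  simpa [hne, hne', mul_assoc, add_assoc] using h

theorem gegenbauer_weight_integral {ν : ℝ} (hν : -(1 / 2) < ν) :
    ∫ t in (-1 : ℝ)..1, (1 - t ^ 2) ^ (ν - 1 / 2) =
      2 ^ (2 * ν) * Real.Gamma (ν + 1 / 2) ^ 2 / Real.Gamma (2 * ν + 1) := by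
  have hb := ProbabilityTheory.beta_eq_betaIntegralReal (ν + 1 / 2) (ν + 1 / 2)
    (by linarith) (by linarith)
  have hb' : (Complex.betaIntegral ((ν + 1 / 2 : ℝ) : ℂ) ((ν + 1 / 2 : ℝ) : ℂ)) =
      ((∫ x in (0 : ℝ)..1, x ^ (ν - 1 / 2) * (1 - x) ^ (ν - 1 / 2) : ℝ) : ℂ) := by
    rw [Complex.betaIntegral, ← intervalIntegral.integral_ofReal]
    apply intervalIntegral.integral_congr
    intro x hx
    rw [Set.uIcc_of_le (by norm_num)] at hx
    simp only
    rw [Complex.ofReal_mul, Complex.ofReal_cpow hx.1, Complex.ofReal_cpow (by linarith [hx.2])]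
    push_cast
    ring_nf
  rw [hb', Complex.ofReal_re, ProbabilityTheory.beta] at hb
  have hs := intervalIntegral.integral_comp_mul_add (a := 0) (b := 1)
    (fun t : ℝ => (1 - t ^ 2) ^ (ν - 1 / 2)) (c := 2) two_ne_zero (-1)
  norm_num at hs
  have hs2 : ∫ x in (0 : ℝ)..1, (1 - (2 * x + -1) ^ 2) ^ (ν - 1 / 2) =
      4 ^ (ν - 1 / 2) * ∫ x in (0 : ℝ)..1, x ^ (ν - 1 / 2) * (1 - x) ^ (ν - 1 / 2) := by
    rw [← intervalIntegral.integral_const_mul]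
    apply intervalIntegral.integral_congr
    intro x hx
    rw [Set.uIcc_of_le (by norm_num)] at hx
    simp only
    rw [← Real.mul_rpow hx.1 (by linarith [hx.2]), ← Real.mul_rpow (by norm_num)
      (mul_nonneg hx.1 (by linarith [hx.2]))]
    ring_nf
  have h4 : (4 : ℝ) ^ (ν - 1 / 2) = 2 ^ (2 * ν) / 2 := by
    rw [show (4 : ℝ) = 2 ^ (2 : ℝ) by norm_num, ← Real.rpow_mul (by norm_num),
      show 2 * (ν - 1 / 2) = 2 * ν - 1 by ring, Real.rpow_sub_one (by norm_num)]
  rw [hs2, ← hb, h4] at hs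
  have e : ν + 1 / 2 + (ν + 1 / 2) = 2 * ν + 1 := by ring
  rw [e] at hs
  linear_combination (-2) * hs

theorem gegenbauer_norm_succ {ν : ℝ} (hν : -(1 / 2) < ν) (l : ℕ) :
    ∫ t in (-1 : ℝ)..1, (gegenbauer ν (l + 1)).eval t * (gegenbauer ν (l + 1)).eval t *
      (1 - t ^ 2) ^ (ν - 1 / 2) =
    2 ^ (2 * ν - 1) * Real.Gamma (ν + 1 / 2) ^ 2 * (l + 1).factorial /
      ((l + 1 + ν) * Real.Gamma (l + 1 + 2 * ν)) := by
  set I : ℝ[X] → ℝ := fun p => ∫ t in (-1 : ℝ)..1, p.eval t * (1 - t ^ 2) ^ (ν - 1 / 2) with hI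
  have hadd : ∀ p q, I (p + q) = I p + I q := by
    intro p q
    simp only [hI]
    rw [← intervalIntegral.integral_add (gegenbauer_weight_integrable hν p)
      (gegenbauer_weight_integrable hν q)]
    simp only [eval_add, add_mul]
  have hmul : ∀ (a : ℝ) p, I (C a * p) = a * I p := by
    intro a p
    simp only [hI, eval_mul, eval_C, mul_assoc, intervalIntegral.integral_const_mul]
  have horth : ∀ {l k : ℕ}, l ≠ k → I (gegenbauer ν l * gegenbauer ν k) = 0 := by
    intro l k h
    simpa only [hI, eval_mul] using gegenbauer_orthogonal hν h
  have hgoal : ∀ l, ∫ t in (-1 : ℝ)..1, (gegenbauer ν l).eval t * (gegenbauer ν l).eval t *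
      (1 - t ^ 2) ^ (ν - 1 / 2) = I (gegenbauer ν l * gegenbauer ν l) := by
    intro l
    simp only [hI, eval_mul]
  rw [hgoal]
  induction l with
  | zero =>
    have h1 : I ((1 - X ^ 2) * derivative X - (2 * C ν + 1) * X * X) = 0 :=
      gegenbauer_weight_parts hν X
    have e : ((1 - X ^ 2) * derivative X - (2 * C ν + 1) * X * X : ℝ[X]) =
        1 + C (-(2 * (ν + 1))) * (X * X) := by
      simp only [derivative_X, C_neg, C_mul, C_add, map_ofNat, C_1]
      ring
    have h0 : I 1 = 2 ^ (2 * ν) * Real.Gamma (ν + 1 / 2) ^ 2 / Real.Gamma (2 * ν + 1) := by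
      simp only [hI, eval_one, one_mul]
      exact gegenbauer_weight_integral hν
    rw [e, hadd, hmul, h0] at h1
    have hG : Real.Gamma (2 * ν + 1) ≠ 0 := (Real.Gamma_pos_of_pos (by linarith)).ne'
    have hn : ν + 1 ≠ 0 := by linarith
    have h2 : (2 : ℝ) ^ (2 * ν - 1) = 2 ^ (2 * ν) / 2 := Real.rpow_sub_one (by norm_num) _
    have e2 : ((0 : ℕ) : ℝ) + 1 + 2 * ν = 2 * ν + 1 := by push_cast; ring
    have e3 : ((0 : ℕ) : ℝ) + 1 + ν = ν + 1 := by push_cast; ring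
    rw [e2, e3, h2, eq_div_iff (mul_ne_zero hn hG)]
    simp only [zero_add, gegenbauer, Nat.factorial_one, Nat.cast_one, mul_one]
    generalize Real.Gamma (ν + 1 / 2) = g at h1 ⊢
    field_simp at h1
    linear_combination (-1 / 2) * h1
  | succ l ih =>
    have r1 := congrArg (fun p => I (p * gegenbauer ν (l + 2))) (gegenbauer_rec hν l)
    have r2 := congrArg (fun p => I (p * gegenbauer ν (l + 1))) (gegenbauer_rec hν (l + 1))
    beta_reduce at r1 r2
    have e1 : ((l : ℝ[X]) + 1 + 2 * C ν) * gegenbauer ν (l + 2) * gegenbauer ν (l + 2) =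
        C ((l : ℝ) + 1 + 2 * ν) * (gegenbauer ν (l + 2) * gegenbauer ν (l + 2)) := by
      simp only [C_add, C_mul, map_natCast, map_ofNat, C_1]; ring
    have e2 : (2 * ((l : ℝ[X]) + 1 + C ν) * X * gegenbauer ν (l + 1) -
        ((l : ℝ[X]) + 1) * gegenbauer ν l) * gegenbauer ν (l + 2) =
        C (2 * ((l : ℝ) + 1 + ν)) * (X * gegenbauer ν (l + 1) * gegenbauer ν (l + 2)) +
        C (-((l : ℝ) + 1)) * (gegenbauer ν l * gegenbauer ν (l + 2)) := by
      simp only [C_add, C_mul, C_neg, map_natCast, map_ofNat, C_1]; ring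
    have e3 : (((l + 1 : ℕ) : ℝ[X]) + 1 + 2 * C ν) * gegenbauer ν (l + 1 + 2) *
        gegenbauer ν (l + 1) =
        C ((l : ℝ) + 2 + 2 * ν) * (gegenbauer ν (l + 3) * gegenbauer ν (l + 1)) := by
      simp only [C_add, C_mul, map_natCast, map_ofNat, C_1]; push_cast; ring
    have e4 : (2 * (((l + 1 : ℕ) : ℝ[X]) + 1 + C ν) * X * gegenbauer ν (l + 1 + 1) -
        (((l + 1 : ℕ) : ℝ[X]) + 1) * gegenbauer ν (l + 1)) * gegenbauer ν (l + 1) =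
        C (2 * ((l : ℝ) + 2 + ν)) * (X * gegenbauer ν (l + 1) * gegenbauer ν (l + 2)) +
        C (-((l : ℝ) + 2)) * (gegenbauer ν (l + 1) * gegenbauer ν (l + 1)) := by
      simp only [C_add, C_mul, C_neg, map_natCast, map_ofNat, C_1]; push_cast; ring
    rw [e1, e2, hadd, hmul, hmul, hmul, horth (l := l) (k := l + 2) (by omega)] at r1
    rw [e3, e4, hadd, hmul, hmul, hmul, horth (l := l + 3) (k := l + 1) (by omega), ih] at r2
    have hl : (0 : ℝ) ≤ l := l.cast_nonneg
    have hs : (0 : ℝ) < l + 1 + 2 * ν := by linarith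
    have hG : Real.Gamma (l + 1 + 2 * ν) ≠ 0 := (Real.Gamma_pos_of_pos hs).ne'
    have n1 : (l : ℝ) + 1 + ν ≠ 0 := by linarith
    have n2 : (l : ℝ) + 2 + ν ≠ 0 := by linarith
    have hGs : Real.Gamma (((l + 1 : ℕ) : ℝ) + 1 + 2 * ν) =
        (l + 1 + 2 * ν) * Real.Gamma (l + 1 + 2 * ν) := by
      rw [← Real.Gamma_add_one hs.ne']; push_cast; ring_nf
    have e5 : ((l + 1 : ℕ) : ℝ) + 1 + ν = l + 2 + ν := by push_cast; ring
    rw [hGs, e5, Nat.factorial_succ (l + 1), eq_div_iff (by positivity)]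
    push_cast
    have e6 : l + 1 + 1 = l + 2 := rfl
    rw [e6]
    generalize Real.Gamma (ν + 1 / 2) = g at r2 ⊢
    generalize Real.Gamma (l + 1 + 2 * ν) = G at r2 hG ⊢
    generalize I (X * gegenbauer ν (l + 1) * gegenbauer ν (l + 2)) = J at r1 r2
    generalize I (gegenbauer ν (l + 2) * gegenbauer ν (l + 2)) = H at r1 ⊢
    field_simp at r2
    linear_combination ((l : ℝ) + 2 + ν) * G * r1 - r2

/-- The polynomials `gegenbauer ν` satisfy the orthogonality relations by which (together with
`deg = l` and the value `1` at `1`) they are usually characterized.  For `l = 0`, `ν = 0` the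
right-hand side has to be read as the limit `ν → 0`, which is why that case is left out here. -/
theorem gegenbauer_orthogonality {ν : ℝ} (hν : -(1 / 2) < ν) (l k : ℕ) (h0 : l = 0 → ν ≠ 0) :
    ∫ t in (-1 : ℝ)..1, (gegenbauer ν l).eval t * (gegenbauer ν k).eval t *
      (1 - t ^ 2) ^ (ν - 1 / 2) =
    if l = k then 2 ^ (2 * ν - 1) * Real.Gamma (ν + 1 / 2) ^ 2 * l.factorial /
      ((l + ν) * Real.Gamma (l + 2 * ν)) else 0 := by
  split_ifs with h
  · subst h
    rcases l with _ | l
    · have hn := h0 rfl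
      have hG := Real.Gamma_add_one (s := 2 * ν) (by simpa using hn)
      have h2 : (2 : ℝ) ^ (2 * ν - 1) = 2 ^ (2 * ν) / 2 := Real.rpow_sub_one (by norm_num) _
      have := gegenbauer_weight_integral hν
      rw [hG] at this
      simp only [gegenbauer, eval_one, one_mul, this, h2, Nat.factorial_zero, Nat.cast_zero,
        Nat.cast_one, zero_add, mul_one]
      have hp : 0 < Real.Gamma (2 * ν + 1) := Real.Gamma_pos_of_pos (by linarith)
      have : Real.Gamma (2 * ν) ≠ 0 := by
        intro h; rw [hG, h] at hp; simp at hp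
      field_simp
    · simpa using gegenbauer_norm_succ hν l
  · exact gegenbauer_orthogonal hν h

theorem gegenbauer_eval_one {ν : ℝ} (hν : -(1 / 2) < ν) (l : ℕ) :
    (gegenbauer ν l).eval 1 = 1 := by
  cases l with
  | zero => simp [gegenbauer]
  | succ l =>
    have h := congrArg (eval 1) (gegenbauer_deriv hν l).2
    have hl : (l : ℝ) + 1 ≠ 0 := by positivity
    induction l with
    | zero => simp [gegenbauer]
    | succ l ih =>
      have h' := ih (congrArg (eval 1) (gegenbauer_deriv hν l).2) (by positivity)
      simp only [eval_mul, eval_sub, eval_one, eval_pow, eval_X, one_pow, sub_self, zero_mul,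
        eval_add, eval_natCast, one_mul, h'] at h
      have := (mul_eq_zero.1 h.symm).resolve_left hl
      linarith

/-- The kernel `h_{m,λ}`; here `d - 3 = n - 4`, `d - 2 = n - 3`. -/
noncomputable def kernel (d m : ℕ) (lam x : ℝ) : ℝ :=
  if 1 - Real.tanh lam ≤ x ∧ x ≤ 1 + Real.tanh lam then
    (2 : ℝ) ^ (3 - (d : ℤ)) * Real.tanh lam ^ (2 - (d : ℤ)) * x *
      (gegenbauer (((d : ℝ) - 2) / 2) m).eval ((x ^ 2 + 1 - Real.tanh lam ^ 2) / (2 * x)) *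
      ((1 + Real.tanh lam - x) * (1 + Real.tanh lam + x) *
        (x - 1 + Real.tanh lam) * (x + 1 - Real.tanh lam)) ^ (((d : ℝ) - 3) / 2)
  else 0

/-- The truncated inversion integral `1/(2πi) ∫_{ϱ-iT}^{ϱ+iT} r^{-s} Q(s) ds`. -/
noncomputable def truncatedMellinInv (ϱ : ℝ) (Q : ℂ → ℂ) (r T : ℝ) : ℂ :=
  1 / (2 * Real.pi) * ∫ y in (-T)..T,
    (r : ℂ) ^ (-((ϱ : ℂ) + y * Complex.I)) * Q ((ϱ : ℂ) + y * Complex.I)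

/-- The quotient `M(K)(s) / M(h_{m,λ})(1 - s)` of Mellin transforms, where `K` is the harmonic
coefficient of the data of `f` at the spherical harmonic `Y` of degree `m`. -/
noncomputable def mellinQuotient {d : ℕ} (m : ℕ) (lam : ℝ)
    (f : EuclideanSpace ℝ (Fin (d + 1)) → ℂ)
    (Y : sphere (0 : EuclideanSpace ℝ (Fin d)) 1 → ℂ) (s : ℂ) : ℂ :=
  mellin (dataCoeff lam f Y) s / mellin (fun x => (kernel d m lam x : ℂ)) (1 - s)

end SpheroidTransform

open SpheroidTransform

/-! Inverse stereographic projection is conformal, so integrating `f` over `S_{ψ,c}` amounts to a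
weighted integral over a Euclidean sphere in `ℝⁿ⁻¹` with centre `c ψ` and radius `c tanh λ`. The
resulting operator commutes with rotations and dilations. Averaging a spherical harmonic over the
stabilizer of an axis gives a zonal harmonic polynomial, which the Gegenbauer equation determines up
to a factor; hence `K(c) = ∫ h(x) g(c x) dx` with `g(r) = (1 + r²)²⁻ⁿ f_{m,l}(r)`. The Mellin
transform turns this convolution into the product `M(K)(s) = M(h)(1 - s) M(g)(s)`. As `h` has
compact support in `(0, ∞)`, the first factor is a nonzero entire function, so it has only countably
many zeros. What remains is to invert the Mellin transform of `g`, which is Fourier inversion in a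
logarithmic variable: Dini's condition gives (i), Fejér's kernel gives (ii).
-/

namespace SpheroidTransform

/-! ### Dini's condition -/

section Dini

variable {E : Type*} [NormedAddCommGroup E] [NormedSpace ℝ E]

/-- Dini's condition at `x`, under which the Fourier inversion integral converges at `x`: the
difference quotients of `φ` at `x` are integrable near `x`. -/
def DiniAt (φ : ℝ → E) (x : ℝ) : Prop := IntegrableAtFilter (slope φ x) (𝓝 x)

theorem integrableAtFilter_smul_of_isBigO_one {x : ℝ} {b : ℝ → ℝ} {g : ℝ → E}
    (hb : AEStronglyMeasurable b) (hO : b =O[𝓝 x] fun _ => (1 : ℝ))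
    (hg : IntegrableAtFilter g (𝓝 x)) : IntegrableAtFilter (fun u => b u • g u) (𝓝 x) := by
  refine (hO.smul (Asymptotics.isBigO_refl g _)).integrableAtFilter ?_ (by simpa using hg)
  obtain ⟨s, hs, hgs⟩ := hg
  exact ⟨s, hs, hb.restrict.smul hgs.1⟩

theorem isBigO_slope_one {φ : ℝ → E} {x : ℝ} (h : DifferentiableAt ℝ φ x) :
    slope φ x =O[𝓝 x] fun _ => (1 : ℝ) := by
  rw [← pure_sup_nhdsNE, Asymptotics.isBigO_sup]
  refine ⟨.of_bound 0 ?_, h.hasDerivAt.tendsto_slope.isBigO_one ℝ⟩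
  simp

theorem aestronglyMeasurable_slope {φ : ℝ → E} (hφ : AEStronglyMeasurable φ) (x : ℝ) :
    AEStronglyMeasurable (slope φ x) := by
  rw [slope_fun_def]
  exact (Measurable.aestronglyMeasurable (by fun_prop)).fun_smul
    (hφ.sub aestronglyMeasurable_const)

theorem diniAt_of_differentiableAt {φ : ℝ → E} {x : ℝ} (hm : AEStronglyMeasurable φ)
    (h : DifferentiableAt ℝ φ x) : DiniAt φ x :=
  (isBigO_slope_one h).integrableAtFilter
    (aestronglyMeasurable_slope hm x).stronglyMeasurableAtFilter
    ⟨ball x 1, ball_mem_nhds x one_pos, by simp⟩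

namespace DiniAt

variable {φ ψ : ℝ → E} {x : ℝ}

theorem sub (hφ : DiniAt φ x) (hψ : DiniAt ψ x) : DiniAt (fun u => φ u - ψ u) x := by
  refine (IntegrableAtFilter.sub hφ hψ).congr (.of_forall fun u => ?_)
  simp only [Pi.sub_apply, slope_def_module, ← smul_sub]
  congr 1
  abel

theorem smul {b : ℝ → ℝ} (hb : Continuous b) (hbx : DifferentiableAt ℝ b x) (hφ : DiniAt φ x) :
    DiniAt (fun u => b u • φ u) x := by
  have h₁ := integrableAtFilter_smul_of_isBigO_one hb.aestronglyMeasurable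
    (hb.continuousAt.isBigO_one ℝ) hφ
  have h₂ := integrableAtFilter_smul_of_isBigO_one (g := fun _ => φ x)
    (aestronglyMeasurable_slope hb.aestronglyMeasurable x) (isBigO_slope_one hbx)
    ⟨ball x 1, ball_mem_nhds x one_pos, by simp⟩
  refine (h₁.add h₂).congr (.of_forall fun u => ?_)
  simp only [Pi.add_apply, slope_def_module, smul_sub, sub_smul, smul_eq_mul, mul_smul,
    smul_comm (b _)]
  abel

theorem comp {θ θ' : ℝ → ℝ} (hθ : ∀ v, HasDerivAt θ (θ' v) v) (hθ' : Continuous θ')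
    (hne : ∀ v, θ' v ≠ 0) (hinj : Function.Injective θ) (h : DiniAt φ (θ x)) :
    DiniAt (fun v => φ (θ v)) x := by
  obtain ⟨s, hs, hi⟩ := h
  obtain ⟨t, hts, hto, hxt⟩ := _root_.mem_nhds_iff.1 hs
  have hθc : Continuous θ := continuous_iff_continuousAt.2 fun v => (hθ v).continuousAt
  have hU : IsOpen (θ ⁻¹' t) := hto.preimage hθc
  have hpull : IntegrableAtFilter (fun v => |θ' v| • slope φ (θ x) (θ v)) (𝓝 x) := by
    refine ⟨θ ⁻¹' t, hU.mem_nhds hxt, ?_⟩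
    rw [← integrableOn_image_iff_integrableOn_abs_deriv_smul hU.measurableSet
      (fun v _ => (hθ v).hasDerivWithinAt) hinj.injOn]
    exact hi.mono_set ((image_preimage_subset θ t).trans hts)
  have hO : (fun v => |θ' v|⁻¹ * slope θ x v) =O[𝓝 x] fun _ => (1 : ℝ) := by
    simpa using ((hθ'.abs.inv₀ fun v => abs_ne_zero.2 (hne v)).continuousAt.isBigO_one ℝ).mul
      (isBigO_slope_one (hθ x).differentiableAt)
  have hm : AEStronglyMeasurable fun v => |θ' v|⁻¹ * slope θ x v :=
    (hθ'.abs.measurable.inv.aestronglyMeasurable).mul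
      (aestronglyMeasurable_slope hθc.aestronglyMeasurable x)
  refine (integrableAtFilter_smul_of_isBigO_one hm hO hpull).congr (.of_forall fun v => ?_)
  rcases eq_or_ne v x with rfl | hv
  · simp
  have h₁ : θ v - θ x ≠ 0 := sub_ne_zero.2 (hinj.ne hv)
  have h₂ : v - x ≠ 0 := sub_ne_zero.2 hv
  simp only [slope_def_module, smul_smul, smul_eq_mul]
  congr 1
  field [abs_ne_zero.2 (hne v)]

end DiniAt

theorem integrable_inv_smul_of_diniAt {H : ℝ → E} (hH : Integrable H) (h0 : H 0 = 0)
    (h : DiniAt H 0) : Integrable fun v : ℝ => v⁻¹ • H v := by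
  obtain ⟨s, hs, hi⟩ := h
  obtain ⟨δ, hδ, hsub⟩ := Metric.mem_nhds_iff.1 hs
  rw [← integrableOn_univ, ← union_compl_self (ball (0 : ℝ) δ)]
  refine IntegrableOn.union ?_ ?_
  · simpa [funext (slope_def_module H 0), h0] using hi.mono_set hsub
  · refine Integrable.mono (hH.norm.const_mul δ⁻¹).integrableOn
      (measurable_inv.aestronglyMeasurable.restrict.smul hH.1.restrict) ?_
    filter_upwards [ae_restrict_mem isOpen_ball.measurableSet.compl] with v hv
    have hδv : δ ≤ |v| := by simpa using hv
    rw [norm_smul, norm_mul, norm_inv, norm_norm, Real.norm_eq_abs,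
      Real.norm_of_nonneg (by positivity)]
    gcongr

end Dini

/-! ### Pointwise Fourier inversion -/

section Fourier

open scoped FourierTransform

/-- The Dirichlet kernel `sin (2πAv) / (πv)` of the Fourier integral. -/
noncomputable def dirichletKernel (A v : ℝ) : ℝ := 2 * A * Real.sinc (2 * Real.pi * A * v)

/-- The Fejér kernel `sin² (πAv) / (π²Av²)` of the Fourier integral. -/
noncomputable def fejerKernel (A v : ℝ) : ℝ := A * Real.sinc (Real.pi * (A * v)) ^ 2

theorem mul_sinc (x : ℝ) : x * Real.sinc x = Real.sin x := by
  rcases eq_or_ne x 0 with rfl | hx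
  · simp
  · rw [Real.sinc_of_ne_zero hx, mul_div_cancel₀ _ hx]

theorem abs_dirichletKernel_le (A v : ℝ) : |dirichletKernel A v| ≤ 2 * |A| := by
  rw [dirichletKernel, abs_mul, abs_mul, abs_two]
  exact mul_le_of_le_one_right (by positivity) (Real.abs_sinc_le_one _)

theorem integrable_dirichletKernel_smul {E : Type*} [NormedAddCommGroup E] [NormedSpace ℝ E]
    {G : ℝ → E} (hG : Integrable G) (A : ℝ) : Integrable fun v : ℝ => dirichletKernel A v • G v :=
  hG.bdd_smul (2 * |A|)
    (by unfold dirichletKernel; fun_prop : Continuous (dirichletKernel A)).aestronglyMeasurable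
    (.of_forall (abs_dirichletKernel_le A))

theorem integral_exp_eq_dirichletKernel (A v : ℝ) :
    ∫ w in (-A)..A, Complex.exp (((-2 * Real.pi * v * w : ℝ) : ℂ) * Complex.I) =
      dirichletKernel A v := by
  rcases eq_or_ne v 0 with rfl | hv
  · simp [dirichletKernel, two_mul]
  have hc : -2 * Real.pi * v ≠ 0 := by simp [hv, Real.pi_ne_zero]
  rw [intervalIntegral.integral_comp_mul_left
    (fun x : ℝ => Complex.exp ((x : ℂ) * Complex.I)) hc, mul_neg, integral_exp_mul_I_eq_sinc,
    show -2 * Real.pi * v * A = -(2 * Real.pi * A * v) by ring, Real.sinc_neg, dirichletKernel]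
  have hv' : (v : ℂ) ≠ 0 := Complex.ofReal_ne_zero.2 hv
  have hpi : (Real.pi : ℂ) ≠ 0 := Complex.ofReal_ne_zero.2 Real.pi_ne_zero
  rw [Complex.real_smul]
  push_cast
  field_simp

theorem two_pi_I_mul_dirichletKernel (A v : ℝ) :
    2 * Real.pi * Complex.I * (v * dirichletKernel A v) =
      Complex.exp (((-2 * Real.pi * v * -A : ℝ) : ℂ) * Complex.I) -
        Complex.exp (((-2 * Real.pi * v * A : ℝ) : ℂ) * Complex.I) := by
  have h : Real.pi * (v * dirichletKernel A v) = Real.sin (2 * Real.pi * A * v) := by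
    rw [← mul_sinc, dirichletKernel]
    ring
  have h₁ : ((-2 * Real.pi * v * -A : ℝ) : ℂ) * Complex.I =
      ((2 * Real.pi * A * v : ℝ) : ℂ) * Complex.I := by push_cast; ring
  have h₂ : ((-2 * Real.pi * v * A : ℝ) : ℂ) * Complex.I =
      -((2 * Real.pi * A * v : ℝ) : ℂ) * Complex.I := by push_cast; ring
  have hsin := Complex.two_sin ((2 * Real.pi * A * v : ℝ) : ℂ)
  rw [← Complex.ofReal_sin, ← h, Complex.ofReal_mul, Complex.ofReal_mul] at hsin
  rw [h₁, h₂]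
  generalize Complex.exp (((2 * Real.pi * A * v : ℝ) : ℂ) * Complex.I) = a at hsin ⊢
  generalize Complex.exp (-((2 * Real.pi * A * v : ℝ) : ℂ) * Complex.I) = b at hsin ⊢
  linear_combination Complex.I * hsin + (b - a) * Complex.I_sq

theorem integral_dirichletKernel (A v : ℝ) :
    ∫ a in (0 : ℝ)..A, dirichletKernel a v = A * fejerKernel A v := by
  rcases eq_or_ne v 0 with rfl | hv
  · simp only [dirichletKernel, fejerKernel, mul_zero, Real.sinc_zero, one_pow, mul_one]
    rw [intervalIntegral.integral_const_mul, integral_id]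
    ring
  have hsin (a : ℝ) : dirichletKernel a v = (Real.pi * v)⁻¹ * Real.sin (2 * Real.pi * v * a) := by
    rw [show 2 * Real.pi * v * a = 2 * Real.pi * a * v by ring, ← mul_sinc, dirichletKernel]
    field
  have hsq : A * fejerKernel A v = (Real.sin (Real.pi * (A * v)) / (Real.pi * v)) ^ 2 := by
    rw [← mul_sinc, fejerKernel]
    field
  simp_rw [hsin]
  rw [intervalIntegral.integral_const_mul, intervalIntegral.integral_comp_mul_left
    Real.sin (by positivity), hsq, integral_sin, mul_zero, Real.cos_zero,
    show 2 * Real.pi * v * A = 2 * (Real.pi * (A * v)) by ring, Real.cos_two_mul',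
    ← Real.sin_sq_add_cos_sq (Real.pi * (A * v)), smul_eq_mul]
  field

theorem one_add_sq_mul_sinc_sq_le (x : ℝ) : (1 + x ^ 2) * Real.sinc (Real.pi * x) ^ 2 ≤ 2 := by
  have h₁ : Real.sinc (Real.pi * x) ^ 2 ≤ 1 :=
    (sq_le_one_iff_abs_le_one _).2 (Real.abs_sinc_le_one _)
  have h₂ : Real.pi ^ 2 * (x ^ 2 * Real.sinc (Real.pi * x) ^ 2) ≤ 1 := by
    rw [← mul_pow, ← mul_pow, ← mul_assoc, mul_sinc]
    exact Real.sin_sq_le_one _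
  have h₃ : x ^ 2 * Real.sinc (Real.pi * x) ^ 2 ≤ 1 :=
    (le_mul_of_one_le_left (by positivity) (by nlinarith [Real.pi_gt_three])).trans h₂
  linarith

theorem sinc_sq_le (x : ℝ) : Real.sinc (Real.pi * x) ^ 2 ≤ 2 * (1 + x ^ 2)⁻¹ := by
  rw [← div_eq_mul_inv, le_div_iff₀' (by positivity)]
  exact one_add_sq_mul_sinc_sq_le x

theorem integrable_sinc_sq : Integrable fun x : ℝ => Real.sinc (Real.pi * x) ^ 2 := by
  refine (integrable_inv_one_add_sq.const_mul 2).mono' ?_ (.of_forall fun x => ?_)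
  · exact (by fun_prop : Continuous fun x : ℝ => Real.sinc (Real.pi * x) ^ 2).aestronglyMeasurable
  · rw [Real.norm_of_nonneg (sq_nonneg _)]
    exact sinc_sq_le x

theorem integral_sinc_sq_pos : 0 < ∫ x : ℝ, Real.sinc (Real.pi * x) ^ 2 :=
  integral_pos_of_integrable_nonneg_nonzero (x := 0) (by fun_prop) integrable_sinc_sq
    (fun _ => sq_nonneg _) (by simp)

theorem tendsto_norm_mul_sinc_sq :
    Tendsto (fun x : ℝ => ‖x‖ * Real.sinc (Real.pi * x) ^ 2) (Bornology.cobounded ℝ) (𝓝 0) := by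
  have h : Tendsto (fun x : ℝ => 2 * ‖x‖⁻¹) (Bornology.cobounded ℝ) (𝓝 0) := by
    simpa using (tendsto_inv_atTop_zero.comp (tendsto_norm_cobounded_atTop (E := ℝ))).const_mul 2
  refine squeeze_zero (fun x => by positivity) (fun x => ?_) h
  rcases eq_or_ne x 0 with rfl | hx
  · simp
  rw [← div_eq_mul_inv, le_div_iff₀ (norm_pos_iff.2 hx), mul_right_comm, ← sq, Real.norm_eq_abs,
    sq_abs]
  linarith [one_add_sq_mul_sinc_sq_le x, sq_nonneg (Real.sinc (Real.pi * x))]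

variable {E : Type*} [NormedAddCommGroup E] [NormedSpace ℂ E]

theorem integrable_exp_smul {G : ℝ → E} (hG : Integrable G) (w : ℝ) : Integrable fun v : ℝ =>
    Complex.exp (((-2 * Real.pi * v * w : ℝ) : ℂ) * Complex.I) • G v := by
  refine hG.mono (AEStronglyMeasurable.fun_smul ?_ hG.1)
    (.of_forall fun v => by simp [norm_smul, Complex.norm_exp])
  exact Continuous.aestronglyMeasurable (by fun_prop)

theorem tendsto_integral_dirichletKernel_smul {H : ℝ → E}
    (hH : Integrable fun v : ℝ => v⁻¹ • H v) :
    Tendsto (fun A : ℝ => ∫ v, dirichletKernel A v • H v) atTop (𝓝 0) := by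
  set K : ℝ → E := fun v => v⁻¹ • H v
  have hRL := Real.zero_at_infty_fourier K
  have hlim : Tendsto (fun A : ℝ => (2 * Real.pi * Complex.I)⁻¹ • (𝓕 K (-A) - 𝓕 K A)) atTop
      (𝓝 0) := by
    simpa using (((hRL.mono_left atBot_le_cocompact).comp tendsto_neg_atTop_atBot).sub
      (hRL.mono_left atTop_le_cocompact)).const_smul (2 * Real.pi * Complex.I)⁻¹
  refine hlim.congr fun A => ?_
  rw [Real.fourier_real_eq_integral_exp_smul, Real.fourier_real_eq_integral_exp_smul,
    ← integral_sub (integrable_exp_smul hH _) (integrable_exp_smul hH _), ← integral_smul]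
  refine integral_congr_ae ?_
  filter_upwards [Measure.ae_ne volume (0 : ℝ)] with v hv
  rw [← sub_smul, ← two_pi_I_mul_dirichletKernel, smul_smul,
    inv_mul_cancel_left₀ Complex.two_pi_I_ne_zero, ← Complex.ofReal_mul, Complex.coe_smul,
    smul_smul, mul_right_comm, mul_inv_cancel₀ hv, one_mul]

theorem continuous_integral_symm_interval {φ : ℝ → E} (hφ : Continuous φ) :
    Continuous fun a : ℝ => ∫ w in (-a)..a, φ w := by
  have hφint (a b : ℝ) : IntervalIntegrable φ volume a b := hφ.intervalIntegrable a b
  have hc := intervalIntegral.continuous_primitive hφint 0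
  refine (hc.sub (hc.comp continuous_neg)).congr fun a => ?_
  exact intervalIntegral.integral_interval_sub_left (hφint _ _) (hφint _ _)

variable [CompleteSpace E]

theorem intervalIntegral_integral_smul_swap {k : ℝ → ℝ → ℂ} (hk : Continuous (Function.uncurry k))
    {a b C : ℝ} (hC : ∀ w ∈ uIoc a b, ∀ v, ‖k w v‖ ≤ C) {F : ℝ → E} (hF : Integrable F) :
    ∫ w in a..b, ∫ v, k w v • F v = ∫ v, (∫ w in a..b, k w v) • F v := by
  have : IsFiniteMeasure (volume.restrict (uIoc a b)) := ⟨by simp [uIoc]⟩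
  have hmem : ∀ᵐ p : ℝ × ℝ ∂(volume.restrict (uIoc a b)).prod volume, p.1 ∈ uIoc a b :=
    Measure.quasiMeasurePreserving_fst.ae (ae_restrict_mem measurableSet_uIoc)
  rw [intervalIntegral_integral_swap]
  · simp_rw [intervalIntegral.integral_smul_const]
  · refine (Integrable.comp_snd hF (volume.restrict (uIoc a b))).bdd_smul C
      hk.aestronglyMeasurable (hmem.mono fun p hp => hC _ hp _)

theorem integral_fourier_eq_integral_dirichletKernel {F : ℝ → E} (hF : Integrable F) (A : ℝ) :
    ∫ w in (-A)..A, 𝓕 F w = ∫ v, dirichletKernel A v • F v := by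
  simp_rw [Real.fourier_real_eq_integral_exp_smul]
  rw [intervalIntegral_integral_smul_swap (C := 1)
    (k := fun w v => Complex.exp (((-2 * Real.pi * v * w : ℝ) : ℂ) * Complex.I)) (by fun_prop)
    (fun w _ v => by simp [Complex.norm_exp]) hF]
  simp_rw [integral_exp_eq_dirichletKernel, Complex.coe_smul]

theorem cesaro_integral_fourier_eq_integral_fejerKernel {F : ℝ → E} (hF : Integrable F) {A : ℝ}
    (hA : A ≠ 0) :
    A⁻¹ • ∫ a in (0 : ℝ)..A, ∫ w in (-a)..a, 𝓕 F w = ∫ v, fejerKernel A v • F v := by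
  have hbound : ∀ a ∈ uIoc 0 A, ∀ v, ‖(dirichletKernel a v : ℂ)‖ ≤ 2 * |A| := fun a ha v => by
    rw [Complex.norm_real]
    refine (abs_dirichletKernel_le a v).trans ?_
    simpa using abs_sub_left_of_mem_uIcc (uIoc_subset_uIcc ha)
  have hcont : Continuous (Function.uncurry fun a v => (dirichletKernel a v : ℂ)) := by
    unfold dirichletKernel
    fun_prop
  have h := intervalIntegral_integral_smul_swap hcont hbound hF
  simp_rw [Complex.coe_smul] at h
  simp_rw [integral_fourier_eq_integral_dirichletKernel hF, h, intervalIntegral.integral_ofReal,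
    integral_dirichletKernel, Complex.coe_smul, mul_smul, integral_smul]
  rw [inv_smul_smul₀ hA]

theorem tendsto_cesaro_of_tendsto {φ : ℝ → E} (hφ : Continuous φ) {C : ℝ} (hb : ∀ a, ‖φ a‖ ≤ C)
    {L : E} (h : Tendsto φ atTop (𝓝 L)) :
    Tendsto (fun A : ℝ => A⁻¹ • ∫ a in (0 : ℝ)..A, φ a) atTop (𝓝 L) := by
  have hlim : Tendsto (fun A : ℝ => ∫ u in (0 : ℝ)..1, φ (A * u)) atTop
      (𝓝 (∫ _ in (0 : ℝ)..1, L)) := by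
    apply intervalIntegral.tendsto_integral_filter_of_dominated_convergence (fun _ => C)
    · exact .of_forall fun A => (by fun_prop : Continuous fun u => φ (A * u)).aestronglyMeasurable
    · exact .of_forall fun A => .of_forall fun _ _ => hb _
    · simp
    · refine .of_forall fun u hu => ?_
      rw [uIoc_of_le zero_le_one] at hu
      exact h.comp (tendsto_id.atTop_mul_const hu.1)
  simp only [intervalIntegral.integral_const, sub_zero, one_smul] at hlim
  refine hlim.congr' ?_
  filter_upwards [eventually_ne_atTop 0] with A hA
  simp [intervalIntegral.integral_comp_mul_left φ hA]

/-- The Gaussian `exp (-πv²)`, which is its own Fourier transform: the test function for which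
Fourier inversion is known beforehand. -/
noncomputable def gaussianPi (v : ℝ) : ℂ := Complex.exp (-Real.pi * v ^ 2)

theorem gaussianPi_zero : gaussianPi 0 = 1 := by simp [gaussianPi]

theorem differentiable_gaussianPi : Differentiable ℝ gaussianPi := by
  have : Differentiable ℝ fun v : ℝ => (v : ℂ) := Complex.ofRealCLM.differentiable
  unfold gaussianPi
  fun_prop

theorem gaussianPi_eq_ofReal (v : ℝ) : gaussianPi v = (Real.exp (-Real.pi * v ^ 2) : ℝ) := by
  simp [gaussianPi]

theorem integrable_gaussianPi : Integrable gaussianPi := by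
  simp_rw [funext gaussianPi_eq_ofReal]
  exact (integrable_exp_neg_mul_sq Real.pi_pos).ofReal

theorem integral_gaussianPi : ∫ v, gaussianPi v = 1 := by
  simp_rw [gaussianPi_eq_ofReal]
  rw [integral_complex_ofReal, integral_gaussian, div_self Real.pi_ne_zero]
  simp

theorem fourier_gaussianPi : 𝓕 gaussianPi = gaussianPi := by
  have h := fourier_gaussian_pi (b := 1) (by simp)
  simp only [mul_one, Complex.one_cpow, div_one, one_mul] at h
  exact h

theorem tendsto_integral_fourier_gaussianPi :
    Tendsto (fun A : ℝ => ∫ w in (-A)..A, 𝓕 gaussianPi w) atTop (𝓝 1) := by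
  rw [fourier_gaussianPi, ← integral_gaussianPi]
  exact intervalIntegral_tendsto_integral integrable_gaussianPi tendsto_neg_atTop_atBot tendsto_id

theorem tendsto_cesaro_integral_fourier_gaussianPi :
    Tendsto (fun A : ℝ => A⁻¹ • ∫ a in (0 : ℝ)..A, ∫ w in (-a)..a, 𝓕 gaussianPi w) atTop
      (𝓝 1) := by
  refine tendsto_cesaro_of_tendsto (C := ∫ v, ‖gaussianPi v‖) ?_ (fun a => ?_)
    tendsto_integral_fourier_gaussianPi <;> rw [fourier_gaussianPi]
  · exact continuous_integral_symm_interval differentiable_gaussianPi.continuous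
  · exact intervalIntegral.norm_integral_le_integral_norm_uIoc.trans
      (setIntegral_le_integral integrable_gaussianPi.norm (.of_forall fun _ => norm_nonneg _))

theorem tendsto_integral_fejerKernel_smul {F : ℝ → E} (hF : Integrable F) (hc : ContinuousAt F 0) :
    Tendsto (fun A : ℝ => ∫ v, fejerKernel A v • F v) atTop
      (𝓝 ((∫ x : ℝ, Real.sinc (Real.pi * x) ^ 2) • F 0)) := by
  set C := ∫ x : ℝ, Real.sinc (Real.pi * x) ^ 2
  have hC : 0 < C := integral_sinc_sq_pos
  have h := tendsto_integral_comp_smul_smul_of_integrable (F := ℝ) (μ := volume)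
    (φ := fun x => C⁻¹ * Real.sinc (Real.pi * x) ^ 2) (fun x => by positivity)
    (by rw [integral_const_mul, inv_mul_cancel₀ hC.ne'])
    (by simpa [mul_left_comm] using tendsto_norm_mul_sinc_sq.const_mul C⁻¹) hF hc
  refine (h.const_smul C).congr fun A => ?_
  rw [← integral_smul]
  congr 1 with v
  rw [smul_smul, Module.finrank_self, pow_one, mul_left_comm, mul_inv_cancel_left₀ hC.ne',
    fejerKernel, smul_eq_mul]

theorem integral_sinc_sq : ∫ x : ℝ, Real.sinc (Real.pi * x) ^ 2 = 1 := by
  have h₁ := tendsto_integral_fejerKernel_smul integrable_gaussianPi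
    differentiable_gaussianPi.continuous.continuousAt
  have h₂ := tendsto_cesaro_integral_fourier_gaussianPi.congr' <|
    (eventually_ne_atTop 0).mono fun A hA =>
      cesaro_integral_fourier_eq_integral_fejerKernel integrable_gaussianPi hA
  have h := tendsto_nhds_unique h₁ h₂
  rw [gaussianPi_zero, Complex.real_smul, mul_one] at h
  exact_mod_cast h

theorem tendsto_cesaro_integral_fourier {F : ℝ → E} (hF : Integrable F) (hc : ContinuousAt F 0) :
    Tendsto (fun A : ℝ => A⁻¹ • ∫ a in (0 : ℝ)..A, ∫ w in (-a)..a, 𝓕 F w) atTop (𝓝 (F 0)) := by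
  have h := tendsto_integral_fejerKernel_smul hF hc
  rw [integral_sinc_sq, one_smul] at h
  refine h.congr' ?_
  filter_upwards [eventually_ne_atTop 0] with A hA
  rw [cesaro_integral_fourier_eq_integral_fejerKernel hF hA]

theorem tendsto_integral_fourier_of_diniAt {F : ℝ → E} (hF : Integrable F) (h : DiniAt F 0) :
    Tendsto (fun A : ℝ => ∫ w in (-A)..A, 𝓕 F w) atTop (𝓝 (F 0)) := by
  have hγ : Integrable fun v => gaussianPi v • F 0 := integrable_gaussianPi.smul_const _
  have hγD : DiniAt (fun v => gaussianPi v • F 0) 0 :=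
    diniAt_of_differentiableAt hγ.1 (differentiable_gaussianPi.differentiableAt.smul_const _)
  have hH := tendsto_integral_dirichletKernel_smul <|
    integrable_inv_smul_of_diniAt (hF.sub hγ) (by simp [gaussianPi_zero]) (h.sub hγD)
  have hlim := hH.add (tendsto_integral_fourier_gaussianPi.smul_const (F 0))
  rw [zero_add, one_smul] at hlim
  refine hlim.congr fun A => ?_
  simp only [integral_fourier_eq_integral_dirichletKernel hF,
    integral_fourier_eq_integral_dirichletKernel integrable_gaussianPi, Pi.sub_apply, smul_sub]
  rw [integral_sub (integrable_dirichletKernel_smul hF A) (integrable_dirichletKernel_smul hγ A),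
    ← integral_smul_const]
  simp_rw [smul_assoc]
  exact sub_add_cancel _ _

end Fourier

/-! ### Mellin inversion -/

section Mellin

open scoped FourierTransform

/-- The function on the line whose Fourier transform is, up to scaling, the integrand of the
inverse Mellin transform of `g` at `r` along `Re s = ϱ`. -/
noncomputable def mellinPullback (ϱ r : ℝ) (g : ℝ → ℂ) (u : ℝ) : ℂ :=
  Real.exp (-ϱ * u) • g (r * Real.exp (-u))

theorem mellinPullback_zero (ϱ r : ℝ) (g : ℝ → ℂ) : mellinPullback ϱ r g 0 = g r := by
  simp [mellinPullback]

theorem hasDerivAt_mul_exp_neg (r u : ℝ) :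
    HasDerivAt (fun u => r * Real.exp (-u)) (-(r * Real.exp (-u))) u := by
  simpa using ((hasDerivAt_neg u).exp).const_mul r

theorem range_exp_neg : range (fun u : ℝ => Real.exp (-u)) = Ioi 0 := by
  rw [← Real.range_exp]
  exact (Equiv.neg ℝ).surjective.range_comp Real.exp

theorem integrable_exp_smul_comp_exp_neg {g : ℝ → ℂ} {ϱ : ℝ} (hg : MellinConvergent g ϱ) :
    Integrable fun u : ℝ => Real.exp (-ϱ * u) • g (Real.exp (-u)) := by
  have hder (u : ℝ) : HasDerivWithinAt (fun u : ℝ => Real.exp (-u)) (-Real.exp (-u)) univ u := by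
    simpa only [mul_neg, mul_one] using (hasDerivAt_neg u).exp.hasDerivWithinAt
  rw [MellinConvergent, ← range_exp_neg, ← image_univ,
    integrableOn_image_iff_integrableOn_abs_deriv_smul MeasurableSet.univ (fun u _ => hder u)
      (fun a _ b _ h => by simpa using h), integrableOn_univ] at hg
  refine hg.congr (.of_forall fun u => ?_)
  beta_reduce
  rw [abs_neg, abs_of_pos (Real.exp_pos _), ← Complex.ofReal_one, ← Complex.ofReal_sub,
    ← Complex.ofReal_cpow (Real.exp_pos _).le, Complex.coe_smul, smul_smul, ← Real.exp_mul,
    ← Real.exp_add]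
  congr 2
  ring

theorem integrable_mellinPullback {g : ℝ → ℂ} {ϱ r : ℝ} (hr : 0 < r) (hg : MellinConvergent g ϱ) :
    Integrable (mellinPullback ϱ r g) :=
  integrable_exp_smul_comp_exp_neg ((MellinConvergent.comp_mul_left hr).2 hg)

theorem continuousAt_mellinPullback {g : ℝ → ℂ} {r : ℝ} (hg : ContinuousAt g r) (ϱ : ℝ) :
    ContinuousAt (mellinPullback ϱ r g) 0 :=
  ContinuousAt.smul (f := fun u => Real.exp (-ϱ * u)) (g := fun u => g (r * Real.exp (-u)))
    (by fun_prop) (ContinuousAt.comp (by simpa using hg) (by fun_prop))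

theorem DiniAt.mellinPullback {g : ℝ → ℂ} {r : ℝ} (hr : r ≠ 0) (hg : DiniAt g r) (ϱ : ℝ) :
    DiniAt (mellinPullback ϱ r g) 0 :=
  DiniAt.smul (by fun_prop) (by fun_prop) <|
    DiniAt.comp (hasDerivAt_mul_exp_neg r) (by fun_prop)
      (fun v => neg_ne_zero.2 (mul_ne_zero hr (Real.exp_pos _).ne'))
      (fun a b h => by simpa [hr] using h) (by simpa using hg)

theorem cpow_neg_mul_mellin_eq_fourier (g : ℝ → ℂ) {ϱ r : ℝ} (hr : 0 < r) (y : ℝ) :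
    (r : ℂ) ^ (-((ϱ : ℂ) + y * Complex.I)) * mellin g ((ϱ : ℂ) + y * Complex.I) =
      𝓕 (mellinPullback ϱ r g) (y / (2 * Real.pi)) := by
  rw [← smul_eq_mul, ← mellin_comp_mul_left g _ hr, mellin_eq_fourier]
  unfold mellinPullback
  simp

variable {g : ℝ → ℂ} {Q : ℂ → ℂ} {ϱ r : ℝ}

theorem truncatedMellinInv_eq (hr : 0 < r)
    (hQ : ∀ᵐ y : ℝ, Q ((ϱ : ℂ) + y * Complex.I) = mellin g ((ϱ : ℂ) + y * Complex.I)) (T : ℝ) :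
    truncatedMellinInv ϱ Q r T =
      ∫ w in (-(T / (2 * Real.pi)))..(T / (2 * Real.pi)), 𝓕 (mellinPullback ϱ r g) w := by
  have h : ∫ y in (-T)..T, (r : ℂ) ^ (-((ϱ : ℂ) + y * Complex.I)) * Q ((ϱ : ℂ) + y * Complex.I) =
      ∫ y in (-T)..T, 𝓕 (mellinPullback ϱ r g) (y / (2 * Real.pi)) := by
    apply intervalIntegral.integral_congr_ae
    filter_upwards [hQ] with y hy _
    rw [hy, cpow_neg_mul_mellin_eq_fourier g hr]
  have hpi : (Real.pi : ℂ) ≠ 0 := Complex.ofReal_ne_zero.2 Real.pi_ne_zero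
  rw [truncatedMellinInv, h, intervalIntegral.integral_comp_div _ (by positivity),
    Complex.real_smul, neg_div]
  push_cast
  field_simp

theorem tendsto_cesaro_truncatedMellinInv (hr : 0 < r)
    (hQ : ∀ᵐ y : ℝ, Q ((ϱ : ℂ) + y * Complex.I) = mellin g ((ϱ : ℂ) + y * Complex.I))
    (hg : MellinConvergent g ϱ) (hc : ContinuousAt g r) :
    Tendsto (fun T : ℝ => (1 / (T : ℂ)) * ∫ τ in (0 : ℝ)..T, truncatedMellinInv ϱ Q r τ) atTop
      (𝓝 (g r)) := by
  have h := (tendsto_cesaro_integral_fourier (integrable_mellinPullback hr hg)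
    (continuousAt_mellinPullback hc ϱ)).comp (tendsto_id.atTop_div_const Real.two_pi_pos)
  rw [mellinPullback_zero] at h
  refine h.congr fun T => ?_
  simp_rw [truncatedMellinInv_eq hr hQ]
  rw [intervalIntegral.integral_comp_div
    (fun a => ∫ w in (-a)..a, 𝓕 (mellinPullback ϱ r g) w) Real.two_pi_pos.ne', zero_div,
    one_div, ← Complex.ofReal_inv, ← Complex.real_smul, smul_smul, Function.comp_apply, id,
    inv_div, div_eq_inv_mul]

theorem tendsto_truncatedMellinInv_of_diniAt (hr : 0 < r)
    (hQ : ∀ᵐ y : ℝ, Q ((ϱ : ℂ) + y * Complex.I) = mellin g ((ϱ : ℂ) + y * Complex.I))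
    (hg : MellinConvergent g ϱ) (hD : DiniAt g r) :
    Tendsto (fun T : ℝ => truncatedMellinInv ϱ Q r T) atTop (𝓝 (g r)) := by
  have h := (tendsto_integral_fourier_of_diniAt (integrable_mellinPullback hr hg)
    (hD.mellinPullback hr.ne' ϱ)).comp (tendsto_id.atTop_div_const Real.two_pi_pos)
  rw [mellinPullback_zero] at h
  exact h.congr fun T => (truncatedMellinInv_eq hr hQ T).symm

theorem diniAt_iff {φ : ℝ → ℂ} {r : ℝ} :
    DiniAt φ r ↔ IntegrableAtFilter (fun u : ℝ => (φ u - φ r) / ((u - r : ℝ) : ℂ)) (𝓝 r) := by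
  have h : slope φ r = fun u => (φ u - φ r) / ((u - r : ℝ) : ℂ) := funext fun u => by
    rw [slope_def_module, Complex.real_smul, Complex.ofReal_inv, div_eq_inv_mul]
  rw [DiniAt, h]

end Mellin

/-! ### Mellin convolution -/

section Convolution

theorem norm_cpow_smul_mul_comp {h g : ℝ → ℂ} {s : ℂ} {c x : ℝ} (hc : 0 < c) (hx : 0 < x) :
    ‖(c : ℂ) ^ (s - 1) * (h x * g (c * x))‖ =
      x * ‖(x : ℂ) ^ ((1 - s) - 1) • h x‖ * ‖((c * x : ℝ) : ℂ) ^ (s - 1) • g (c * x)‖ := by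
  rw [norm_mul, norm_mul, norm_smul, norm_smul, Complex.norm_cpow_eq_rpow_re_of_pos hc,
    Complex.norm_cpow_eq_rpow_re_of_pos hx, Complex.norm_cpow_eq_rpow_re_of_pos (mul_pos hc hx),
    Real.mul_rpow hc.le hx.le]
  have hx1 : x * x ^ (1 - s - 1).re * x ^ (s - 1).re = 1 := by
    nth_rewrite 1 [← Real.rpow_one x]
    rw [← Real.rpow_add hx, ← Real.rpow_add hx]
    convert Real.rpow_zero x using 2
    simp only [Complex.sub_re, Complex.one_re]
    ring
  linear_combination (-(c ^ (s - 1).re * ‖h x‖ * ‖g (c * x)‖)) * hx1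

theorem integrable_mellin_convolution {h g : ℝ → ℂ} (hm : Measurable h) (gm : Measurable g) {s : ℂ}
    (hh : MellinConvergent h (1 - s)) (hg : MellinConvergent g s) :
    Integrable (fun p : ℝ × ℝ => (p.1 : ℂ) ^ (s - 1) * (h p.2 * g (p.1 * p.2)))
      ((volume.restrict (Ioi 0)).prod (volume.restrict (Ioi 0))) := by
  have hmeas : Measurable fun p : ℝ × ℝ => (p.1 : ℂ) ^ (s - 1) * (h p.2 * g (p.1 * p.2)) := by
    fun_prop
  rw [integrable_prod_iff' hmeas.aestronglyMeasurable]
  constructor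
  · filter_upwards [ae_restrict_mem measurableSet_Ioi] with x hx
    refine (((MellinConvergent.comp_mul_left hx).2 hg).const_mul (h x)).congr
      (.of_forall fun c => ?_)
    simp only [smul_eq_mul]
    rw [mul_comm x c]
    ring
  · refine (hh.norm.mul_const (∫ u in Ioi (0 : ℝ), ‖(u : ℂ) ^ (s - 1) • g u‖)).congr ?_
    filter_upwards [ae_restrict_mem measurableSet_Ioi] with x hx
    rw [setIntegral_congr_fun measurableSet_Ioi
      (fun c hc => norm_cpow_smul_mul_comp (h := h) (g := g) (s := s) hc hx), integral_const_mul,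
      integral_comp_mul_right_Ioi (fun u : ℝ => ‖(u : ℂ) ^ (s - 1) • g u‖) 0 hx,
      zero_mul, smul_eq_mul (a := x⁻¹)]
    field [(mem_Ioi.1 hx).ne']

theorem hasMellin_convolution {h g K : ℝ → ℂ} (hm : Measurable h) (gm : Measurable g) {s : ℂ}
    (hh : MellinConvergent h (1 - s)) (hg : MellinConvergent g s)
    (hK : ∀ c, 0 < c → K c = ∫ x in Ioi (0 : ℝ), h x * g (c * x)) :
    HasMellin K s (mellin h (1 - s) * mellin g s) := by
  have hinteg := integrable_mellin_convolution hm gm hh hg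
  have hKs : ∀ c ∈ Ioi (0 : ℝ), ∫ x in Ioi (0 : ℝ), (c : ℂ) ^ (s - 1) * (h x * g (c * x)) =
      (c : ℂ) ^ (s - 1) • K c := fun c hc => by
    rw [hK c hc, integral_const_mul, smul_eq_mul]
  have hgs : ∀ x ∈ Ioi (0 : ℝ), ∫ c in Ioi (0 : ℝ), (c : ℂ) ^ (s - 1) * (h x * g (c * x)) =
      ((x : ℂ) ^ ((1 - s) - 1) • h x) * mellin g s := fun x hx => by
    have hscale := mellin_comp_mul_right g s hx
    rw [mellin] at hscale
    simp only [smul_eq_mul, mul_left_comm _ (h x)] at hscale ⊢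
    rw [integral_const_mul, hscale, show 1 - s - 1 = -s by ring]
    ring
  refine ⟨IntegrableOn.congr_fun hinteg.integral_prod_left hKs measurableSet_Ioi, ?_⟩
  rw [mellin, ← setIntegral_congr_fun measurableSet_Ioi hKs, integral_integral_swap hinteg,
    setIntegral_congr_fun measurableSet_Ioi hgs, integral_mul_const]
  rfl

theorem exists_mellin_ne_zero {g : ℝ → ℂ} {ϱ r : ℝ} (hr : 0 < r) (hg : MellinConvergent g ϱ)
    (hc : ContinuousAt g r) (hgr : g r ≠ 0) : ∃ y : ℝ, mellin g ((ϱ : ℂ) + y * Complex.I) ≠ 0 := by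
  by_contra! h
  have hlim := tendsto_cesaro_truncatedMellinInv (Q := 0) hr (.of_forall fun y => (h y).symm) hg hc
  simp only [truncatedMellinInv, Pi.zero_apply, mul_zero, intervalIntegral.integral_zero] at hlim
  exact hgr (tendsto_nhds_unique hlim tendsto_const_nhds)

theorem ae_mellin_ne_zero {g : ℝ → ℂ} (hd : Differentiable ℂ (mellin g)) {ϱ y₀ : ℝ}
    (hy₀ : mellin g ((ϱ : ℂ) + y₀ * Complex.I) ≠ 0) :
    ∀ᵐ y : ℝ, mellin g ((ϱ : ℂ) + y * Complex.I) ≠ 0 := by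
  have hA : AnalyticOnNhd ℝ (fun y : ℝ => mellin g ((ϱ : ℂ) + y * Complex.I)) univ := fun y _ =>
    (hd.analyticAt _).restrictScalars.comp (f := fun y : ℝ => (ϱ : ℂ) + y * Complex.I)
      (analyticAt_const.add ((Complex.ofRealCLM.analyticAt y).mul analyticAt_const))
  rw [← Measure.restrict_univ (μ := volume)]
  exact ae_restrict_le_codiscreteWithin .univ (hA.preimage_zero_mem_codiscrete hy₀)

theorem isBigO_of_eventually_notMem_Icc {h : ℝ → ℂ} {a b : ℝ} {l : Filter ℝ}
    (hs : Function.support h ⊆ Icc a b) (hl : ∀ᶠ x in l, x ∉ Icc a b) (φ : ℝ → ℝ) :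
    h =O[l] φ := by
  refine Asymptotics.IsBigO.of_bound 0 (hl.mono fun x hx => ?_)
  simp [Function.notMem_support.1 fun h => hx (hs h)]

section CompactSupport

variable {h : ℝ → ℂ} {a b : ℝ}

theorem isBigO_atTop_of_support_subset_Icc (hs : Function.support h ⊆ Icc a b) (φ : ℝ → ℝ) :
    h =O[atTop] φ :=
  isBigO_of_eventually_notMem_Icc hs
    ((eventually_gt_atTop b).mono fun _ hx hx' => hx.not_ge hx'.2) φ

theorem isBigO_nhdsGT_of_support_subset_Icc (ha : 0 < a) (hs : Function.support h ⊆ Icc a b)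
    (φ : ℝ → ℝ) : h =O[𝓝[>] 0] φ :=
  isBigO_of_eventually_notMem_Icc hs
    (((eventually_lt_nhds ha).filter_mono nhdsWithin_le_nhds).mono
      fun _ hx hx' => hx.not_ge hx'.1) φ

theorem mellinConvergent_of_support_subset_Icc (hi : Integrable h) (ha : 0 < a)
    (hs : Function.support h ⊆ Icc a b) (s : ℂ) : MellinConvergent h s :=
  mellinConvergent_of_isBigO_rpow (hi.locallyIntegrable.locallyIntegrableOn _)
    (isBigO_atTop_of_support_subset_Icc hs _) (lt_add_one s.re)
    (isBigO_nhdsGT_of_support_subset_Icc ha hs _) (sub_one_lt s.re)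

theorem differentiable_mellin_of_support_subset_Icc (hi : Integrable h) (ha : 0 < a)
    (hs : Function.support h ⊆ Icc a b) : Differentiable ℂ (mellin h) := fun s =>
  mellin_differentiableAt_of_isBigO_rpow (hi.locallyIntegrable.locallyIntegrableOn _)
    (isBigO_atTop_of_support_subset_Icc hs _) (lt_add_one s.re)
    (isBigO_nhdsGT_of_support_subset_Icc ha hs _) (sub_one_lt s.re)

end CompactSupport

end Convolution

/-! ### The kernel -/

section Kernel

theorem tanh_pos {lam : ℝ} (hlam : 0 < lam) : 0 < Real.tanh lam := by
  rw [Real.tanh_eq_sinh_div_cosh]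
  exact div_pos (Real.sinh_pos_iff.2 hlam) (Real.cosh_pos _)

/-- The latitude `⟪ψ, ω⟫` at which the point `ψ + tω` has norm `x`, where `ψ` and `ω` are unit
vectors. -/
noncomputable def latitude (t x : ℝ) : ℝ := (x ^ 2 - 1 - t ^ 2) / (2 * t)

theorem sq_eq_of_latitude {t : ℝ} (ht : t ≠ 0) (x : ℝ) :
    1 + t ^ 2 + 2 * t * latitude t x = x ^ 2 := by
  unfold latitude
  field

theorem latitude_sqrt {t τ : ℝ} (ht : t ≠ 0) (h : 0 ≤ 1 + t ^ 2 + 2 * t * τ) :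
    latitude t √(1 + t ^ 2 + 2 * t * τ) = τ := by
  rw [latitude, Real.sq_sqrt h]
  field

theorem hasDerivAt_latitude (t x : ℝ) : HasDerivAt (latitude t) (x / t) x := by
  refine ((((hasDerivAt_pow 2 x).sub_const 1).sub_const (t ^ 2)).div_const (2 * t)).congr_deriv ?_
  rw [Nat.cast_ofNat, pow_one, mul_div_mul_left _ _ two_ne_zero]

theorem injOn_latitude {t : ℝ} (ht : t ≠ 0) : InjOn (latitude t) (Ici 0) := fun x hx y hy h => by
  rw [← sq_eq_sq₀ hx hy, ← sq_eq_of_latitude ht, h, sq_eq_of_latitude ht]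

theorem Ioo_subset_Ici {t : ℝ} (ht1 : t < 1) : Ioo (1 - t) (1 + t) ⊆ Ici 0 := fun _ hx =>
  (sub_pos.2 ht1).le.trans hx.1.le

theorem image_latitude {t : ℝ} (ht : 0 < t) (ht1 : t < 1) :
    latitude t '' Ioo (1 - t) (1 + t) = Ioo (-1) 1 := by
  ext τ
  constructor
  · rintro ⟨x, ⟨h₁, h₂⟩, rfl⟩
    have := sq_eq_of_latitude ht.ne' x
    constructor <;> nlinarith
  · rintro ⟨h₁, h₂⟩
    have hp : 0 ≤ 1 + t ^ 2 + 2 * t * τ := by nlinarith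
    refine ⟨_, ⟨Real.lt_sqrt_of_sq_lt ?_, (Real.sqrt_lt' ?_).2 ?_⟩, latitude_sqrt ht.ne' hp⟩ <;>
      nlinarith

theorem one_sub_latitude_sq_pos {t x : ℝ} (ht : 0 < t) (ht1 : t < 1)
    (hx : x ∈ Ioo (1 - t) (1 + t)) : 0 < 1 - latitude t x ^ 2 := by
  have h : latitude t x ∈ Ioo (-1 : ℝ) 1 := image_latitude ht ht1 ▸ mem_image_of_mem _ hx
  nlinarith [h.1, h.2]

theorem setIntegral_Ioo_eq_integral_latitude {E : Type*} [NormedAddCommGroup E] [NormedSpace ℝ E]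
    {t : ℝ} (ht : 0 < t) (ht1 : t < 1) (Φ : ℝ → E) :
    ∫ τ in Ioo (-1 : ℝ) 1, Φ τ = ∫ x in Ioo (1 - t) (1 + t), (x / t) • Φ (latitude t x) := by
  rw [← image_latitude ht ht1, integral_image_eq_integral_abs_deriv_smul measurableSet_Ioo
    (fun x _ => (hasDerivAt_latitude t x).hasDerivWithinAt)
    ((injOn_latitude ht.ne').mono (Ioo_subset_Ici ht1))]
  refine setIntegral_congr_fun measurableSet_Ioo fun x hx => ?_
  simp only [abs_of_nonneg (div_nonneg (Ioo_subset_Ici ht1 hx) ht.le)]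

theorem neg_half_lt_order {d : ℕ} (hd : 2 ≤ d) : -(1 / 2) < ((d : ℝ) - 2) / 2 := by
  have : (2 : ℝ) ≤ d := by exact_mod_cast hd
  linarith

variable {d : ℕ} (m : ℕ) {lam x : ℝ}

theorem four_factors_eq {t : ℝ} (ht : 0 < t) (x : ℝ) :
    (1 + t - x) * (1 + t + x) * (x - 1 + t) * (x + 1 - t) =
      (2 * t) ^ 2 * (1 - latitude t x ^ 2) := by
  unfold latitude
  field

theorem kernel_scale (d : ℕ) {t : ℝ} (ht : 0 < t) :
    (2 : ℝ) ^ (3 - (d : ℤ)) * t ^ (2 - (d : ℤ)) * ((2 * t) ^ 2) ^ (((d : ℝ) - 3) / 2) = t⁻¹ := by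
  have h : ((2 * t) ^ 2) ^ (((d : ℝ) - 3) / 2) = (2 * t) ^ ((d : ℤ) - 3) := by
    rw [← Real.rpow_natCast, ← Real.rpow_mul (by positivity), ← Real.rpow_intCast]
    congr 1
    push_cast
    ring
  rw [h, mul_zpow, mul_mul_mul_comm, ← zpow_add₀ two_ne_zero, ← zpow_add₀ ht.ne',
    show 3 - (d : ℤ) + (d - 3) = 0 by ring, show 2 - (d : ℤ) + (d - 3) = -1 by ring, zpow_zero,
    one_mul, zpow_neg_one]

theorem kernel_eq (hlam : 0 < lam) (hx : x ∈ Ioo (1 - Real.tanh lam) (1 + Real.tanh lam)) :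
    kernel d m lam x = x / Real.tanh lam *
      ((1 - latitude (Real.tanh lam) x ^ 2) ^ (((d : ℝ) - 3) / 2) *
        (gegenbauer (((d : ℝ) - 2) / 2) m).eval ((x ^ 2 + 1 - Real.tanh lam ^ 2) / (2 * x))) := by
  have ht := tanh_pos hlam
  rw [kernel, if_pos ⟨hx.1.le, hx.2.le⟩, four_factors_eq ht, Real.mul_rpow (by positivity)
    (one_sub_latitude_sq_pos ht (Real.tanh_lt_one lam) hx).le, div_eq_mul_inv x,
    ← kernel_scale d ht]
  ring

theorem support_kernel_subset : Function.support (fun x => (kernel d m lam x : ℂ)) ⊆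
    Icc (1 - Real.tanh lam) (1 + Real.tanh lam) := fun x hx => by
  contrapose! hx
  rw [Function.notMem_support, kernel, if_neg (by exact hx), Complex.ofReal_zero]

theorem continuousOn_eval_gegenbauer (ν : ℝ) {t : ℝ} (ht1 : t < 1) :
    ContinuousOn (fun x => (gegenbauer ν m).eval ((x ^ 2 + 1 - t ^ 2) / (2 * x)))
      (Icc (1 - t) (1 + t)) :=
  (gegenbauer ν m).continuous.comp_continuousOn <| ContinuousOn.div (by fun_prop) (by fun_prop)
    fun _ hx => mul_ne_zero two_ne_zero ((sub_pos.2 ht1).trans_le hx.1).ne'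

theorem measurable_kernel (d : ℕ) (lam : ℝ) : Measurable (kernel d m lam) := by
  have := (gegenbauer (((d : ℝ) - 2) / 2) m).continuous.measurable
  exact Measurable.ite (measurableSet_Icc (a := 1 - Real.tanh lam) (b := 1 + Real.tanh lam))
    (by fun_prop) measurable_const

theorem integrable_kernel (hd : 2 ≤ d) (hlam : 0 < lam) :
    Integrable fun x => (kernel d m lam x : ℂ) := by
  have ht := tanh_pos hlam
  have ht1 := Real.tanh_lt_one lam
  have hw := gegenbauer_weight_integrable (neg_half_lt_order hd) 1
  rw [intervalIntegrable_iff_integrableOn_Ioo_of_le (by norm_num), ← image_latitude ht ht1,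
    integrableOn_image_iff_integrableOn_abs_deriv_smul measurableSet_Ioo
      (fun x _ => (hasDerivAt_latitude _ x).hasDerivWithinAt)
      ((injOn_latitude ht.ne').mono (Ioo_subset_Ici ht1))] at hw
  rw [← integrableOn_iff_integrable_of_support_subset (support_kernel_subset m),
    integrableOn_Icc_iff_integrableOn_Ioo]
  have hK : IntegrableOn (kernel d m lam) (Ioo (1 - Real.tanh lam) (1 + Real.tanh lam)) := by
    refine (hw.mul_continuousOn_of_subset (continuousOn_eval_gegenbauer m (((d : ℝ) - 2) / 2) ht1)
      measurableSet_Ioo isCompact_Icc Ioo_subset_Icc_self).congr_fun (fun x hx => ?_)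
      measurableSet_Ioo
    simp only [eval_one, one_mul]
    rw [kernel_eq m hlam hx, abs_of_nonneg (div_nonneg (Ioo_subset_Ici ht1 hx) ht.le), smul_eq_mul,
      show ((d : ℝ) - 2) / 2 - 1 / 2 = ((d : ℝ) - 3) / 2 by ring, mul_assoc]
  exact Integrable.ofReal hK

theorem integral_kernel_mul (hlam : 0 < lam) (g : ℝ → ℂ) :
    ∫ x in Ioi (0 : ℝ), (kernel d m lam x : ℂ) * g x =
      ∫ τ in Ioo (-1 : ℝ) 1, (((1 - τ ^ 2) ^ (((d : ℝ) - 3) / 2) : ℝ) : ℂ) *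
        ((((gegenbauer (((d : ℝ) - 2) / 2) m).eval
          ((1 + Real.tanh lam * τ) / √(1 + Real.tanh lam ^ 2 + 2 * Real.tanh lam * τ)) : ℝ) : ℂ) *
          g (√(1 + Real.tanh lam ^ 2 + 2 * Real.tanh lam * τ))) := by
  have ht := tanh_pos hlam
  have ht1 := Real.tanh_lt_one lam
  have hsub : Icc (1 - Real.tanh lam) (1 + Real.tanh lam) ⊆ Ioi 0 := fun x hx =>
    (sub_pos.2 ht1).trans_le hx.1
  rw [setIntegral_Ioo_eq_integral_latitude ht ht1,
    setIntegral_eq_of_subset_of_forall_sdiff_eq_zero measurableSet_Ioi hsub fun x hx => by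
      rw [Function.notMem_support.1 fun h => hx.2 (support_kernel_subset m h), zero_mul],
    integral_Icc_eq_integral_Ioo]
  refine setIntegral_congr_fun measurableSet_Ioo fun x hx => ?_
  have hx0 : 0 < x := hsub (Ioo_subset_Icc_self hx)
  have harg : (1 + Real.tanh lam * latitude (Real.tanh lam) x) / x =
      (x ^ 2 + 1 - Real.tanh lam ^ 2) / (2 * x) := by
    rw [← sq_eq_of_latitude ht.ne' x]
    field
  rw [sq_eq_of_latitude ht.ne', Real.sqrt_sq hx0.le, harg, kernel_eq m hlam hx, Complex.real_smul]
  push_cast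
  ring

theorem continuousAt_kernel (hlam : 0 < lam)
    (hx : x ∈ Ioo (1 - Real.tanh lam) (1 + Real.tanh lam)) : ContinuousAt (kernel d m lam) x := by
  have hgeg := (continuousOn_eval_gegenbauer m (((d : ℝ) - 2) / 2)
    (Real.tanh_lt_one lam)).continuousAt (Icc_mem_nhds hx.1 hx.2)
  have hlat : ContinuousAt
      (fun x => (1 - latitude (Real.tanh lam) x ^ 2) ^ (((d : ℝ) - 3) / 2)) x :=
    (continuousAt_const.sub ((hasDerivAt_latitude _ x).continuousAt.pow 2)).rpow_const
      (.inl (one_sub_latitude_sq_pos (tanh_pos hlam) (Real.tanh_lt_one lam) hx).ne')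
  refine ((continuousAt_id.div_const (Real.tanh lam)).mul (hlat.mul hgeg)).congr ?_
  filter_upwards [Ioo_mem_nhds hx.1 hx.2] with y hy
  rw [kernel_eq m hlam hy]
  rfl

theorem exists_kernel_ne_zero (hd : 2 ≤ d) (hlam : 0 < lam) :
    ∃ x ∈ Ioo (1 - Real.tanh lam) (1 + Real.tanh lam), kernel d m lam x ≠ 0 := by
  have ht := tanh_pos hlam
  have ht1 := Real.tanh_lt_one lam
  set t := Real.tanh lam
  -- At the right end point of the support the argument of the Gegenbauer polynomial is `1`.
  have hlim : Tendsto (fun x => (gegenbauer (((d : ℝ) - 2) / 2) m).eval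
      ((x ^ 2 + 1 - t ^ 2) / (2 * x))) (𝓝[<] (1 + t)) (𝓝 1) := by
    have h := (continuousOn_eval_gegenbauer m (((d : ℝ) - 2) / 2) ht1) (1 + t)
      (right_mem_Icc.2 (by linarith))
    have harg : ((1 + t) ^ 2 + 1 - t ^ 2) / (2 * (1 + t)) = 1 := by field
    simp only [ContinuousWithinAt, harg, gegenbauer_eval_one (neg_half_lt_order hd)] at h
    exact h.mono_left (nhdsWithin_le_of_mem (Icc_mem_nhdsLT (by linarith : 1 - t < 1 + t)))
  obtain ⟨x, hgeg, hx⟩ := ((hlim.eventually_ne one_ne_zero).and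
    (Ioo_mem_nhdsLT (by linarith : 1 - t < 1 + t))).exists
  refine ⟨x, hx, ?_⟩
  rw [kernel_eq m hlam hx]
  have hx0 : 0 < x := (sub_pos.2 (Real.tanh_lt_one lam)).trans hx.1
  exact mul_ne_zero (div_ne_zero hx0.ne' ht.ne') (mul_ne_zero (Real.rpow_pos_of_pos
    (one_sub_latitude_sq_pos ht (Real.tanh_lt_one lam) hx) _).ne' hgeg)

theorem mellinConvergent_kernel (hd : 2 ≤ d) (hlam : 0 < lam) (s : ℂ) :
    MellinConvergent (fun x => (kernel d m lam x : ℂ)) s :=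
  mellinConvergent_of_support_subset_Icc (integrable_kernel m hd hlam)
    (sub_pos.2 (Real.tanh_lt_one lam)) (support_kernel_subset m) s

theorem ae_mellin_kernel_ne_zero (hd : 2 ≤ d) (hlam : 0 < lam) (ϱ : ℝ) :
    ∀ᵐ y : ℝ, mellin (fun x => (kernel d m lam x : ℂ)) (1 - ((ϱ : ℂ) + y * Complex.I)) ≠ 0 := by
  obtain ⟨x, hx, hne⟩ := exists_kernel_ne_zero m hd hlam
  have hx0 : 0 < x := (sub_pos.2 (Real.tanh_lt_one lam)).trans hx.1
  obtain ⟨y₀, hy₀⟩ := exists_mellin_ne_zero (ϱ := 1 - ϱ) hx0 (mellinConvergent_kernel m hd hlam _)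
    (continuousAt_kernel m hlam hx).ofReal (Complex.ofReal_ne_zero.2 hne)
  have h := ae_mellin_ne_zero (differentiable_mellin_of_support_subset_Icc
    (integrable_kernel m hd hlam) (sub_pos.2 (Real.tanh_lt_one lam)) (support_kernel_subset m)) hy₀
  filter_upwards [(Measure.measurePreserving_neg volume).quasiMeasurePreserving.ae h] with y hy
  convert hy using 2
  push_cast
  ring

end Kernel

/-! ### Hausdorff measure under maps with `edist (Φ x) (Φ y) = g x * g y * edist x y` -/

section Conformal

open scoped NNReal ENNReal

section Density

variable {X : Type*} [MeasurableSpace X] {μ ν : Measure X} {g : X → ℝ≥0} {N : ℕ}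

theorem measure_le_of_partition {S : ℤ → Set X} (hS : ∀ j, MeasurableSet (S j))
    (hdisj : Pairwise (Function.onFun Disjoint S)) (hcov : ⋃ j, S j = univ)
    (h : ∀ j A, MeasurableSet A → A ⊆ S j → μ A ≤ ν A) : μ ≤ ν := by
  refine Measure.le_iff.2 fun A hA => ?_
  have hd : Pairwise (Function.onFun Disjoint fun j => A ∩ S j) := fun i j hij =>
    (hdisj hij).mono inter_subset_right inter_subset_right
  rw [← inter_univ A, ← hcov, inter_iUnion, measure_iUnion hd fun j => hA.inter (hS j),
    measure_iUnion hd fun j => hA.inter (hS j)]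
  exact ENNReal.tsum_le_tsum fun j => h j _ (hA.inter (hS j)) inter_subset_right

theorem measure_le_of_mem_Ico_zpow (hg : Measurable g) (hpos : ∀ x, 0 < g x) {q : ℝ≥0}
    (hq : 1 < q) (h : ∀ (j : ℤ) A, MeasurableSet A → (∀ x ∈ A, g x ∈ Ico (q ^ j) (q ^ (j + 1))) →
      μ A ≤ ν A) : μ ≤ ν :=
  measure_le_of_partition (S := fun j => g ⁻¹' Ico (q ^ j) (q ^ (j + 1)))
    (fun _ => hg measurableSet_Ico)
    (fun _ _ hij => ((zpow_right_mono₀ hq.le).pairwise_disjoint_on_Ico_succ hij).preimage _)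
    (eq_univ_of_forall fun x => mem_iUnion.2 (exists_mem_Ico_zpow (hpos x) hq)) h

theorem le_of_forall_one_lt_pow_smul (N : ℕ)
    (h : ∀ q : ℝ≥0, 1 < q → μ ≤ ((q : ℝ≥0∞) ^ N) • ν) : μ ≤ ν := by
  intro A
  have hpow : Tendsto (fun q : ℝ≥0 => (q : ℝ≥0∞) ^ N) (𝓝 1) (𝓝 1) := by
    have hc : Continuous fun q : ℝ≥0 => (q : ℝ≥0∞) ^ N := by fun_prop
    simpa only [ENNReal.coe_one, one_pow] using hc.tendsto 1
  have hmul := ENNReal.Tendsto.mul_const (b := ν A)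
    (hpow.mono_left (nhdsWithin_le_nhds (s := Ioi 1))) (.inl one_ne_zero)
  rw [one_mul] at hmul
  refine ge_of_tendsto hmul ?_
  filter_upwards [self_mem_nhdsWithin] with q hq using h q hq A

theorem le_withDensity_pow (hg : Measurable g) (hpos : ∀ x, 0 < g x)
    (h : ∀ (a : ℝ≥0) A, (∀ x ∈ A, g x ≤ a) → μ A ≤ (a : ℝ≥0∞) ^ N * ν A) :
    μ ≤ ν.withDensity fun x => ((g x ^ N : ℝ≥0) : ℝ≥0∞) := by
  refine le_of_forall_one_lt_pow_smul N fun q hq =>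
    measure_le_of_mem_Ico_zpow hg hpos hq fun j A hA hAj => ?_
  rw [Measure.smul_apply, withDensity_apply _ hA, smul_eq_mul]
  calc μ A ≤ ((q ^ (j + 1) : ℝ≥0) : ℝ≥0∞) ^ N * ν A := h _ A fun x hx => (hAj x hx).2.le
    _ = (q : ℝ≥0∞) ^ N * ((((q ^ j) ^ N : ℝ≥0) : ℝ≥0∞) * ν A) := by
        rw [zpow_add_one₀ (zero_lt_one.trans hq).ne', ENNReal.coe_mul, mul_pow, ENNReal.coe_pow]
        ring
    _ ≤ (q : ℝ≥0∞) ^ N * ∫⁻ x in A, ((g x ^ N : ℝ≥0) : ℝ≥0∞) ∂ν := by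
        rw [← setLIntegral_const]
        gcongr (q : ℝ≥0∞) ^ N * ?_
        exact setLIntegral_mono' hA fun x hx =>
          ENNReal.coe_le_coe.2 (pow_le_pow_left' (hAj x hx).1 N)

theorem withDensity_pow_le (hg : Measurable g) (hpos : ∀ x, 0 < g x)
    (h : ∀ (a : ℝ≥0) A, 0 < a → (∀ x ∈ A, a ≤ g x) → (a : ℝ≥0∞) ^ N * ν A ≤ μ A) :
    (ν.withDensity fun x => ((g x ^ N : ℝ≥0) : ℝ≥0∞)) ≤ μ := by
  refine le_of_forall_one_lt_pow_smul N fun q hq =>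
    measure_le_of_mem_Ico_zpow hg hpos hq fun j A hA hAj => ?_
  rw [Measure.smul_apply, withDensity_apply _ hA, smul_eq_mul]
  have hq0 : 0 < q := zero_lt_one.trans hq
  calc ∫⁻ x in A, ((g x ^ N : ℝ≥0) : ℝ≥0∞) ∂ν
      ≤ ∫⁻ _ in A, (((q ^ (j + 1)) ^ N : ℝ≥0) : ℝ≥0∞) ∂ν := setLIntegral_mono' hA fun x hx =>
        ENNReal.coe_le_coe.2 (pow_le_pow_left' (hAj x hx).2.le N)
    _ = (q : ℝ≥0∞) ^ N * (((q ^ j : ℝ≥0) : ℝ≥0∞) ^ N * ν A) := by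
        rw [setLIntegral_const, zpow_add_one₀ hq0.ne', mul_pow, ENNReal.coe_mul, ENNReal.coe_pow,
          ENNReal.coe_pow]
        ring
    _ ≤ (q : ℝ≥0∞) ^ N * μ A := by
        gcongr
        exact h _ A (zpow_pos hq0 j) fun x hx => (hAj x hx).1

end Density

variable {X Y : Type*} [EMetricSpace X] [MeasurableSpace X] [BorelSpace X]
  [EMetricSpace Y] [MeasurableSpace Y] [BorelSpace Y] {Φ : X → Y} {g : X → ℝ≥0}

theorem hausdorffMeasure_image_le_of_edist
    (hΦ : ∀ x y, edist (Φ x) (Φ y) = g x * g y * edist x y) (k : ℕ) {B : Set X} {a : ℝ≥0}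
    (hB : ∀ x ∈ B, g x ≤ a) :
    μH[(k : ℝ)] (Φ '' B) ≤ (a : ℝ≥0∞) ^ (2 * k) * μH[(k : ℝ)] B := by
  have hL : LipschitzOnWith (a ^ 2) Φ B := fun x hx y hy => by
    rw [hΦ, ← ENNReal.coe_mul, sq]
    gcongr
    exacts [hB x hx, hB y hy]
  have h := hL.hausdorffMeasure_image_le (d := k) (by positivity)
  rwa [ENNReal.coe_pow, ENNReal.rpow_natCast, ← pow_mul] at h

theorem le_hausdorffMeasure_image_of_edist
    (hΦ : ∀ x y, edist (Φ x) (Φ y) = g x * g y * edist x y) (k : ℕ) {B : Set X} {a : ℝ≥0}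
    (ha : 0 < a) (hB : ∀ x ∈ B, a ≤ g x) :
    (a : ℝ≥0∞) ^ (2 * k) * μH[(k : ℝ)] B ≤ μH[(k : ℝ)] (Φ '' B) := by
  have hL : AntilipschitzWith (a ^ 2)⁻¹ (B.domRestrict Φ) := fun x y => by
    rw [ENNReal.coe_inv (pow_pos ha 2).ne', mul_comm, ← div_eq_mul_inv,
      ENNReal.le_div_iff_mul_le (.inl (by simpa using ha.ne')) (.inl ENNReal.coe_ne_top), mul_comm,
      domRestrict_apply, domRestrict_apply, hΦ, sq, Subtype.edist_eq, ENNReal.coe_mul]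
    gcongr
    exacts [hB x x.2, hB y y.2]
  have h := hL.le_hausdorffMeasure_image (d := k) (by positivity) univ
  rw [image_univ, range_domRestrict,
    ← isometry_subtype_coe.hausdorffMeasure_image (.inl k.cast_nonneg), image_univ,
    Subtype.range_coe, ENNReal.coe_inv (pow_pos ha 2).ne', ENNReal.coe_pow,
    ENNReal.rpow_natCast, ← ENNReal.inv_pow, ← pow_mul, mul_comm, ← div_eq_mul_inv] at h
  rw [mul_comm]
  exact ENNReal.mul_le_of_le_div h

theorem comap_hausdorffMeasure_of_edist (hemb : MeasurableEmbedding Φ) (hg : Measurable g)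
    (hpos : ∀ x, 0 < g x) (hΦ : ∀ x y, edist (Φ x) (Φ y) = g x * g y * edist x y) (k : ℕ) :
    (μH[(k : ℝ)] : Measure Y).comap Φ =
      (μH[(k : ℝ)] : Measure X).withDensity fun x => ((g x ^ (2 * k) : ℝ≥0) : ℝ≥0∞) := by
  refine le_antisymm (le_withDensity_pow hg hpos fun a A hA => ?_)
    (withDensity_pow_le hg hpos fun a A ha hA => ?_)
  · rw [hemb.comap_apply]
    exact hausdorffMeasure_image_le_of_edist hΦ k hA
  · rw [hemb.comap_apply]
    exact le_hausdorffMeasure_image_of_edist hΦ k ha hA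

theorem comap_euclideanHausdorffMeasure_of_edist (hemb : MeasurableEmbedding Φ) (hg : Measurable g)
    (hpos : ∀ x, 0 < g x) (hΦ : ∀ x y, edist (Φ x) (Φ y) = g x * g y * edist x y) (k : ℕ) :
    (μHE[k] : Measure Y).comap Φ =
      (μHE[k] : Measure X).withDensity fun x => ((g x ^ (2 * k) : ℝ≥0) : ℝ≥0∞) := by
  ext A hA
  rw [hemb.comap_apply, Measure.euclideanHausdorffMeasure_def,
    Measure.euclideanHausdorffMeasure_def, withDensity_apply _ hA, Measure.restrict_smul,
    lintegral_smul_measure, Measure.smul_apply, ← withDensity_apply _ hA,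
    ← comap_hausdorffMeasure_of_edist hemb hg hpos hΦ, hemb.comap_apply]

theorem setIntegral_range_euclideanHausdorffMeasure {E : Type*} [NormedAddCommGroup E]
    [NormedSpace ℝ E] (hemb : MeasurableEmbedding Φ) (hg : Measurable g) (hpos : ∀ x, 0 < g x)
    (hΦ : ∀ x y, edist (Φ x) (Φ y) = g x * g y * edist x y) (k : ℕ) (f : Y → E) :
    ∫ y in range Φ, f y ∂μHE[k] = ∫ x, ((g x : ℝ) ^ (2 * k)) • f (Φ x) ∂μHE[k] := by
  rw [← hemb.map_comap, hemb.integral_map, comap_euclideanHausdorffMeasure_of_edist hemb hg hpos hΦ,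
    integral_withDensity_eq_integral_smul (hg.pow_const _)]
  simp only [NNReal.smul_def, NNReal.coe_pow]

end Conformal

/-! ### Stereographic projection and the subspheres -/

section Stereographic

variable {d : ℕ} {lam : ℝ} {p x : EuclideanSpace ℝ (Fin (d + 1))}

/-- The orthogonal projection of `ℝ^{d+1} = ℝ^d × ℝ` onto `ℝ^d`, along the distinguished axis. -/
noncomputable def horizontal (x : EuclideanSpace ℝ (Fin (d + 1))) : EuclideanSpace ℝ (Fin d) :=
  WithLp.toLp 2 fun i => x i.castSucc

theorem ext_horizontal {x y : EuclideanSpace ℝ (Fin (d + 1))} (h : horizontal x = horizontal y)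
    (hl : x (Fin.last d) = y (Fin.last d)) : x = y := by
  ext i
  exact Fin.lastCases hl (fun i => congrArg (fun v : EuclideanSpace ℝ (Fin d) => v i) h) i

theorem inner_eq_inner_horizontal_add (x y : EuclideanSpace ℝ (Fin (d + 1))) :
    inner ℝ x y = inner ℝ (horizontal x) (horizontal y) + x (Fin.last d) * y (Fin.last d) := by
  simp only [PiLp.inner_apply, Fin.sum_univ_castSucc, horizontal, RCLike.inner_apply, conj_trivial,
    mul_comm]

theorem norm_sq_eq_norm_horizontal_sq_add (x : EuclideanSpace ℝ (Fin (d + 1))) :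
    ‖x‖ ^ 2 = ‖horizontal x‖ ^ 2 + x (Fin.last d) ^ 2 := by
  rw [← real_inner_self_eq_norm_sq, inner_eq_inner_horizontal_add, real_inner_self_eq_norm_sq, ← sq]

theorem norm_horizontal_sq (hx : ‖x‖ = 1) : ‖horizontal x‖ ^ 2 = 1 - x (Fin.last d) ^ 2 := by
  rw [eq_sub_iff_add_eq, ← norm_sq_eq_norm_horizontal_sq_add, hx, one_pow]

theorem horizontal_eq_zero (hx : ‖x‖ = 1) (hl : x (Fin.last d) ^ 2 = 1) : horizontal x = 0 := by
  rw [← norm_eq_zero, ← sq_eq_zero_iff, norm_horizontal_sq hx, hl, sub_self]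

theorem stereoInv_last (y : EuclideanSpace ℝ (Fin d)) :
    stereoInv y (Fin.last d) = (-1 + ‖y‖ ^ 2) / (1 + ‖y‖ ^ 2) := by
  simp [stereoInv]

theorem horizontal_stereoInv (y : EuclideanSpace ℝ (Fin d)) :
    horizontal (stereoInv y) = (2 / (1 + ‖y‖ ^ 2)) • y := by
  ext i
  simp [horizontal, stereoInv, div_mul_eq_mul_div]

theorem continuous_stereoInv : Continuous (stereoInv (d := d)) := by
  have hne : ∀ y : EuclideanSpace ℝ (Fin d), 1 + ‖y‖ ^ 2 ≠ 0 := fun y => by positivity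
  refine (PiLp.continuous_toLp 2 _).comp (continuous_pi fun i => ?_)
  refine Fin.lastCases ?_ (fun i => ?_) i
  · simp only [Fin.snoc_last]
    exact Continuous.div (by fun_prop) (by fun_prop) hne
  · simp only [Fin.snoc_castSucc]
    exact Continuous.div (by fun_prop) (by fun_prop) hne

theorem inner_stereoInv (x y : EuclideanSpace ℝ (Fin d)) :
    inner ℝ (stereoInv x) (stereoInv y) =
      (4 * inner ℝ x y + (-1 + ‖x‖ ^ 2) * (-1 + ‖y‖ ^ 2)) / ((1 + ‖x‖ ^ 2) * (1 + ‖y‖ ^ 2)) := by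
  rw [inner_eq_inner_horizontal_add, horizontal_stereoInv, horizontal_stereoInv,
    real_inner_smul_left, real_inner_smul_right, stereoInv_last, stereoInv_last]
  field

theorem norm_stereoInv (x : EuclideanSpace ℝ (Fin d)) : ‖stereoInv x‖ = 1 := by
  rw [← pow_eq_one_iff_of_nonneg (norm_nonneg _) two_ne_zero, ← real_inner_self_eq_norm_sq,
    inner_stereoInv, real_inner_self_eq_norm_sq]
  field

theorem norm_stereoInv_sub_sq (x y : EuclideanSpace ℝ (Fin d)) :
    ‖stereoInv x - stereoInv y‖ ^ 2 =
      4 * ‖x - y‖ ^ 2 / ((1 + ‖x‖ ^ 2) * (1 + ‖y‖ ^ 2)) := by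
  rw [norm_sub_sq_real, norm_sub_sq_real, inner_stereoInv, norm_stereoInv, norm_stereoInv]
  field

theorem dist_stereoInv (x y : EuclideanSpace ℝ (Fin d)) :
    dist (stereoInv x) (stereoInv y) = √(2 / (1 + ‖x‖ ^ 2)) * √(2 / (1 + ‖y‖ ^ 2)) * dist x y := by
  rw [dist_eq_norm, dist_eq_norm, ← sq_eq_sq₀ (norm_nonneg _) (by positivity), mul_pow, mul_pow,
    Real.sq_sqrt (by positivity), Real.sq_sqrt (by positivity), norm_stereoInv_sub_sq]
  field

theorem injective_stereoInv : Function.Injective (stereoInv (d := d)) := fun x y h => by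
  have hdist := dist_stereoInv x y
  rw [h, dist_self] at hdist
  exact dist_eq_zero.1 ((mul_eq_zero.1 hdist.symm).resolve_left (by positivity))

theorem exists_stereoInv_eq (hx : ‖x‖ = 1) (hl : x (Fin.last d) ≠ 1) : ∃ y, stereoInv y = x := by
  have hne : 1 - x (Fin.last d) ≠ 0 := sub_ne_zero.2 hl.symm
  refine ⟨(1 - x (Fin.last d))⁻¹ • horizontal x, ?_⟩
  have hnorm : 1 + ‖(1 - x (Fin.last d))⁻¹ • horizontal x‖ ^ 2 = 2 / (1 - x (Fin.last d)) := by
    rw [norm_smul, mul_pow, norm_horizontal_sq hx, norm_inv, Real.norm_eq_abs, inv_pow, sq_abs]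
    field
  refine ext_horizontal ?_ ?_
  · rw [horizontal_stereoInv, hnorm, smul_smul, div_div_cancel₀ two_ne_zero, mul_inv_cancel₀ hne,
      one_smul]
  · rw [stereoInv_last, hnorm, eq_sub_of_add_eq' hnorm]
    field

theorem tanh_sq_mul_cosh_sq (lam : ℝ) :
    Real.tanh lam ^ 2 * Real.cosh lam ^ 2 = Real.cosh lam ^ 2 - 1 := by
  rw [Real.tanh_eq_sinh_div_cosh, div_pow, div_mul_cancel₀ _ (pow_ne_zero 2 (Real.cosh_pos _).ne'),
    Real.sinh_sq]

theorem mem_spheroid_iff : p ∈ spheroid d lam ↔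
    p (Fin.last d) ^ 2 + ‖horizontal p‖ ^ 2 * Real.cosh lam ^ 2 = 1 := by
  rw [EuclideanSpace.real_norm_sq_eq]
  rfl

theorem mem_tangentHyperplane_iff (hp : p ∈ spheroid d lam) : x ∈ tangentHyperplane lam p ↔
    p (Fin.last d) * x (Fin.last d) +
      Real.cosh lam ^ 2 * inner ℝ (horizontal p) (horizontal x) = 1 := by
  have hinner : ∑ i : Fin d, p i.castSucc * (x i.castSucc - p i.castSucc) =
      inner ℝ (horizontal p) (horizontal x) - ‖horizontal p‖ ^ 2 := by
    rw [← real_inner_self_eq_norm_sq, ← inner_sub_right]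
    simp only [PiLp.inner_apply, horizontal, PiLp.sub_apply, RCLike.inner_apply, conj_trivial,
      mul_comm]
  rw [mem_spheroid_iff] at hp
  rw [tangentHyperplane, mem_ofPred_eq, hinner]
  constructor <;> intro h
  · linear_combination h + hp
  · linear_combination h - hp

theorem eq_of_mem_tangentHyperplane_of_horizontal_eq_zero (hp : p ∈ spheroid d lam)
    (h0 : horizontal p = 0) (hx : ‖x‖ = 1) (hxp : x ∈ tangentHyperplane lam p) : x = p := by
  rw [mem_tangentHyperplane_iff hp, h0, inner_zero_left, mul_zero, add_zero] at hxp
  rw [mem_spheroid_iff, h0, norm_zero, zero_pow two_ne_zero, zero_mul, add_zero] at hp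
  have hl : x (Fin.last d) = p (Fin.last d) := by
    linear_combination p (Fin.last d) * hxp - x (Fin.last d) * hp
  exact ext_horizontal (by rw [h0, horizontal_eq_zero hx (hl ▸ hp)]) hl

/-- The point of the spheroid at which the tangent hyperplane cuts out `subsphere lam ψ c`. -/
noncomputable def tangentPoint (lam : ℝ) (ψ : sphere (0 : EuclideanSpace ℝ (Fin d)) 1) (c : ℝ) :
    EuclideanSpace ℝ (Fin (d + 1)) :=
  WithLp.toLp 2 (Fin.snoc (α := fun _ => ℝ)
    (fun i => 2 * c / (c ^ 2 + Real.cosh lam ^ 2) * (ψ : EuclideanSpace ℝ (Fin d)) i)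
    ((c ^ 2 - Real.cosh lam ^ 2) / (c ^ 2 + Real.cosh lam ^ 2)))

variable (ψ : sphere (0 : EuclideanSpace ℝ (Fin d)) 1)

theorem tangentPoint_last (lam c : ℝ) : tangentPoint lam ψ c (Fin.last d) =
    (c ^ 2 - Real.cosh lam ^ 2) / (c ^ 2 + Real.cosh lam ^ 2) := by
  simp [tangentPoint]

theorem horizontal_tangentPoint (lam c : ℝ) : horizontal (tangentPoint lam ψ c) =
    (2 * c / (c ^ 2 + Real.cosh lam ^ 2)) • (ψ : EuclideanSpace ℝ (Fin d)) := by
  ext i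
  simp [horizontal, tangentPoint]

theorem tangentPoint_mem_spheroid (lam c : ℝ) : tangentPoint lam ψ c ∈ spheroid d lam := by
  rw [mem_spheroid_iff, tangentPoint_last, horizontal_tangentPoint, norm_smul,
    norm_eq_of_mem_sphere, mul_one, Real.norm_eq_abs, sq_abs]
  field

theorem stereoInv_mem_tangentHyperplane_iff (lam c : ℝ) (y : EuclideanSpace ℝ (Fin d)) :
    stereoInv y ∈ tangentHyperplane lam (tangentPoint lam ψ c) ↔
      ‖y - c • (ψ : EuclideanSpace ℝ (Fin d))‖ ^ 2 = (c * Real.tanh lam) ^ 2 := by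
  have hDY : (c ^ 2 + Real.cosh lam ^ 2) * (1 + ‖y‖ ^ 2) ≠ 0 := by positivity
  rw [mem_tangentHyperplane_iff (tangentPoint_mem_spheroid ψ lam c), tangentPoint_last,
    horizontal_tangentPoint, stereoInv_last, horizontal_stereoInv, real_inner_smul_left,
    real_inner_smul_right, norm_sub_sq_real, real_inner_smul_right, real_inner_comm, norm_smul,
    norm_eq_of_mem_sphere, mul_one, Real.norm_eq_abs, sq_abs]
  have htc := tanh_sq_mul_cosh_sq lam
  generalize inner ℝ y (ψ : EuclideanSpace ℝ (Fin d)) = s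
  rw [← mul_left_inj' hDY, one_mul]
  field_simp
  constructor <;> intro h
  · refine mul_left_cancel₀ (by positivity : 2 * Real.cosh lam ^ 2 ≠ 0) ?_
    linear_combination -h - 2 * c ^ 2 * htc
  · linear_combination -(2 * Real.cosh lam ^ 2) * h - 2 * c ^ 2 * htc

theorem last_ne_one_of_mem_tangentHyperplane {c : ℝ} (hx : ‖x‖ = 1)
    (hxt : x ∈ tangentHyperplane lam (tangentPoint lam ψ c)) : x (Fin.last d) ≠ 1 := fun hl => by
  have hC := Real.cosh_pos lam
  rw [mem_tangentHyperplane_iff (tangentPoint_mem_spheroid ψ lam c), hl,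
    horizontal_eq_zero hx (by rw [hl, one_pow]), inner_zero_right, mul_one, mul_zero, add_zero,
    tangentPoint_last, div_eq_one_iff_eq (by positivity)] at hxt
  nlinarith

theorem sphere_inter_tangentHyperplane (hlam : 0 < lam) {c : ℝ} (hc : 0 < c) :
    sphere 0 1 ∩ tangentHyperplane lam (tangentPoint lam ψ c) = subsphere lam ψ c := by
  have hct : 0 < c * Real.tanh lam := mul_pos hc (tanh_pos hlam)
  ext x
  constructor
  · rintro ⟨hx, hxt⟩
    rw [mem_sphere_zero_iff_norm] at hx
    obtain ⟨y, rfl⟩ := exists_stereoInv_eq hx (last_ne_one_of_mem_tangentHyperplane ψ hx hxt)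
    rw [stereoInv_mem_tangentHyperplane_iff, sq_eq_sq₀ (norm_nonneg _) hct.le] at hxt
    refine ⟨⟨(c * Real.tanh lam)⁻¹ • (y - c • (ψ : EuclideanSpace ℝ (Fin d))), ?_⟩, ?_⟩
    · rw [mem_sphere_zero_iff_norm, norm_smul, hxt, norm_inv, Real.norm_of_nonneg hct.le,
        inv_mul_cancel₀ hct.ne']
    · simp only [smul_inv_smul₀ hct.ne', add_sub_cancel]
  · rintro ⟨ω, rfl⟩
    refine ⟨mem_sphere_zero_iff_norm.2 (norm_stereoInv _), ?_⟩
    rw [stereoInv_mem_tangentHyperplane_iff, add_sub_cancel_left, norm_smul, norm_eq_of_mem_sphere,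
      mul_one, Real.norm_eq_abs, sq_abs]

theorem exists_tangentPoint_eq (hp : p ∈ spheroid d lam) (hne : horizontal p ≠ 0) :
    ∃ (ψ : sphere (0 : EuclideanSpace ℝ (Fin d)) 1) (c : ℝ), 0 < c ∧ tangentPoint lam ψ c = p := by
  have hC := Real.cosh_pos lam
  have hn : 0 < ‖horizontal p‖ := norm_pos_iff.2 hne
  rw [mem_spheroid_iff] at hp
  have hlt : 0 < 1 - p (Fin.last d) := by
    have : 0 < ‖horizontal p‖ ^ 2 * Real.cosh lam ^ 2 := by positivity
    nlinarith
  set c := Real.cosh lam ^ 2 * ‖horizontal p‖ / (1 - p (Fin.last d)) with hc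
  have hadd : c ^ 2 + Real.cosh lam ^ 2 = 2 * Real.cosh lam ^ 2 / (1 - p (Fin.last d)) := by
    rw [hc]
    field_simp
    linear_combination hp
  have hsub : c ^ 2 - Real.cosh lam ^ 2 =
      2 * Real.cosh lam ^ 2 * p (Fin.last d) / (1 - p (Fin.last d)) := by
    rw [hc]
    field_simp
    linear_combination hp
  refine ⟨⟨‖horizontal p‖⁻¹ • horizontal p, by simp [norm_smul, hn.ne']⟩, c, by positivity,
    ext_horizontal ?_ ?_⟩
  · rw [horizontal_tangentPoint, hadd, hc, smul_smul]
    convert one_smul ℝ (horizontal p)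
    field
  · rw [tangentPoint_last, hadd, hsub]
    field

theorem nontrivial_subsphere (hlam : 0 < lam) {c : ℝ} (hc : 0 < c) :
    (subsphere lam ψ c).Nontrivial := by
  refine ⟨_, ⟨ψ, rfl⟩, _, ⟨-ψ, rfl⟩, fun h => ne_neg_of_mem_unit_sphere ℝ ψ (Subtype.ext ?_)⟩
  exact smul_right_injective _ (mul_pos hc (tanh_pos hlam)).ne'
    (add_left_cancel (injective_stereoInv h))

theorem tangentSubspheres_eq (hlam : 0 < lam) :
    tangentSubspheres d lam = {T | ∃ (ψ : sphere (0 : EuclideanSpace ℝ (Fin d)) 1) (c : ℝ),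
      0 < c ∧ T = subsphere lam ψ c} := by
  ext T
  constructor
  · rintro ⟨p, hp, rfl, x, ⟨hx, hxp⟩, y, ⟨hy, hyp⟩, hxy⟩
    rw [mem_sphere_zero_iff_norm] at hx hy
    have hne : horizontal p ≠ 0 := fun h0 => hxy <|
      (eq_of_mem_tangentHyperplane_of_horizontal_eq_zero hp h0 hx hxp).trans
        (eq_of_mem_tangentHyperplane_of_horizontal_eq_zero hp h0 hy hyp).symm
    obtain ⟨ψ, c, hc, rfl⟩ := exists_tangentPoint_eq hp hne
    exact ⟨ψ, c, hc, sphere_inter_tangentHyperplane ψ hlam hc⟩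
  · rintro ⟨ψ, c, hc, rfl⟩
    exact ⟨tangentPoint lam ψ c, tangentPoint_mem_spheroid ψ lam c,
      (sphere_inter_tangentHyperplane ψ hlam hc).symm, nontrivial_subsphere ψ hlam hc⟩

end Stereographic

/-! ### The orthogonal group and rotation-invariant measures on the sphere -/

section Rotations

open scoped Pointwise

instance continuousStar_clm (E : Type*) [NormedAddCommGroup E] [InnerProductSpace ℝ E]
    [CompleteSpace E] : ContinuousStar (E →L[ℝ] E) :=
  ⟨(ContinuousLinearMap.adjoint (𝕜 := ℝ) (E := E) (F := E)).continuous⟩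

/-- The orthogonal group of `ℝ^d`. -/
abbrev OrthGroup (d : ℕ) : Type :=
  unitary (EuclideanSpace ℝ (Fin d) →L[ℝ] EuclideanSpace ℝ (Fin d))

instance compactSpace_orthGroup (d : ℕ) : CompactSpace (OrthGroup d) := by
  refine isCompact_iff_compactSpace.1 (isCompact_of_isClosed_isBounded isClosed_unitary
    (isBounded_closedBall (x := 0) (r := 1) |>.subset fun u hu => ?_))
  rw [mem_closedBall_zero_iff]
  refine ContinuousLinearMap.opNorm_le_bound _ zero_le_one fun x => ?_
  rw [one_mul]
  exact (Unitary.norm_map ⟨u, hu⟩ x).le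

/-- The normalized Haar measure of the orthogonal group. -/
noncomputable def haarProb (d : ℕ) : Measure (OrthGroup d) := Measure.haarMeasure ⊤

instance isProbabilityMeasure_haarProb (d : ℕ) : IsProbabilityMeasure (haarProb d) :=
  ⟨by
    rw [haarProb, ← TopologicalSpace.PositiveCompacts.coe_top]
    exact Measure.haarMeasure_self⟩

instance isMulLeftInvariant_haarProb (d : ℕ) : (haarProb d).IsMulLeftInvariant :=
  Measure.isMulLeftInvariant_haarMeasure _

variable {d : ℕ}

theorem inv_apply_apply (R : OrthGroup d) (x : EuclideanSpace ℝ (Fin d)) :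
    R⁻¹.1 (R.1 x) = x :=
  DFunLike.congr_fun (Unitary.star_mul_self_of_mem R.2) x

/-- The action of the orthogonal group on the unit sphere. -/
noncomputable def rotate (R : OrthGroup d) (x : sphere (0 : EuclideanSpace ℝ (Fin d)) 1) :
    sphere (0 : EuclideanSpace ℝ (Fin d)) 1 :=
  ⟨(R : EuclideanSpace ℝ (Fin d) →L[ℝ] _) x, by simp [Unitary.norm_map]⟩

theorem coe_rotate (R : OrthGroup d) (x : sphere (0 : EuclideanSpace ℝ (Fin d)) 1) :
    (rotate R x : EuclideanSpace ℝ (Fin d)) = (R : EuclideanSpace ℝ (Fin d) →L[ℝ] _) x := rfl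

theorem rotate_mul (R T : OrthGroup d) (x : sphere (0 : EuclideanSpace ℝ (Fin d)) 1) :
    rotate (R * T) x = rotate R (rotate T x) := rfl

theorem rotate_one (x : sphere (0 : EuclideanSpace ℝ (Fin d)) 1) : rotate 1 x = x := rfl

theorem rotate_inv_rotate (R : OrthGroup d) (x : sphere (0 : EuclideanSpace ℝ (Fin d)) 1) :
    rotate R⁻¹ (rotate R x) = x := by
  rw [← rotate_mul, inv_mul_cancel, rotate_one]

theorem rotate_rotate_inv (R : OrthGroup d) (x : sphere (0 : EuclideanSpace ℝ (Fin d)) 1) :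
    rotate R (rotate R⁻¹ x) = x := by
  rw [← rotate_mul, mul_inv_cancel, rotate_one]

theorem continuous_rotate : Continuous fun p : OrthGroup d ×
    sphere (0 : EuclideanSpace ℝ (Fin d)) 1 => rotate p.1 p.2 := by
  refine Continuous.subtype_mk ?_ _
  exact (continuous_subtype_val.comp continuous_fst).clm_apply
    (continuous_subtype_val.comp continuous_snd)

theorem continuous_rotate_inv : Continuous fun p : OrthGroup d ×
    sphere (0 : EuclideanSpace ℝ (Fin d)) 1 => rotate p.1⁻¹ p.2 :=
  continuous_rotate.comp (continuous_fst.inv.prodMk continuous_snd)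

theorem exists_orthGroup_map_eq {x y : EuclideanSpace ℝ (Fin d)} (h : ‖x‖ = ‖y‖) :
    ∃ R : OrthGroup d, (R : EuclideanSpace ℝ (Fin d) →L[ℝ] _) x = y ∧
      ∀ z, inner ℝ (x - y) z = 0 → (R : EuclideanSpace ℝ (Fin d) →L[ℝ] _) z = z := by
  refine ⟨Unitary.linearIsometryEquiv.symm ((ℝ ∙ (x - y))ᗮ.reflection), ?_, fun z hz => ?_⟩
  · exact Submodule.reflection_sub h
  · exact Submodule.reflection_mem_subspace_eq_self
      (Submodule.mem_orthogonal_singleton_iff_inner_right.2 hz)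

theorem exists_rotate_eq (x y : sphere (0 : EuclideanSpace ℝ (Fin d)) 1) :
    ∃ R : OrthGroup d, rotate R x = y := by
  obtain ⟨R, hR, -⟩ := exists_orthGroup_map_eq (x := (x : EuclideanSpace ℝ (Fin d))) (y := y)
    (by rw [norm_eq_of_mem_sphere, norm_eq_of_mem_sphere])
  exact ⟨R, Subtype.ext hR⟩

/-- `rotate R` as an isometry of the sphere onto itself. -/
noncomputable def rotateIsometryEquiv (R : OrthGroup d) :
    sphere (0 : EuclideanSpace ℝ (Fin d)) 1 ≃ᵢ sphere (0 : EuclideanSpace ℝ (Fin d)) 1 :=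
  IsometryEquiv.mk' (rotate R) (rotate R⁻¹) (rotate_rotate_inv R) <|
    Isometry.of_dist_eq fun x y => by
      rw [Subtype.dist_eq, Subtype.dist_eq, coe_rotate, coe_rotate, dist_eq_norm, dist_eq_norm,
        ← map_sub, Unitary.norm_map]

theorem measurableEmbedding_rotate (R : OrthGroup d) : MeasurableEmbedding (rotate R) :=
  (rotateIsometryEquiv R).toHomeomorph.measurableEmbedding

/-- Invariance of a measure on the sphere under the full orthogonal group. -/
def IsRotationInvariant (ν : Measure (sphere (0 : EuclideanSpace ℝ (Fin d)) 1)) : Prop :=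
  ∀ R : OrthGroup d, MeasurePreserving (rotate R) ν ν

theorem coe_image_preimage_rotate (R : OrthGroup d)
    (s : Set (sphere (0 : EuclideanSpace ℝ (Fin d)) 1)) :
    ((↑) '' (rotate R ⁻¹' s) : Set (EuclideanSpace ℝ (Fin d))) =
      Unitary.linearIsometryEquiv R⁻¹ '' ((↑) '' s) := by
  rw [image_image, show rotate R ⁻¹' s = rotate R⁻¹ '' s from
    ((rotateIsometryEquiv R).toEquiv.image_symm_eq_preimage s).symm, image_image]
  rfl

theorem isRotationInvariant_toSphere : IsRotationInvariant
    (volume : Measure (EuclideanSpace ℝ (Fin d))).toSphere := by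
  intro R
  have hR := (measurableEmbedding_rotate R).measurable
  refine ⟨hR, Measure.ext fun s hs => ?_⟩
  set L := Unitary.linearIsometryEquiv R⁻¹
  have hcone : Ioo (0 : ℝ) 1 • L '' ((↑) '' s) = L '' (Ioo (0 : ℝ) 1 • ((↑) '' s)) :=
    (image_image2_distrib_right fun a x => map_smul L a x).symm
  rw [Measure.map_apply hR hs, Measure.toSphere_apply' _ hs, Measure.toSphere_apply' _ (hR hs),
    coe_image_preimage_rotate, hcone, LinearIsometryEquiv.image_eq_preimage_symm]
  exact congrArg _ (L.symm.measurePreserving.measure_preimage_equiv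
    (f := L.symm.toMeasurableEquiv) _)

theorem isRotationInvariant_euclideanHausdorffMeasure (k : ℕ) : IsRotationInvariant
    (μHE[k] : Measure (sphere (0 : EuclideanSpace ℝ (Fin d)) 1)) :=
  fun R => (rotateIsometryEquiv R).measurePreserving_euclideanHausdorffMeasure k

theorem integral_haarProb_rotate_inv {G : Type*} [NormedAddCommGroup G] [NormedSpace ℝ G]
    (F : sphere (0 : EuclideanSpace ℝ (Fin d)) 1 → G)
    (x y : sphere (0 : EuclideanSpace ℝ (Fin d)) 1) :
    ∫ R, F (rotate R⁻¹ x) ∂haarProb d = ∫ R, F (rotate R⁻¹ y) ∂haarProb d := by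
  obtain ⟨T, hT⟩ := exists_rotate_eq x y
  rw [← integral_mul_left_eq_self (fun R => F (rotate R⁻¹ y)) T]
  simp_rw [mul_inv_rev, rotate_mul, ← hT, rotate_inv_rotate]

theorem integral_eq_haar_average {G : Type*} [NormedAddCommGroup G] [NormedSpace ℝ G]
    [CompleteSpace G] {ν : Measure (sphere (0 : EuclideanSpace ℝ (Fin d)) 1)} [IsFiniteMeasure ν]
    (hν : IsRotationInvariant ν) {F : sphere (0 : EuclideanSpace ℝ (Fin d)) 1 → G}
    (hF : Continuous F) (e : sphere (0 : EuclideanSpace ℝ (Fin d)) 1) :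
    ∫ x, F x ∂ν = ν.real univ • ∫ R, F (rotate R⁻¹ e) ∂haarProb d := by
  have hc : Continuous fun p : OrthGroup d × sphere (0 : EuclideanSpace ℝ (Fin d)) 1 =>
      F (rotate p.1⁻¹ p.2) := hF.comp continuous_rotate_inv
  have hinteg : Integrable (Function.uncurry fun (R : OrthGroup d)
      (x : sphere (0 : EuclideanSpace ℝ (Fin d)) 1) => F (rotate R⁻¹ x)) ((haarProb d).prod ν) :=
    hc.integrable_of_hasCompactSupport (HasCompactSupport.of_compactSpace _)
  calc ∫ x, F x ∂ν = ∫ _R : OrthGroup d, ∫ x, F x ∂ν ∂haarProb d := by simp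
    _ = ∫ R : OrthGroup d, ∫ x, F (rotate R⁻¹ x) ∂ν ∂haarProb d := by
      congr 1
      ext R
      rw [(hν R⁻¹).integral_comp (measurableEmbedding_rotate R⁻¹)]
    _ = ∫ x, ∫ R : OrthGroup d, F (rotate R⁻¹ x) ∂haarProb d ∂ν := integral_integral_swap hinteg
    _ = ∫ _x, ∫ R : OrthGroup d, F (rotate R⁻¹ e) ∂haarProb d ∂ν := by
      congr 1
      ext x
      exact integral_haarProb_rotate_inv F x e
    _ = _ := by rw [integral_const]

theorem eq_of_isRotationInvariant {μ ν : Measure (sphere (0 : EuclideanSpace ℝ (Fin d)) 1)}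
    [IsFiniteMeasure μ] [IsFiniteMeasure ν] (hμ : IsRotationInvariant μ)
    (hν : IsRotationInvariant ν) (h : μ.real univ = ν.real univ) : μ = ν := by
  rcases isEmpty_or_nonempty (sphere (0 : EuclideanSpace ℝ (Fin d)) 1) with he | ⟨⟨e⟩⟩
  · exact Measure.eq_zero_of_isEmpty μ |>.trans (Measure.eq_zero_of_isEmpty ν).symm
  refine ext_of_forall_integral_eq_of_IsFiniteMeasure fun F => ?_
  rw [integral_eq_haar_average hμ F.continuous e, integral_eq_haar_average hν F.continuous e, h]

end Rotations

/-! ### The surface measure of the sphere -/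

section SphereMeasure

open scoped NNReal ENNReal

theorem edist_eq_of_dist_eq {X Y : Type*} [PseudoMetricSpace X] [PseudoMetricSpace Y] {a b : Y}
    {x y : X} {g h : ℝ≥0} (hd : dist a b = g * h * dist x y) :
    edist a b = g * h * edist x y := by
  rw [edist_nndist, edist_nndist, ← ENNReal.coe_mul, ← ENNReal.coe_mul, ENNReal.coe_inj]
  exact NNReal.eq (by push_cast; exact hd)

variable {n : ℕ} {G : Type*} [NormedAddCommGroup G] [NormedSpace ℝ G]

/-- The inverse stereographic projection with values in the unit sphere. -/
noncomputable def stereoSphere (y : EuclideanSpace ℝ (Fin n)) :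
    sphere (0 : EuclideanSpace ℝ (Fin (n + 1))) 1 :=
  ⟨stereoInv y, by simp [norm_stereoInv]⟩

/-- The square root of the conformal factor of the inverse stereographic projection. -/
noncomputable def stereoFactor (y : EuclideanSpace ℝ (Fin n)) : ℝ≥0 :=
  ⟨√(2 / (1 + ‖y‖ ^ 2)), Real.sqrt_nonneg _⟩

theorem stereoFactor_pow (y : EuclideanSpace ℝ (Fin n)) (k : ℕ) :
    (stereoFactor y : ℝ) ^ (2 * k) = (2 / (1 + ‖y‖ ^ 2)) ^ k := by
  rw [pow_mul]
  congr 1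
  exact Real.sq_sqrt (by positivity)

theorem stereoFactor_pos (y : EuclideanSpace ℝ (Fin n)) : 0 < stereoFactor y :=
  Real.sqrt_pos.2 (by positivity)

theorem continuous_stereoFactor : Continuous (stereoFactor (n := n)) := by
  refine Continuous.subtype_mk ?_ _
  refine Real.continuous_sqrt.comp (Continuous.div (by fun_prop) (by fun_prop) fun y => ?_)
  positivity

theorem measurableEmbedding_stereoSphere : MeasurableEmbedding (stereoSphere (n := n)) :=
  Continuous.measurableEmbedding (continuous_stereoInv.subtype_mk _) fun _ _ h =>
    injective_stereoInv (congrArg Subtype.val h)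

theorem edist_stereoSphere (x y : EuclideanSpace ℝ (Fin n)) :
    edist (stereoSphere x) (stereoSphere y) = stereoFactor x * stereoFactor y * edist x y :=
  edist_eq_of_dist_eq (dist_stereoInv x y)

theorem euclideanHausdorffMeasure_compl_range_stereoSphere (hn : 1 ≤ n) :
    (μHE[n] : Measure (sphere (0 : EuclideanSpace ℝ (Fin (n + 1))) 1))
      (range (stereoSphere (n := n)))ᶜ = 0 := by
  have hlast : ∀ x ∈ (range (stereoSphere (n := n)))ᶜ,
      (x : EuclideanSpace ℝ (Fin (n + 1))) (Fin.last n) = 1 := by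
    intro x hx
    by_contra h
    obtain ⟨y, hy⟩ := exists_stereoInv_eq (norm_eq_of_mem_sphere x) h
    exact hx ⟨y, Subtype.ext hy⟩
  have hzero : ∀ x ∈ (range (stereoSphere (n := n)))ᶜ,
      horizontal (x : EuclideanSpace ℝ (Fin (n + 1))) = 0 := fun x hx =>
    horizontal_eq_zero (norm_eq_of_mem_sphere x) (by rw [hlast x hx, one_pow])
  have hsub : ((range (stereoSphere (n := n)))ᶜ).Subsingleton := fun x hx y hy =>
    Subtype.ext (ext_horizontal (by rw [hzero x hx, hzero y hy]) (by rw [hlast x hx, hlast y hy]))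
  have := Measure.nullSingletonClass_hausdorff (sphere (0 : EuclideanSpace ℝ (Fin (n + 1))) 1)
    (d := n) (by exact_mod_cast hn)
  rw [Measure.euclideanHausdorffMeasure_def, Measure.smul_apply, hsub.measure_zero, smul_zero]

theorem integral_euclideanHausdorffMeasure_sphere (hn : 1 ≤ n)
    (F : sphere (0 : EuclideanSpace ℝ (Fin (n + 1))) 1 → G) :
    ∫ x, F x ∂μHE[n] =
      ∫ y : EuclideanSpace ℝ (Fin n), (2 / (1 + ‖y‖ ^ 2)) ^ n • F (stereoSphere y) := by
  have hae : ∀ᵐ x ∂(μHE[n] : Measure (sphere (0 : EuclideanSpace ℝ (Fin (n + 1))) 1)),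
      x ∈ range (stereoSphere (n := n)) :=
    euclideanHausdorffMeasure_compl_range_stereoSphere hn
  rw [← Measure.restrict_eq_self_of_ae_mem hae, setIntegral_range_euclideanHausdorffMeasure
    measurableEmbedding_stereoSphere continuous_stereoFactor.measurable stereoFactor_pos
    edist_stereoSphere, EuclideanSpace.euclideanHausdorffMeasure_eq_volume]
  simp_rw [stereoFactor_pow]

/-- The last coordinate of `stereoInv y` for `‖y‖ = r`. -/
noncomputable def stereoLatitude (r : ℝ) : ℝ := (-1 + r ^ 2) / (1 + r ^ 2)

theorem one_sub_stereoLatitude_sq (r : ℝ) :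
    1 - stereoLatitude r ^ 2 = (2 * r / (1 + r ^ 2)) ^ 2 := by
  rw [stereoLatitude]
  field

theorem image_stereoLatitude : stereoLatitude '' Ioi 0 = Ioo (-1) 1 := by
  ext τ
  constructor
  · rintro ⟨r, hr, rfl⟩
    have hr2 : 0 < r ^ 2 := pow_pos hr 2
    refine ⟨?_, ?_⟩
    · rw [stereoLatitude, lt_div_iff₀ (by positivity)]
      linarith
    · rw [stereoLatitude, div_lt_iff₀ (by positivity)]
      linarith
  · rintro ⟨h1, h2⟩
    have h3 : 0 < (1 + τ) / (1 - τ) := div_pos (by linarith) (by linarith)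
    have h4 : 1 - τ ≠ 0 := by linarith
    refine ⟨√((1 + τ) / (1 - τ)), Real.sqrt_pos.2 h3, ?_⟩
    rw [stereoLatitude, Real.sq_sqrt h3.le, div_eq_iff (by positivity)]
    field

theorem hasDerivAt_stereoLatitude (r : ℝ) :
    HasDerivAt stereoLatitude (4 * r / (1 + r ^ 2) ^ 2) r := by
  have hp : HasDerivAt (fun r : ℝ => r ^ 2) (2 * r) r := by simpa using hasDerivAt_pow 2 r
  refine ((hp.const_add (-1)).div (hp.const_add 1) (by positivity)).congr_deriv ?_
  field

theorem injOn_stereoLatitude : InjOn stereoLatitude (Ioi 0) := by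
  intro x hx y hy h
  rw [stereoLatitude, stereoLatitude, div_eq_div_iff (by positivity) (by positivity)] at h
  exact (sq_eq_sq₀ (le_of_lt hx) (le_of_lt hy)).1 (by linarith)

theorem abs_deriv_mul_stereoLatitude_weight (hn : 1 ≤ n) {r : ℝ} (hr : 0 < r) :
    |4 * r / (1 + r ^ 2) ^ 2| * (1 - stereoLatitude r ^ 2) ^ (((n : ℝ) - 2) / 2) =
      r ^ (n - 1) * (2 / (1 + r ^ 2)) ^ n := by
  set A := 2 * r / (1 + r ^ 2) with hA
  have hA0 : 0 < A := by positivity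
  have hderiv : |4 * r / (1 + r ^ 2) ^ 2| = A ^ (2 : ℝ) * r⁻¹ := by
    rw [abs_of_pos (by positivity), Real.rpow_two, hA]
    field
  have hpow : A ^ n * r⁻¹ = r ^ (n - 1) * (2 / (1 + r ^ 2)) ^ n := by
    obtain ⟨k, rfl⟩ := Nat.exists_eq_add_of_le' hn
    rw [hA, Nat.add_sub_cancel]
    field
  rw [hderiv, one_sub_stereoLatitude_sq, ← hA, ← Real.rpow_two, ← Real.rpow_mul hA0.le,
    mul_right_comm, ← Real.rpow_add hA0, show (2 : ℝ) + 2 * (((n : ℝ) - 2) / 2) = n by ring,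
    Real.rpow_natCast, hpow]

theorem natCast_mul_volume_ball (hn : 1 ≤ n) :
    (n : ℝ) * (volume : Measure (EuclideanSpace ℝ (Fin n))).real (ball 0 1) =
      sphereVolume (n - 1) := by
  have : Nonempty (Fin n) := ⟨⟨0, hn⟩⟩
  rw [Measure.real, EuclideanSpace.volume_ball, sphereVolume, Nat.cast_sub hn]
  simp only [Fintype.card_fin, ENNReal.ofReal_one, one_pow, one_mul, Nat.cast_one, sub_add_cancel]
  rw [Real.Gamma_add_one (by positivity), ENNReal.toReal_ofReal (by positivity),
    Real.sqrt_eq_rpow, ← Real.rpow_natCast, ← Real.rpow_mul Real.pi_pos.le]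
  rw [show (1 / 2 : ℝ) * n = n / 2 by ring]
  field_simp

theorem neg_half_lt (hn : 1 ≤ n) : -(1 / 2) < ((n : ℝ) - 1) / 2 := by
  have : (1 : ℝ) ≤ n := by exact_mod_cast hn
  linarith

theorem integrableOn_weight (hn : 1 ≤ n) :
    IntegrableOn (fun τ : ℝ => (1 - τ ^ 2) ^ (((n : ℝ) - 2) / 2)) (Ioo (-1) 1) := by
  have hw := gegenbauer_weight_integrable (neg_half_lt hn) 1
  rw [intervalIntegrable_iff_integrableOn_Ioo_of_le (by norm_num)] at hw
  refine hw.congr_fun (fun τ _ => ?_) measurableSet_Ioo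
  simp only [eval_one, one_mul]
  rw [show ((n : ℝ) - 1) / 2 - 1 / 2 = ((n : ℝ) - 2) / 2 by ring]

theorem integrable_stereoFactor (hn : 1 ≤ n) :
    Integrable fun y : EuclideanSpace ℝ (Fin n) => (2 / (1 + ‖y‖ ^ 2)) ^ n := by
  have : Nonempty (Fin n) := ⟨⟨0, hn⟩⟩
  rw [integrable_fun_norm_addHaar (volume : Measure (EuclideanSpace ℝ (Fin n)))
    (f := fun r : ℝ => (2 / (1 + r ^ 2)) ^ n), finrank_euclideanSpace_fin]
  have hw := integrableOn_weight hn
  rw [← image_stereoLatitude, integrableOn_image_iff_integrableOn_abs_deriv_smul measurableSet_Ioi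
    (fun r _ => (hasDerivAt_stereoLatitude r).hasDerivWithinAt) injOn_stereoLatitude] at hw
  refine hw.congr_fun (fun r hr => ?_) measurableSet_Ioi
  simp only [smul_eq_mul]
  exact abs_deriv_mul_stereoLatitude_weight hn hr

theorem integral_latitude_euclideanHausdorffMeasure (hn : 1 ≤ n) (φ : ℝ → G) :
    ∫ x : sphere (0 : EuclideanSpace ℝ (Fin (n + 1))) 1,
      φ ((x : EuclideanSpace ℝ (Fin (n + 1))) (Fin.last n)) ∂μHE[n] =
    sphereVolume (n - 1) •
      ∫ τ in Ioo (-1 : ℝ) 1, (1 - τ ^ 2) ^ (((n : ℝ) - 2) / 2) • φ τ := by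
  have : Nonempty (Fin n) := ⟨⟨0, hn⟩⟩
  have hradial : ∀ y : EuclideanSpace ℝ (Fin n),
      (2 / (1 + ‖y‖ ^ 2)) ^ n •
        φ ((stereoSphere y : EuclideanSpace ℝ (Fin (n + 1))) (Fin.last n)) =
      (fun r : ℝ => (2 / (1 + r ^ 2)) ^ n • φ (stereoLatitude r)) ‖y‖ := fun y => by
    simp only [stereoSphere, stereoInv_last, stereoLatitude]
  rw [integral_euclideanHausdorffMeasure_sphere hn, integral_congr_ae (.of_forall hradial),
    integral_fun_norm_addHaar volume (fun r : ℝ => (2 / (1 + r ^ 2)) ^ n • φ (stereoLatitude r)),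
    finrank_euclideanSpace_fin, ← image_stereoLatitude,
    integral_image_eq_integral_abs_deriv_smul measurableSet_Ioi
    (fun r _ => (hasDerivAt_stereoLatitude r).hasDerivWithinAt) injOn_stereoLatitude,
    ← natCast_mul_volume_ball hn, ← Nat.cast_smul_eq_nsmul ℝ, smul_smul]
  congr 1
  refine setIntegral_congr_fun measurableSet_Ioi fun r hr => ?_
  simp only [smul_smul]
  rw [abs_deriv_mul_stereoLatitude_weight hn hr]

theorem sphereVolume_mul_integral_weight (hn : 1 ≤ n) :
    sphereVolume (n - 1) * ∫ τ in Ioo (-1 : ℝ) 1, (1 - τ ^ 2) ^ (((n : ℝ) - 2) / 2) =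
      sphereVolume n := by
  have h := gegenbauer_weight_integral (neg_half_lt hn)
  rw [intervalIntegral.integral_of_le (by norm_num), integral_Ioc_eq_integral_Ioo] at h
  rw [show ((n : ℝ) - 2) / 2 = ((n : ℝ) - 1) / 2 - 1 / 2 by ring, h,
    show 2 * (((n : ℝ) - 1) / 2) = n - 1 by ring, show ((n : ℝ) - 1) / 2 + 1 / 2 = n / 2 by ring,
    sub_add_cancel, sphereVolume, sphereVolume, Nat.cast_sub hn, Nat.cast_one, sub_add_cancel]
  have hdup := Real.Gamma_mul_Gamma_add_half ((n : ℝ) / 2)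
  rw [show 2 * ((n : ℝ) / 2) = n by ring, show (n : ℝ) / 2 + 1 / 2 = (n + 1) / 2 by ring] at hdup
  have e1 : Real.pi ^ (((n : ℝ) + 1) / 2) = Real.pi ^ ((n : ℝ) / 2) * √Real.pi := by
    rw [Real.sqrt_eq_rpow, ← Real.rpow_add Real.pi_pos]; congr 1; ring
  have e2 : (2 : ℝ) ^ ((n : ℝ) - 1) * 2 ^ (1 - (n : ℝ)) = 1 := by
    rw [← Real.rpow_add two_pos]; simp
  rw [e1]
  field_simp
  linear_combination (2 : ℝ) ^ ((n : ℝ) - 1) * hdup +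
    Real.Gamma n * √Real.pi * e2

theorem isFiniteMeasure_euclideanHausdorffMeasure_sphere (hn : 1 ≤ n) :
    IsFiniteMeasure (μHE[n] : Measure (sphere (0 : EuclideanSpace ℝ (Fin (n + 1))) 1)) := by
  have hrange : (μHE[n] : Measure (sphere (0 : EuclideanSpace ℝ (Fin (n + 1))) 1)) univ =
      μHE[n] (range (stereoSphere (n := n))) :=
    measure_congr (ae_eq_univ.2 (euclideanHausdorffMeasure_compl_range_stereoSphere hn)).symm
  refine ⟨?_⟩
  rw [hrange, ← image_univ, ← measurableEmbedding_stereoSphere.comap_apply,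
    comap_euclideanHausdorffMeasure_of_edist measurableEmbedding_stereoSphere
      continuous_stereoFactor.measurable stereoFactor_pos edist_stereoSphere,
    withDensity_apply _ MeasurableSet.univ, Measure.restrict_univ,
    EuclideanSpace.euclideanHausdorffMeasure_eq_volume]
  refine lt_of_le_of_lt (lintegral_mono fun y => ?_) (integrable_stereoFactor hn).lintegral_lt_top
  rw [← stereoFactor_pow, ← NNReal.coe_pow, ENNReal.ofReal_coe_nnreal]

theorem euclideanHausdorffMeasure_sphere (hn : 1 ≤ n) :
    (μHE[n] : Measure (sphere (0 : EuclideanSpace ℝ (Fin (n + 1))) 1)) =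
      (volume : Measure (EuclideanSpace ℝ (Fin (n + 1)))).toSphere := by
  have := isFiniteMeasure_euclideanHausdorffMeasure_sphere hn
  refine eq_of_isRotationInvariant (isRotationInvariant_euclideanHausdorffMeasure n)
    isRotationInvariant_toSphere ?_
  rw [Measure.toSphere_real_apply_univ, finrank_euclideanSpace_fin,
    natCast_mul_volume_ball (by omega), Nat.add_sub_cancel, ← sphereVolume_mul_integral_weight hn]
  simpa only [integral_const, smul_eq_mul, mul_one] using
    integral_latitude_euclideanHausdorffMeasure hn (fun _ => (1 : ℝ))

theorem integral_latitude_toSphere (hn : 1 ≤ n) (φ : ℝ → G) :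
    ∫ x : sphere (0 : EuclideanSpace ℝ (Fin (n + 1))) 1,
      φ ((x : EuclideanSpace ℝ (Fin (n + 1))) (Fin.last n))
        ∂(volume : Measure (EuclideanSpace ℝ (Fin (n + 1)))).toSphere =
    sphereVolume (n - 1) •
      ∫ τ in Ioo (-1 : ℝ) 1, (1 - τ ^ 2) ^ (((n : ℝ) - 2) / 2) • φ τ := by
  rw [← euclideanHausdorffMeasure_sphere hn, integral_latitude_euclideanHausdorffMeasure hn]

end SphereMeasure

/-! ### Linear substitutions in polynomials -/

section Substitution

variable {d : ℕ}

theorem sum_eq_of_mem_support {σ R : Type*} [Fintype σ] [CommSemiring R] {P : MvPolynomial σ R}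
    {m : ℕ} (hP : P.IsHomogeneous m) {α : σ →₀ ℕ} (hα : α ∈ P.support) : ∑ i, α i = m := by
  rw [← Finsupp.degree_eq_sum, Finsupp.degree_apply, ← hP.degree_eq_sum_deg_support hα]

/-- Evaluation of complex polynomials at a point of `ℝ^d`. -/
noncomputable def evalAt (x : EuclideanSpace ℝ (Fin d)) : MvPolynomial (Fin d) ℂ →ₐ[ℂ] ℂ :=
  MvPolynomial.aeval fun i => ((x i : ℝ) : ℂ)

theorem evalAt_X (x : EuclideanSpace ℝ (Fin d)) (i : Fin d) :
    evalAt x (MvPolynomial.X i) = ((x i : ℝ) : ℂ) := by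
  simp [evalAt]

theorem continuous_evalAt (P : MvPolynomial (Fin d) ℂ) : Continuous fun x => evalAt x P := by
  simp only [evalAt, MvPolynomial.aeval_eq_eval]
  exact (MvPolynomial.continuous_eval P).comp (by fun_prop)

theorem evalAt_smul {P : MvPolynomial (Fin d) ℂ} {m : ℕ} (hP : P.IsHomogeneous m) (c : ℝ)
    (x : EuclideanSpace ℝ (Fin d)) : evalAt (c • x) P = (c : ℂ) ^ m * evalAt x P := by
  simp only [evalAt, MvPolynomial.aeval_def, MvPolynomial.eval₂_eq', Finset.mul_sum]
  refine Finset.sum_congr rfl fun α hα => ?_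
  simp only [PiLp.smul_apply, smul_eq_mul, Complex.ofReal_mul, mul_pow, Finset.prod_mul_distrib,
    Finset.prod_pow_eq_pow_sum, sum_eq_of_mem_support hP hα]
  ring

theorem eq_zero_of_forall_evalAt_eq_zero {P : MvPolynomial (Fin d) ℂ}
    (h : ∀ x, evalAt x P = 0) : P = 0 := by
  refine MvPolynomial.funext_set (fun _ => range ((↑) : ℝ → ℂ))
    (fun _ => infinite_range_of_injective Complex.ofReal_injective) fun x hx => ?_
  choose y hy using fun i => hx i (mem_univ i)
  have := h (WithLp.toLp 2 y)
  simp only [evalAt, MvPolynomial.aeval_eq_eval, hy] at this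
  simpa using this

variable (A : EuclideanSpace ℝ (Fin d) →L[ℝ] EuclideanSpace ℝ (Fin d))

/-- The substitution of the linear forms given by the rows of `A` for the variables. -/
noncomputable def linSubst :
    MvPolynomial (Fin d) ℂ →ₐ[ℂ] MvPolynomial (Fin d) ℂ :=
  MvPolynomial.aeval fun i => ∑ j,
    MvPolynomial.C ((A (EuclideanSpace.single j 1) i : ℝ) : ℂ) * MvPolynomial.X j

theorem linSubst_X (i : Fin d) :
    linSubst A (MvPolynomial.X i) = ∑ j,
      MvPolynomial.C ((A (EuclideanSpace.single j 1) i : ℝ) : ℂ) * MvPolynomial.X j := by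
  simp [linSubst]

theorem map_apply_eq_sum (x : EuclideanSpace ℝ (Fin d)) (i : Fin d) :
    A x i = ∑ j, A (EuclideanSpace.single j 1) i * x j := by
  have hx : x = ∑ j, x j • EuclideanSpace.single j (1 : ℝ) := by
    ext k
    simp [Finset.sum_apply, Pi.single_apply]
  conv_lhs => rw [hx]
  simp [mul_comm]

theorem evalAt_linSubst (x : EuclideanSpace ℝ (Fin d)) (P : MvPolynomial (Fin d) ℂ) :
    evalAt x (linSubst A P) = evalAt (A x) P := by
  have : (evalAt x).comp (linSubst A) = evalAt (A x) := by
    refine MvPolynomial.algHom_ext fun i => ?_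
    rw [AlgHom.comp_apply, linSubst_X, evalAt_X, map_apply_eq_sum]
    simp [evalAt]
  exact DFunLike.congr_fun this P

theorem isHomogeneous_linSubst {P : MvPolynomial (Fin d) ℂ} {m : ℕ} (hP : P.IsHomogeneous m) :
    (linSubst A P).IsHomogeneous m := by
  have := hP.aeval (fun i => ∑ j,
    MvPolynomial.C ((A (EuclideanSpace.single j 1) i : ℝ) : ℂ) * MvPolynomial.X j) (n := 1)
    fun i => MvPolynomial.IsHomogeneous.sum _ _ _ fun j _ => MvPolynomial.isHomogeneous_C_mul_X _ _
  rwa [one_mul] at this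

theorem pderiv_linSubst (k : Fin d) (P : MvPolynomial (Fin d) ℂ) :
    MvPolynomial.pderiv k (linSubst A P) = ∑ i,
      MvPolynomial.C ((A (EuclideanSpace.single k 1) i : ℝ) : ℂ) *
        linSubst A (MvPolynomial.pderiv i P) := by
  induction P using MvPolynomial.induction_on with
  | C a => simp [linSubst]
  | add p q hp hq => simp only [map_add, hp, hq, mul_add, Finset.sum_add_distrib]
  | mul_X p i hp =>
    rw [map_mul, Derivation.leibniz, hp, linSubst_X]
    simp only [Derivation.leibniz, map_add, smul_eq_mul, map_mul, mul_add, map_sum,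
      MvPolynomial.pderiv_C, MvPolynomial.pderiv_X, mul_zero, add_zero, linSubst_X,
      Finset.sum_add_distrib]
    congr 1
    · simp [Pi.single_apply, mul_comm]
    · rw [Finset.mul_sum]
      exact Finset.sum_congr rfl fun j _ => by ring

theorem polyLaplacian_apply (P : MvPolynomial (Fin d) ℂ) :
    polyLaplacian d P = ∑ i, MvPolynomial.pderiv i (MvPolynomial.pderiv i P) := by
  simp [polyLaplacian, LinearMap.sum_apply]

theorem apply_single_eq_inv_apply_single (R : OrthGroup d) (i k : Fin d) :
    R.1 (EuclideanSpace.single k 1) i = R⁻¹.1 (EuclideanSpace.single i 1) k := by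
  have h := Unitary.inner_map_map R⁻¹ (EuclideanSpace.single i 1) (R.1 (EuclideanSpace.single k 1))
  rw [inv_apply_apply] at h
  simpa [EuclideanSpace.inner_single_left, EuclideanSpace.inner_single_right] using h.symm

theorem sum_apply_single_mul (R : OrthGroup d) (i j : Fin d) :
    ∑ k, R.1 (EuclideanSpace.single k 1) i * R.1 (EuclideanSpace.single k 1) j =
      if i = j then 1 else 0 := by
  have h := Unitary.inner_map_map R⁻¹ (EuclideanSpace.single j 1) (EuclideanSpace.single i 1)
  rw [PiLp.inner_apply] at h
  simpa [apply_single_eq_inv_apply_single R, EuclideanSpace.inner_single_left, eq_comm] using h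

theorem polyLaplacian_linSubst (R : OrthGroup d) (P : MvPolynomial (Fin d) ℂ) :
    polyLaplacian d (linSubst R P) = linSubst R (polyLaplacian d P) := by
  have hrow : ∀ i j, ∑ k, MvPolynomial.C ((R.1 (EuclideanSpace.single k 1) i : ℝ) : ℂ) *
        (MvPolynomial.C ((R.1 (EuclideanSpace.single k 1) j : ℝ) : ℂ) *
          linSubst R (MvPolynomial.pderiv j (MvPolynomial.pderiv i P))) =
      if i = j then linSubst R (MvPolynomial.pderiv j (MvPolynomial.pderiv i P)) else 0 := by
    intro i j
    simp_rw [← mul_assoc, ← Finset.sum_mul, ← map_mul, ← map_sum, ← Complex.ofReal_mul,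
      ← Complex.ofReal_sum, sum_apply_single_mul]
    split_ifs <;> simp
  simp only [polyLaplacian_apply, pderiv_linSubst, map_sum, Derivation.leibniz, smul_eq_mul,
    MvPolynomial.pderiv_C, mul_zero, add_zero, Finset.mul_sum]
  rw [Finset.sum_comm]
  refine Finset.sum_congr rfl fun i _ => ?_
  rw [Finset.sum_comm]
  simp_rw [hrow, Finset.sum_ite_eq, Finset.mem_univ, if_true]

theorem continuous_coeff_linSubst {K : Type*} [TopologicalSpace K]
    {A : K → EuclideanSpace ℝ (Fin d) →L[ℝ] EuclideanSpace ℝ (Fin d)} (hA : Continuous A)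
    (P : MvPolynomial (Fin d) ℂ) (α : Fin d →₀ ℕ) :
    Continuous fun R => (linSubst (A R) P).coeff α := by
  induction P using MvPolynomial.induction_on generalizing α with
  | C a => simpa [linSubst] using continuous_const
  | add p q hp hq => simpa using! (hp α).add (hq α)
  | mul_X p i hp =>
    simp only [map_mul, linSubst_X]
    simp_rw [MvPolynomial.coeff_mul (linSubst (A _) p), MvPolynomial.coeff_sum,
      MvPolynomial.coeff_C_mul]
    refine continuous_finsetSum _ fun β _ => (hp β.1).mul ?_
    refine continuous_finsetSum _ fun j _ => Continuous.mul ?_ continuous_const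
    have : Continuous fun R => A R (EuclideanSpace.single j 1) :=
      hA.clm_apply continuous_const
    fun_prop

end Substitution

/-! ### Averages of polynomials -/

section Average

theorem linearMap_eq_sum_coeff {σ R M : Type*} [Fintype σ] [DecidableEq σ] [CommSemiring R]
    [AddCommMonoid M] [Module R M] {P : MvPolynomial σ R} {m : ℕ} (hP : P.IsHomogeneous m)
    (L : MvPolynomial σ R →ₗ[R] M) :
    L P = ∑ α ∈ Finset.univ.finsuppAntidiag m, P.coeff α • L (MvPolynomial.monomial α 1) := by
  conv_lhs => rw [P.as_sum, map_sum]
  refine (Finset.sum_congr rfl fun α _ => ?_).trans (Finset.sum_subset (fun α hα => ?_)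
    fun α _ hα => ?_)
  · rw [← map_smul, MvPolynomial.smul_monomial, smul_eq_mul, mul_one]
  · simpa using sum_eq_of_mem_support hP hα
  · rw [MvPolynomial.notMem_support_iff.1 hα, zero_smul]

variable {σ K : Type*} [Finite σ] [TopologicalSpace K] [CompactSpace K] [MeasurableSpace K]
  [BorelSpace K]

theorem exists_isHomogeneous_average (μ : Measure K) [IsFiniteMeasure μ] {m : ℕ}
    {Q : K → MvPolynomial σ ℂ}
    (hQ : ∀ R, (Q R).IsHomogeneous m) (hc : ∀ α, Continuous fun R => (Q R).coeff α)
    {G : K → ℂ} (hG : Continuous G) :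
    ∃ W : MvPolynomial σ ℂ, W.IsHomogeneous m ∧
      ∀ L : MvPolynomial σ ℂ →ₗ[ℂ] ℂ, L W = ∫ R, G R * L (Q R) ∂μ := by
  classical
  have := Fintype.ofFinite σ
  refine ⟨∑ α ∈ Finset.univ.finsuppAntidiag m,
    MvPolynomial.monomial α (∫ R, G R * (Q R).coeff α ∂μ), ?_, fun L => ?_⟩
  · exact MvPolynomial.IsHomogeneous.sum _ _ _ fun α hα => MvPolynomial.isHomogeneous_monomial _
      (α.degree_eq_sum.trans (Finset.mem_finsuppAntidiag.1 hα).1)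
  · rw [map_sum]
    simp_rw [fun R => linearMap_eq_sum_coeff (hQ R) L, smul_eq_mul, Finset.mul_sum]
    rw [integral_finsetSum]
    · refine Finset.sum_congr rfl fun α _ => ?_
      simp_rw [← mul_assoc]
      rw [integral_mul_const, ← smul_eq_mul, ← map_smul, MvPolynomial.smul_monomial, smul_eq_mul,
        mul_one]
    · intro α _
      exact ((hG.mul ((hc α).mul continuous_const)).integrable_of_hasCompactSupport
        (HasCompactSupport.of_compactSpace _))

end Average

/-! ### Uniqueness for the Gegenbauer equation -/

section Uniqueness

theorem eq_zero_of_gegenbauer_ode {a b : ℂ} (ha : 0 < a.re) {u : ℂ[X]}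
    (hode : (1 - X ^ 2) * derivative (derivative u) - C a * X * derivative u + C b * u = 0)
    (h1 : u.eval 1 = 0) : u = 0 := by
  by_contra hu
  obtain ⟨w, hw, hnd⟩ := exists_eq_pow_rootMultiplicity_mul_and_not_dvd u hu 1
  obtain ⟨n, hn⟩ : ∃ n, u.rootMultiplicity 1 = n + 1 :=
    Nat.exists_eq_succ_of_ne_zero ((rootMultiplicity_pos hu).2 h1).ne'
  rw [hn] at hw
  have hw1 : w.eval 1 ≠ 0 := fun h => hnd (dvd_iff_isRoot.2 h)
  have hXn : (X - C (1 : ℂ)) ^ n ≠ 0 := pow_ne_zero _ (X_sub_C_ne_zero 1)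
  have key : (X - C (1 : ℂ)) ^ n *
      (-(X + 1) * (((n : ℂ[X]) + 1) * (n : ℂ[X]) * w + 2 * ((n : ℂ[X]) + 1) * (X - C 1) *
      derivative w + (X - C 1) ^ 2 * derivative (derivative w)) - C a * X * (((n : ℂ[X]) + 1) * w +
      (X - C 1) * derivative w) + C b * (X - C 1) * w) = 0 := by
    rw [← hode, hw]
    rcases n with _ | n
    · simp only [map_one, pow_zero, Nat.cast_zero, zero_add, mul_zero, zero_mul, mul_one, one_mul,
        pow_one, derivative_mul, derivative_sub, derivative_X, derivative_one, sub_zero,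
        derivative_add]
      ring
    · simp only [derivative_mul, derivative_pow, derivative_sub, derivative_X, derivative_add,
        derivative_natCast, Nat.add_sub_cancel, C_1, derivative_one, sub_zero,
        mul_one, Nat.cast_add, Nat.cast_one, C_add, map_natCast]
      ring
  have hfac : ((n : ℂ) + 1) * (2 * n + a) * w.eval 1 = 0 := by
    have h0 := congrArg (eval 1) ((mul_eq_zero.1 key).resolve_left hXn)
    simp only [C_1, eval_add, eval_sub, eval_mul, eval_neg, eval_one, eval_X, eval_natCast,
      eval_ofNat, sub_self, mul_zero, zero_mul, add_zero, eval_pow, ne_eq, OfNat.ofNat_ne_zero,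
      not_false_eq_true, zero_pow, eval_C, mul_one, eval_zero] at h0
    linear_combination -h0
  have hindex : 2 * n + a ≠ 0 := fun h => by
    have hre : 2 * (n : ℝ) + a.re = 0 := by simpa using congrArg Complex.re h
    linarith [n.cast_nonneg (α := ℝ)]
  exact mul_ne_zero (mul_ne_zero n.cast_add_one_ne_zero hindex) hw1 hfac

/-- The Gegenbauer operator `v ↦ (1 - x²)v'' - (2ν + 1)xv' + m(m + 2ν)v`. -/
noncomputable def gegenbauerOp (ν : ℝ) (m : ℕ) : ℂ[X] →ₗ[ℂ] ℂ[X] where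
  toFun v := (1 - X ^ 2) * derivative (derivative v) -
    C ((2 * ν + 1 : ℝ) : ℂ) * X * derivative v + C ((m * (m + 2 * ν) : ℝ) : ℂ) * v
  map_add' u v := by
    simp only [derivative_add]
    ring
  map_smul' c v := by
    simp only [smul_eq_C_mul, derivative_C_mul, RingHom.id_apply]
    ring

theorem gegenbauerOp_apply (ν : ℝ) (m : ℕ) (v : ℂ[X]) :
    gegenbauerOp ν m v = (1 - X ^ 2) * derivative (derivative v) -
      C ((2 * ν + 1 : ℝ) : ℂ) * X * derivative v + C ((m * (m + 2 * ν) : ℝ) : ℂ) * v := rfl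

theorem gegenbauerOp_gegenbauer {ν : ℝ} (hν : -(1 / 2) < ν) (m : ℕ) :
    gegenbauerOp ν m ((gegenbauer ν m).map (algebraMap ℝ ℂ)) = 0 := by
  have h := congrArg (Polynomial.map (algebraMap ℝ ℂ)) (gegenbauer_ode hν m)
  simp only [Polynomial.map_mul, Polynomial.map_sub, Polynomial.map_add, Polynomial.map_neg,
    Polynomial.map_one, Polynomial.map_pow, map_X, map_C, Polynomial.map_natCast,
    Polynomial.map_ofNat, ← derivative_map, Complex.coe_algebraMap] at h
  rw [gegenbauerOp_apply]
  push_cast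
  simp only [C_add, C_mul, map_natCast, map_ofNat, C_1]
  linear_combination h

theorem eq_gegenbauer_of_gegenbauerOp_eq_zero {ν : ℝ} (hν : -(1 / 2) < ν) {m : ℕ} {v : ℂ[X]}
    (hv : gegenbauerOp ν m v = 0) :
    v = v.eval 1 • (gegenbauer ν m).map (algebraMap ℝ ℂ) := by
  rw [← sub_eq_zero]
  refine eq_zero_of_gegenbauer_ode (a := ((2 * ν + 1 : ℝ) : ℂ))
    (b := ((m * (m + 2 * ν) : ℝ) : ℂ)) (by rw [Complex.ofReal_re]; linarith) ?_ ?_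
  · rw [← gegenbauerOp_apply, map_sub, map_smul, hv, gegenbauerOp_gegenbauer hν, smul_zero,
      sub_zero]
  · rw [eval_sub, eval_smul, eval_map_algebraMap, ← map_one (algebraMap ℝ ℂ),
      aeval_algebraMap_apply, Polynomial.coe_aeval_eq_eval, gegenbauer_eval_one hν]
    simp

end Uniqueness

/-! ### Zonal harmonic polynomials -/

section Zonal

variable {n : ℕ}

/-- The squared distance to the first coordinate axis. -/
noncomputable def axisDistSq (n : ℕ) : MvPolynomial (Fin (n + 2)) ℂ :=
  ∑ i : Fin (n + 1), MvPolynomial.X i.succ ^ 2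

theorem pderiv_zero_axisDistSq : MvPolynomial.pderiv 0 (axisDistSq n) = 0 := by
  simp [axisDistSq, Derivation.leibniz_pow, MvPolynomial.pderiv_X]

theorem pderiv_succ_axisDistSq (i : Fin (n + 1)) :
    MvPolynomial.pderiv i.succ (axisDistSq n) = 2 * MvPolynomial.X i.succ := by
  simp [axisDistSq, Derivation.leibniz_pow, MvPolynomial.pderiv_X, Pi.single_apply]

theorem pderiv_zero_pderiv_zero_zonal (k j : ℕ) :
    MvPolynomial.pderiv 0 (MvPolynomial.pderiv 0 (MvPolynomial.X 0 ^ k * axisDistSq n ^ j)) =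
      ((k * (k - 1) : ℕ) : MvPolynomial (Fin (n + 2)) ℂ) *
        (MvPolynomial.X 0 ^ (k - 2) * axisDistSq n ^ j) := by
  simp only [Derivation.leibniz, Derivation.leibniz_pow, pderiv_zero_axisDistSq, smul_zero,
    MvPolynomial.pderiv_X_self, smul_eq_mul, mul_zero, zero_add, mul_one, nsmul_eq_mul,
    Derivation.map_natCast, Nat.sub_sub, add_zero]
  push_cast
  ring

theorem pderiv_succ_pderiv_succ_zonal (k j : ℕ) (i : Fin (n + 1)) :
    MvPolynomial.pderiv i.succ
        (MvPolynomial.pderiv i.succ (MvPolynomial.X 0 ^ k * axisDistSq n ^ j)) =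
      ((4 * j * (j - 1) : ℕ) : MvPolynomial (Fin (n + 2)) ℂ) *
        (MvPolynomial.X 0 ^ k * axisDistSq n ^ (j - 2) * MvPolynomial.X i.succ ^ 2) +
      ((2 * j : ℕ) : MvPolynomial (Fin (n + 2)) ℂ) *
        (MvPolynomial.X 0 ^ k * axisDistSq n ^ (j - 1)) := by
  have hX : MvPolynomial.pderiv i.succ (MvPolynomial.X 0 : MvPolynomial (Fin (n + 2)) ℂ) = 0 :=
    MvPolynomial.pderiv_X_of_ne (Fin.succ_ne_zero i).symm
  have h2 : MvPolynomial.pderiv i.succ (2 : MvPolynomial (Fin (n + 2)) ℂ) = 0 :=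
    Derivation.map_natCast _ 2
  simp only [Derivation.leibniz, Derivation.leibniz_pow, pderiv_succ_axisDistSq, smul_zero, hX,
    MvPolynomial.pderiv_X_self, smul_eq_mul, mul_zero, mul_one, nsmul_eq_mul,
    Derivation.map_natCast, Nat.sub_sub, add_zero, h2]
  push_cast
  ring

theorem polyLaplacian_zonal (k j : ℕ) :
    polyLaplacian (n + 2) (MvPolynomial.X 0 ^ k * axisDistSq n ^ j) =
      ((k * (k - 1) : ℕ) : MvPolynomial (Fin (n + 2)) ℂ) *
        (MvPolynomial.X 0 ^ (k - 2) * axisDistSq n ^ j) +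
      ((2 * j * (2 * (j - 1) + n + 1) : ℕ) : MvPolynomial (Fin (n + 2)) ℂ) *
        (MvPolynomial.X 0 ^ k * axisDistSq n ^ (j - 1)) := by
  rw [polyLaplacian_apply, Fin.sum_univ_succ, pderiv_zero_pderiv_zero_zonal]
  congr 1
  simp_rw [pderiv_succ_pderiv_succ_zonal]
  rw [Finset.sum_add_distrib, ← Finset.mul_sum, ← Finset.mul_sum, ← axisDistSq, Finset.sum_const,
    Finset.card_univ, Fintype.card_fin, nsmul_eq_mul]
  rcases j with _ | _ | j
  · simp
  · simp only [zero_add, mul_one, Nat.sub_self, mul_zero, Nat.cast_zero, zero_mul]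
    push_cast
    ring
  · simp only [Nat.add_sub_cancel, Nat.reduceSubDiff]
    push_cast
    ring

theorem gegenbauerOp_zonal (k j : ℕ) :
    gegenbauerOp (n / 2) (k + 2 * j) (X ^ k * (1 - X ^ 2) ^ j) =
      ((k * (k - 1) : ℕ) : ℂ[X]) * (X ^ (k - 2) * (1 - X ^ 2) ^ j) +
        ((2 * j * (2 * (j - 1) + n + 1) : ℕ) : ℂ[X]) * (X ^ k * (1 - X ^ 2) ^ (j - 1)) := by
  have h1 : derivative (1 - X ^ 2 : ℂ[X]) = -2 * X := by
    rw [derivative_sub, derivative_one, derivative_X_pow, Nat.cast_ofNat, map_ofNat]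
    ring
  have hC1 : C ((2 * (n / 2 : ℝ) + 1 : ℝ) : ℂ) = (n : ℂ[X]) + 1 := by
    rw [mul_div_cancel₀ _ two_ne_zero]
    simp
  have hC2 : C ((((k + 2 * j : ℕ) : ℝ) * ((k + 2 * j : ℕ) + 2 * (n / 2 : ℝ)) : ℝ) : ℂ) =
      ((k : ℂ[X]) + 2 * j) * ((k : ℂ[X]) + 2 * j + n) := by
    rw [mul_div_cancel₀ _ two_ne_zero]
    simp [map_ofNat]
  rw [gegenbauerOp_apply, hC1, hC2]
  rcases k with _ | _ | k <;> rcases j with _ | _ | j <;>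
  · simp only [derivative_mul, derivative_pow, derivative_X, h1, derivative_natCast, derivative_neg,
      derivative_ofNat, derivative_one, pow_zero, pow_one,
      Nat.add_sub_cancel, Nat.cast_add, Nat.cast_one, Nat.cast_zero, map_add, map_natCast, map_one,
      zero_add, Nat.reduceSubDiff, zero_mul, mul_zero, one_mul, mul_one, add_zero,
      Nat.cast_mul, Nat.cast_ofNat, Nat.zero_sub, tsub_self, derivative_zero]
    ring

theorem evalAt_axisDistSq (x : EuclideanSpace ℝ (Fin (n + 2))) :
    evalAt x (axisDistSq n) = ((‖x‖ ^ 2 - x 0 ^ 2 : ℝ) : ℂ) := by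
  rw [EuclideanSpace.real_norm_sq_eq, Fin.sum_univ_succ, add_sub_cancel_left]
  simp [axisDistSq, evalAt_X]

theorem axisDistSq_ne_zero : axisDistSq n ≠ 0 := by
  intro h
  have h1 := evalAt_axisDistSq (EuclideanSpace.single (1 : Fin (n + 2)) 1)
  rw [h] at h1
  simp at h1

theorem evalAt_zonal {x : EuclideanSpace ℝ (Fin (n + 2))} (hx : ‖x‖ = 1) (k j : ℕ) :
    evalAt x (MvPolynomial.X 0 ^ k * axisDistSq n ^ j) =
      (X ^ k * (1 - X ^ 2) ^ j : ℂ[X]).eval ((x 0 : ℝ) : ℂ) := by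
  rw [map_mul, map_pow, map_pow, evalAt_X, evalAt_axisDistSq, hx]
  simp

theorem evalAt_polyLaplacian_zonal {x : EuclideanSpace ℝ (Fin (n + 2))} (hx : ‖x‖ = 1)
    (k j : ℕ) :
    evalAt x (polyLaplacian (n + 2) (MvPolynomial.X 0 ^ k * axisDistSq n ^ j)) =
      (gegenbauerOp (n / 2) (k + 2 * j) (X ^ k * (1 - X ^ 2) ^ j)).eval ((x 0 : ℝ) : ℂ) := by
  simp only [polyLaplacian_zonal, gegenbauerOp_zonal, ← nsmul_eq_mul, map_add, map_nsmul,
    evalAt_zonal hx, eval_add, eval_smul]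

/-- The point `(a, b, 0, …, 0)`. -/
noncomputable def planePoint (n : ℕ) (a b : ℝ) : EuclideanSpace ℝ (Fin (n + 2)) :=
  a • EuclideanSpace.single 0 1 + b • EuclideanSpace.single 1 1

theorem planePoint_zero (a b : ℝ) : planePoint n a b 0 = a := by simp [planePoint]

theorem planePoint_one (a b : ℝ) : planePoint n a b 1 = b := by simp [planePoint]

theorem planePoint_succ_succ (a b : ℝ) (i : Fin n) : planePoint n a b i.succ.succ = 0 := by
  have h : i.succ.succ ≠ 1 := fun h => Fin.succ_ne_zero i (Fin.succ_injective _ h)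
  simp [planePoint, h]

theorem smul_planePoint (c a b : ℝ) : c • planePoint n a b = planePoint n (c * a) (c * b) := by
  simp [planePoint, mul_smul]

theorem norm_sq_planePoint (a b : ℝ) : ‖planePoint n a b‖ ^ 2 = a ^ 2 + b ^ 2 := by
  rw [EuclideanSpace.real_norm_sq_eq, Fin.sum_univ_succ, Fin.sum_univ_succ]
  simp only [planePoint_zero, planePoint_succ_succ]
  rw [show (Fin.succ 0 : Fin (n + 2)) = 1 from rfl, planePoint_one]
  simp

/-- Invariance of a polynomial under the orthogonal maps that fix the first coordinate axis. -/
def IsZonal (W : MvPolynomial (Fin (n + 2)) ℂ) : Prop :=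
  ∀ R : OrthGroup (n + 2), R.1 (EuclideanSpace.single 0 1) = EuclideanSpace.single 0 1 →
    ∀ x, evalAt (R.1 x) W = evalAt x W

theorem IsZonal.evalAt_eq {W : MvPolynomial (Fin (n + 2)) ℂ} (hW : IsZonal W)
    {x y : EuclideanSpace ℝ (Fin (n + 2))} (h : ‖x‖ = ‖y‖) (h0 : x 0 = y 0) :
    evalAt x W = evalAt y W := by
  obtain ⟨R, hR, hfix⟩ := exists_orthGroup_map_eq h
  rw [← hR, hW R (hfix _ (by simp [EuclideanSpace.inner_single_right, h0]))]

theorem exists_polynomial_evalAt_planePoint {W : MvPolynomial (Fin (n + 2)) ℂ} {m : ℕ}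
    (hm : W.IsHomogeneous m) : ∃ z : ℂ[X], z.natDegree ≤ m ∧
      ∀ a : ℝ, evalAt (planePoint n a 1) W = z.eval (a : ℂ) := by
  set g : Fin (n + 2) → ℂ[X] := fun i => if i = 0 then X else if i = 1 then 1 else 0 with hg
  refine ⟨MvPolynomial.aeval g W, ?_, fun a => ?_⟩
  · refine (MvPolynomial.aeval_natDegree_le W hm.totalDegree_le g (n := 1) fun i => ?_).trans
      (mul_one m).le
    simp only [hg]
    split_ifs <;> simp
  · have : evalAt (planePoint n a 1) = (Polynomial.aeval (a : ℂ)).comp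
        ((MvPolynomial.aeval g).restrictScalars ℂ) := by
      refine MvPolynomial.algHom_ext fun i => ?_
      rw [evalAt_X, AlgHom.comp_apply]
      refine Fin.cases ?_ (fun i => Fin.cases ?_ (fun i => ?_) i) i
      · simp [hg, planePoint_zero]
      · simp [hg, planePoint_one]
      · have h : i.succ.succ ≠ 1 := fun h => Fin.succ_ne_zero i (Fin.succ_injective _ h)
        simp [hg, planePoint_succ_succ, h]
    rw [this]
    simp

theorem IsZonal.evalAt_planePoint_neg {W : MvPolynomial (Fin (n + 2)) ℂ} {m : ℕ}
    (hW : IsZonal W) (hm : W.IsHomogeneous m) (a : ℝ) :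
    evalAt (planePoint n (-a) 1) W = (-1) ^ m * evalAt (planePoint n a 1) W := by
  have hnorm : ‖planePoint n a (-1)‖ = ‖planePoint n a 1‖ := by
    rw [← sq_eq_sq₀ (norm_nonneg _) (norm_nonneg _), norm_sq_planePoint, norm_sq_planePoint,
      neg_one_sq, one_pow]
  have h := evalAt_smul hm (-1) (planePoint n a (-1))
  rw [smul_planePoint, hW.evalAt_eq hnorm (by rw [planePoint_zero, planePoint_zero])] at h
  simpa using h

theorem IsZonal.evalAt_eq_pow_mul {W : MvPolynomial (Fin (n + 2)) ℂ} {m : ℕ} (hW : IsZonal W)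
    (hm : W.IsHomogeneous m) {x : EuclideanSpace ℝ (Fin (n + 2))} {b : ℝ} (hb : b ≠ 0)
    (hbx : b ^ 2 = ‖x‖ ^ 2 - x 0 ^ 2) :
    evalAt x W = (b : ℂ) ^ m * evalAt (planePoint n (x 0 / b) 1) W := by
  rw [← evalAt_smul hm, smul_planePoint, mul_div_cancel₀ _ hb, mul_one]
  refine hW.evalAt_eq ?_ (planePoint_zero _ _).symm
  rw [← sq_eq_sq₀ (norm_nonneg _) (norm_nonneg _), norm_sq_planePoint, hbx, add_sub_cancel]

theorem infinite_image_ofReal {s : Set ℝ} (hs : s.Infinite) :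
    (((↑) : ℝ → ℂ) '' s).Infinite :=
  hs.image Complex.ofReal_injective.injOn

theorem even_sub_of_coeff_ne_zero {z : ℂ[X]} {m k : ℕ}
    (hz : z.comp (C (-1) * X) = C ((-1) ^ m) * z) (hkm : k ≤ m) (hk : z.coeff k ≠ 0) :
    Even (m - k) := by
  have h : z.coeff k * (-1) ^ k = (-1) ^ m * z.coeff k := by
    simpa only [coeff_C_mul, comp_C_mul_X_coeff] using congrArg (fun p => p.coeff k) hz
  rw [mul_comm, mul_left_inj' hk, ← Nat.sub_add_cancel hkm, pow_add,
    right_eq_mul₀ (pow_ne_zero _ (by norm_num))] at h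
  exact (neg_one_pow_eq_one_iff_even (by norm_num)).1 h

theorem exists_eq_sum_smul_X_pow_sub_two_mul {z : ℂ[X]} {m : ℕ} (hdeg : z.natDegree ≤ m)
    (hz : z.comp (C (-1) * X) = C ((-1) ^ m) * z) :
    ∃ c : ℕ → ℂ, z = ∑ j ∈ Finset.range (m / 2 + 1), c j • X ^ (m - 2 * j) := by
  refine ⟨fun j => z.coeff (m - 2 * j), Polynomial.ext fun k => ?_⟩
  simp only [finsetSum_coeff, coeff_smul, coeff_X_pow, smul_eq_mul, mul_ite, mul_one, mul_zero]
  by_cases hk : z.coeff k = 0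
  · rw [hk, Finset.sum_eq_zero fun j _ => ?_]
    split_ifs with h
    · rw [← h, hk]
    · rfl
  · have hkm : k ≤ m := (le_natDegree_of_ne_zero hk).trans hdeg
    obtain ⟨j, hj⟩ := (even_sub_of_coeff_ne_zero hz hkm hk).two_dvd
    rw [Finset.sum_eq_single_of_mem j (Finset.mem_range.2 (by omega)) fun i hi hij =>
      if_neg (by have := Finset.mem_range.1 hi; omega), if_pos (by omega)]
    congr 1
    omega

theorem IsZonal.exists_eq_sum {W : MvPolynomial (Fin (n + 2)) ℂ} {m : ℕ} (hW : IsZonal W)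
    (hm : W.IsHomogeneous m) : ∃ c : ℕ → ℂ, W = ∑ j ∈ Finset.range (m / 2 + 1),
      c j • (MvPolynomial.X 0 ^ (m - 2 * j) * axisDistSq n ^ j) := by
  obtain ⟨z, hdeg, hz⟩ := exists_polynomial_evalAt_planePoint hm
  have hpar : z.comp (C (-1) * X) = C ((-1) ^ m) * z := by
    refine eq_of_infinite_eval_eq _ _ ((infinite_image_ofReal infinite_univ).mono ?_)
    rintro _ ⟨a, -, rfl⟩
    simpa [hz] using hW.evalAt_planePoint_neg hm a
  obtain ⟨c, hc⟩ := exists_eq_sum_smul_X_pow_sub_two_mul hdeg hpar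
  refine ⟨c, sub_eq_zero.1 ?_⟩
  -- It suffices to compare values off the axis, where `axisDistSq` does not vanish.
  refine (mul_eq_zero.1 (eq_zero_of_forall_evalAt_eq_zero fun x => ?_)).resolve_left
    (axisDistSq_ne_zero (n := n))
  rw [map_mul, evalAt_axisDistSq]
  have hle : x 0 ^ 2 ≤ ‖x‖ ^ 2 := by
    rw [EuclideanSpace.real_norm_sq_eq]
    exact Finset.single_le_sum (f := fun i => x i ^ 2) (fun i _ => sq_nonneg _) (Finset.mem_univ _)
  rcases hle.eq_or_lt with h0 | hlt
  · rw [h0, sub_self, Complex.ofReal_zero, zero_mul]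
  set b := √(‖x‖ ^ 2 - x 0 ^ 2)
  have hb : b ≠ 0 := (Real.sqrt_pos.2 (sub_pos.2 hlt)).ne'
  have hbx : b ^ 2 = ‖x‖ ^ 2 - x 0 ^ 2 := Real.sq_sqrt (sub_nonneg.2 hle)
  refine mul_eq_zero_of_right _ ?_
  rw [map_sub, sub_eq_zero, hW.evalAt_eq_pow_mul hm hb hbx, hz, hc, eval_finsetSum, map_sum,
    Finset.mul_sum]
  refine Finset.sum_congr rfl fun j hj => ?_
  obtain ⟨k, rfl⟩ := Nat.exists_eq_add_of_le'
    (show 2 * j ≤ m by have := Finset.mem_range.1 hj; omega)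
  have hb' : (b : ℂ) ≠ 0 := Complex.ofReal_ne_zero.2 hb
  rw [map_smul, map_mul, map_pow, map_pow, evalAt_X, evalAt_axisDistSq, ← hbx, eval_smul,
    eval_pow, eval_X, Nat.add_sub_cancel]
  simp only [smul_eq_mul, Complex.ofReal_div, Complex.ofReal_pow, pow_add, pow_mul, div_pow]
  field

theorem IsZonal.evalAt_eq_gegenbauer {W : MvPolynomial (Fin (n + 2)) ℂ} {m : ℕ} (hW : IsZonal W)
    (hm : W.IsHomogeneous m) (hΔ : polyLaplacian (n + 2) W = 0)
    {x : EuclideanSpace ℝ (Fin (n + 2))} (hx : ‖x‖ = 1) :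
    evalAt x W = (((gegenbauer (n / 2) m).eval (x 0) : ℝ) : ℂ) *
      evalAt (EuclideanSpace.single 0 1) W := by
  obtain ⟨c, hc⟩ := hW.exists_eq_sum hm
  set v : ℂ[X] := ∑ j ∈ Finset.range (m / 2 + 1), c j • (X ^ (m - 2 * j) * (1 - X ^ 2) ^ j) with hv
  have hWv : ∀ y : EuclideanSpace ℝ (Fin (n + 2)), ‖y‖ = 1 →
      evalAt y W = v.eval ((y 0 : ℝ) : ℂ) := fun y hy => by
    simp only [hc, hv, map_sum, eval_finsetSum, map_smul, eval_smul, evalAt_zonal hy]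
  have hΔv : ∀ y : EuclideanSpace ℝ (Fin (n + 2)), ‖y‖ = 1 →
      (gegenbauerOp (n / 2) m v).eval ((y 0 : ℝ) : ℂ) = 0 := fun y hy => by
    rw [← map_zero (evalAt y), ← hΔ, hc, hv, map_sum, map_sum, map_sum, eval_finsetSum]
    refine Finset.sum_congr rfl fun j hj => ?_
    obtain ⟨k, rfl⟩ := Nat.exists_eq_add_of_le'
      (show 2 * j ≤ m by have := Finset.mem_range.1 hj; omega)
    rw [map_smul, map_smul, map_smul, evalAt_polyLaplacian_zonal hy, eval_smul,
      Nat.add_sub_cancel]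
  have hode : gegenbauerOp (n / 2) m v = 0 := by
    refine eq_zero_of_infinite_isRoot _
      ((infinite_image_ofReal (Icc_infinite (neg_one_lt_zero (R := ℝ)))).mono ?_)
    rintro _ ⟨τ, hτ, rfl⟩
    have hτ' : 0 ≤ 1 - τ ^ 2 := by nlinarith [hτ.1, hτ.2]
    have hnorm : ‖planePoint n τ √(1 - τ ^ 2)‖ = 1 := by
      rw [← sq_eq_sq₀ (norm_nonneg _) zero_le_one, norm_sq_planePoint, Real.sq_sqrt hτ']
      ring
    change (gegenbauerOp (n / 2) m v).eval (τ : ℂ) = 0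
    simpa only [planePoint_zero] using hΔv _ hnorm
  have hν : -(1 / 2) < (n : ℝ) / 2 := by
    have : (0 : ℝ) ≤ n := n.cast_nonneg
    linarith
  rw [hWv x hx, hWv _ (by simp), mul_comm]
  conv_lhs => rw [eq_gegenbauer_of_gegenbauerOp_eq_zero hν hode]
  rw [eval_smul, eval_map_algebraMap, ← Complex.coe_algebraMap, aeval_algebraMap_apply,
    Polynomial.coe_aeval_eq_eval]
  simp

end Zonal

/-! ### Averages of spherical harmonics over the orthogonal group -/

section ZonalAverage

variable {d : ℕ}

theorem inner_rotate (R : OrthGroup d) (x y : sphere (0 : EuclideanSpace ℝ (Fin d)) 1) :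
    inner ℝ (rotate R x : EuclideanSpace ℝ (Fin d)) (rotate R y) =
      inner ℝ (x : EuclideanSpace ℝ (Fin d)) y := by
  rw [coe_rotate, coe_rotate]
  exact Unitary.inner_map_map R _ _

theorem continuous_rotate_inv_left (x : sphere (0 : EuclideanSpace ℝ (Fin d)) 1) :
    Continuous fun R : OrthGroup d => rotate R⁻¹ x :=
  Continuous.comp (f := fun R : OrthGroup d => (R, x)) continuous_rotate_inv
    (Continuous.prodMk continuous_id continuous_const)

/-- The first standard unit vector. -/
noncomputable def pole (n : ℕ) : sphere (0 : EuclideanSpace ℝ (Fin (n + 2))) 1 :=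
  ⟨EuclideanSpace.single 0 1, by simp⟩

theorem integral_haarProb_pole {n m : ℕ} {P : MvPolynomial (Fin (n + 2)) ℂ}
    (hP : P.IsHomogeneous m) (hΔ : polyLaplacian (n + 2) P = 0)
    {G : sphere (0 : EuclideanSpace ℝ (Fin (n + 2))) 1 → ℂ} (hG : Continuous G)
    (e : sphere (0 : EuclideanSpace ℝ (Fin (n + 2))) 1) :
    ∫ R, G (rotate R⁻¹ (pole n)) * evalAt (rotate R⁻¹ e) P ∂haarProb (n + 2) =
      (((gegenbauer (n / 2) m).eval ((e : EuclideanSpace ℝ (Fin (n + 2))) 0) : ℝ) : ℂ) *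
      ∫ R, G (rotate R⁻¹ (pole n)) * evalAt (rotate R⁻¹ (pole n)) P ∂haarProb (n + 2) := by
  obtain ⟨W, hWm, hW⟩ := exists_isHomogeneous_average (haarProb (n + 2))
    (Q := fun R : OrthGroup (n + 2) => linSubst (R⁻¹).1 P)
    (fun R => isHomogeneous_linSubst _ hP)
    (fun α => continuous_coeff_linSubst (continuous_subtype_val.comp continuous_inv) P α)
    (hG.comp (continuous_rotate_inv_left (pole n)))
  have hev : ∀ x, evalAt x W = ∫ R : OrthGroup (n + 2), G (rotate R⁻¹ (pole n)) *
      evalAt ((R⁻¹).1 x) P ∂haarProb (n + 2) := by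
    intro x
    simpa only [AlgHom.toLinearMap_apply, evalAt_linSubst, Function.comp_apply] using
      hW (evalAt x).toLinearMap
  have hzonal : IsZonal W := by
    intro T hT x
    have hT' : rotate T (pole n) = pole n := Subtype.ext hT
    rw [hev, hev, ← integral_mul_left_eq_self _ T]
    refine integral_congr_ae (.of_forall fun R => ?_)
    have hpole : rotate (T * R)⁻¹ (pole n) = rotate R⁻¹ (pole n) := by
      rw [mul_inv_rev, rotate_mul, ← hT', rotate_inv_rotate, hT']
    have harg : (T * R)⁻¹.1 (T.1 x) = R⁻¹.1 x := by
      rw [mul_inv_rev]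
      exact congrArg (R⁻¹).1 (inv_apply_apply T x)
    simp only [hpole, harg]
  have hΔW : polyLaplacian (n + 2) W = 0 := by
    ext α
    simpa [polyLaplacian_linSubst, hΔ] using
      hW (MvPolynomial.lcoeff ℂ α ∘ₗ polyLaplacian (n + 2))
  have h := hzonal.evalAt_eq_gegenbauer hWm hΔW (norm_eq_of_mem_sphere e)
  rw [hev, hev] at h
  exact h

theorem integral_haarProb_mul_harmonic (hd : 2 ≤ d) {m : ℕ}
    {Y : sphere (0 : EuclideanSpace ℝ (Fin d)) 1 → ℂ} (hY : Y ∈ sphericalHarmonics d m)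
    {G : sphere (0 : EuclideanSpace ℝ (Fin d)) 1 → ℂ} (hG : Continuous G)
    (η e : sphere (0 : EuclideanSpace ℝ (Fin d)) 1) :
    ∫ R, G (rotate R⁻¹ η) * Y (rotate R⁻¹ e) ∂haarProb d =
      (((gegenbauer (((d : ℝ) - 2) / 2) m).eval
        (inner ℝ (η : EuclideanSpace ℝ (Fin d)) e) : ℝ) : ℂ) *
      ∫ R, G (rotate R⁻¹ η) * Y (rotate R⁻¹ η) ∂haarProb d := by
  obtain ⟨n, rfl⟩ := Nat.exists_eq_add_of_le' hd
  obtain ⟨P, ⟨hP, hΔ⟩, rfl⟩ := hY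
  obtain ⟨T, hT⟩ := exists_rotate_eq η (pole n)
  have htranslate : ∀ x, ∫ R, G (rotate R⁻¹ η) * restrictToSphere (n + 2) P (rotate R⁻¹ x)
      ∂haarProb (n + 2) = ∫ R, G (rotate R⁻¹ (pole n)) *
        restrictToSphere (n + 2) P (rotate R⁻¹ (rotate T x)) ∂haarProb (n + 2) := by
    intro x
    rw [← integral_mul_left_eq_self (fun R => G (rotate R⁻¹ (pole n)) *
        restrictToSphere (n + 2) P (rotate R⁻¹ (rotate T x))) T]
    simp_rw [mul_inv_rev, rotate_mul, rotate_inv_rotate, ← hT, rotate_inv_rotate]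
  have hinner : inner ℝ (η : EuclideanSpace ℝ (Fin (n + 2))) e =
      (rotate T e : EuclideanSpace ℝ (Fin (n + 2))) 0 := by
    rw [← inner_rotate T, hT]
    simp [pole, EuclideanSpace.inner_single_left]
  have horder : (((n + 2 : ℕ) : ℝ) - 2) / 2 = n / 2 := by push_cast; ring
  rw [htranslate, htranslate, hinner, horder, hT]
  exact integral_haarProb_pole hP hΔ hG (rotate T e)

theorem integral_haarProb_mul_conj_harmonic (hd : 2 ≤ d) {m : ℕ}
    {Y : sphere (0 : EuclideanSpace ℝ (Fin d)) 1 → ℂ} (hY : Y ∈ sphericalHarmonics d m)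
    {G : sphere (0 : EuclideanSpace ℝ (Fin d)) 1 → ℂ} (hG : Continuous G)
    (η e : sphere (0 : EuclideanSpace ℝ (Fin d)) 1) :
    ∫ R, G (rotate R⁻¹ η) * conj (Y (rotate R⁻¹ e)) ∂haarProb d =
      (((gegenbauer (((d : ℝ) - 2) / 2) m).eval
        (inner ℝ (η : EuclideanSpace ℝ (Fin d)) e) : ℝ) : ℂ) *
      ∫ R, G (rotate R⁻¹ η) * conj (Y (rotate R⁻¹ η)) ∂haarProb d := by
  have h := congrArg conj (integral_haarProb_mul_harmonic hd hY
    (Complex.continuous_conj.comp hG) η e)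
  rw [map_mul, Complex.conj_ofReal, ← integral_conj, ← integral_conj] at h
  simpa using h

theorem continuous_of_mem_sphericalHarmonics {m : ℕ}
    {Y : sphere (0 : EuclideanSpace ℝ (Fin d)) 1 → ℂ} (hY : Y ∈ sphericalHarmonics d m) :
    Continuous Y := by
  obtain ⟨P, -, rfl⟩ := hY
  exact (continuous_evalAt P).comp continuous_subtype_val

end ZonalAverage

/-! ### The data of a function in terms of its harmonic coefficients -/

section Data

open scoped NNReal

variable {d : ℕ}

theorem continuous_comp_stereoInv {f : EuclideanSpace ℝ (Fin (d + 1)) → ℂ}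
    (hf : ContinuousOn f (sphere 0 1)) :
    Continuous fun y : EuclideanSpace ℝ (Fin d) => f (stereoInv y) :=
  hf.comp_continuous continuous_stereoInv fun y => by simp [norm_stereoInv]

/-- The product of `f ∘ Λ⁻¹` and the power of the conformal factor that occurs in the spherical
transform. -/
noncomputable def weightedPullback (f : EuclideanSpace ℝ (Fin (d + 1)) → ℂ)
    (y : EuclideanSpace ℝ (Fin d)) : ℂ :=
  f (stereoInv y) / (((1 + ‖y‖ ^ 2) ^ (d - 1) : ℝ) : ℂ)

theorem continuous_weightedPullback {f : EuclideanSpace ℝ (Fin (d + 1)) → ℂ}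
    (hf : ContinuousOn f (sphere 0 1)) : Continuous (weightedPullback f) := by
  refine (continuous_comp_stereoInv hf).div (by fun_prop) fun y => ?_
  exact Complex.ofReal_ne_zero.2 (by positivity)

/-- The point with parameter `ω` of the sphere of radius `c t` around `c ψ`. For `t = tanh λ` the
inverse stereographic projection maps this sphere onto `subsphere lam ψ c`. -/
noncomputable def planarPoint (t c : ℝ) (ψ ω : sphere (0 : EuclideanSpace ℝ (Fin d)) 1) :
    EuclideanSpace ℝ (Fin d) :=
  c • (ψ : EuclideanSpace ℝ (Fin d)) + (c * t) • (ω : EuclideanSpace ℝ (Fin d))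

theorem continuous_planarPoint (t c : ℝ) :
    Continuous fun p : sphere (0 : EuclideanSpace ℝ (Fin d)) 1 ×
      sphere (0 : EuclideanSpace ℝ (Fin d)) 1 => planarPoint t c p.1 p.2 := by
  unfold planarPoint
  fun_prop

theorem dist_planarPoint {t c : ℝ} (ht : 0 ≤ t) (hc : 0 ≤ c)
    (ψ ω ω' : sphere (0 : EuclideanSpace ℝ (Fin d)) 1) :
    dist (planarPoint t c ψ ω) (planarPoint t c ψ ω') = c * t * dist ω ω' := by
  rw [planarPoint, planarPoint, dist_add_left, dist_smul₀, Real.norm_of_nonneg (by positivity),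
    Subtype.dist_eq]

theorem planarPoint_rotate (t c : ℝ) (R : OrthGroup d)
    (ψ ω : sphere (0 : EuclideanSpace ℝ (Fin d)) 1) :
    planarPoint t c (rotate R ψ) (rotate R ω) = R.1 (planarPoint t c ψ ω) := by
  simp only [planarPoint, coe_rotate, map_add, map_smul]

theorem norm_planarPoint {t c : ℝ} (ht : 0 ≤ t) (hc : 0 ≤ c)
    (ψ ω : sphere (0 : EuclideanSpace ℝ (Fin d)) 1) :
    ‖planarPoint t c ψ ω‖ =
      c * √(1 + t ^ 2 + 2 * t * inner ℝ (ψ : EuclideanSpace ℝ (Fin d)) ω) := by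
  rw [← Real.sqrt_sq (norm_nonneg _), planarPoint, norm_add_sq_real, inner_smul_right,
    real_inner_smul_left, norm_smul, norm_smul, norm_eq_of_mem_sphere, norm_eq_of_mem_sphere,
    Real.norm_of_nonneg hc, Real.norm_of_nonneg (mul_nonneg hc ht)]
  conv_rhs => rw [← Real.sqrt_sq hc, ← Real.sqrt_mul (sq_nonneg c)]
  congr 1
  ring

theorem inner_planarPoint (t c : ℝ) (ψ ω : sphere (0 : EuclideanSpace ℝ (Fin d)) 1) :
    inner ℝ (planarPoint t c ψ ω) (ψ : EuclideanSpace ℝ (Fin d)) =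
      c * (1 + t * inner ℝ (ψ : EuclideanSpace ℝ (Fin d)) ω) := by
  rw [planarPoint, inner_add_left, real_inner_smul_left, real_inner_smul_left,
    real_inner_self_eq_norm_sq, norm_eq_of_mem_sphere, real_inner_comm]
  ring

theorem planarPoint_ne_zero {t c : ℝ} (ht : 0 ≤ t) (ht1 : t < 1) (hc : 0 < c)
    (ψ ω : sphere (0 : EuclideanSpace ℝ (Fin d)) 1) : planarPoint t c ψ ω ≠ 0 := by
  intro h
  have hnorm := congrArg norm (eq_neg_of_add_eq_zero_left h)
  rw [norm_neg, norm_smul, norm_smul, norm_eq_of_mem_sphere, norm_eq_of_mem_sphere,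
    Real.norm_of_nonneg hc.le, Real.norm_of_nonneg (by positivity)] at hnorm
  nlinarith

theorem exists_planarPoint_eq_smul {t c : ℝ} (ht : 0 ≤ t) (ht1 : t < 1) (hc : 0 < c)
    (ψ ω : sphere (0 : EuclideanSpace ℝ (Fin d)) 1) {τ : ℝ}
    (hτ : inner ℝ (ψ : EuclideanSpace ℝ (Fin d)) ω = τ) :
    ∃ η : sphere (0 : EuclideanSpace ℝ (Fin d)) 1,
      planarPoint t c ψ ω =
        (c * √(1 + t ^ 2 + 2 * t * τ)) • (η : EuclideanSpace ℝ (Fin d)) ∧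
      inner ℝ (η : EuclideanSpace ℝ (Fin d)) ψ = (1 + t * τ) / √(1 + t ^ 2 + 2 * t * τ) := by
  have hnorm := norm_planarPoint ht hc.le ψ ω
  have hpos := norm_pos_iff.2 (planarPoint_ne_zero ht ht1 hc ψ ω)
  refine ⟨⟨‖planarPoint t c ψ ω‖⁻¹ • planarPoint t c ψ ω, by simp [norm_smul, hpos.ne']⟩, ?_, ?_⟩
  · rw [← hτ, ← hnorm, smul_inv_smul₀ hpos.ne']
  · rw [real_inner_smul_left, inner_planarPoint, hnorm, hτ, mul_inv, mul_mul_mul_comm,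
      inv_mul_cancel₀ hc.ne', one_mul, div_eq_inv_mul]

theorem setIntegral_range_stereoInv_comp {X E : Type*} [MetricSpace X] [CompactSpace X]
    [MeasurableSpace X] [BorelSpace X] [NormedAddCommGroup E] [NormedSpace ℝ E]
    {y : X → EuclideanSpace ℝ (Fin d)} (hy : Continuous y) {ρ : ℝ} (hρ : 0 < ρ)
    (hdist : ∀ a b, dist (y a) (y b) = ρ * dist a b) (k : ℕ)
    (f : EuclideanSpace ℝ (Fin (d + 1)) → E) :
    ∫ z in range fun a => stereoInv (y a), f z ∂μHE[k] =
      ∫ a, (2 * ρ / (1 + ‖y a‖ ^ 2)) ^ k • f (stereoInv (y a)) ∂μHE[k] := by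
  have hinj : Function.Injective y := fun a b h => by
    have := hdist a b
    rw [h, dist_self] at this
    exact dist_eq_zero.1 ((mul_eq_zero.1 this.symm).resolve_left hρ.ne')
  set g : X → ℝ≥0 := fun a => NNReal.sqrt ρ.toNNReal * stereoFactor (y a) with hg
  have hroot : ((NNReal.sqrt ρ.toNNReal : ℝ≥0) : ℝ) ^ 2 = ρ := by
    rw [← NNReal.coe_pow, NNReal.sq_sqrt, Real.coe_toNNReal _ hρ.le]
  have hgpow : ∀ a, (g a : ℝ) ^ (2 * k) = (2 * ρ / (1 + ‖y a‖ ^ 2)) ^ k := fun a => by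
    rw [hg, NNReal.coe_mul, mul_pow, stereoFactor_pow, pow_mul, hroot, ← mul_pow]
    ring
  rw [setIntegral_range_euclideanHausdorffMeasure (Φ := fun a => stereoInv (y a)) (g := g)
    ((continuous_stereoInv.comp hy).measurableEmbedding (injective_stereoInv.comp hinj))
    (measurable_const.mul (continuous_stereoFactor.comp hy).measurable)
    (fun a => mul_pos (NNReal.sqrt_pos.2 (Real.toNNReal_pos.2 hρ)) (stereoFactor_pos _))
    fun a b => edist_eq_of_dist_eq ?_]
  · simp_rw [hgpow]
  · rw [dist_stereoInv, hdist, NNReal.coe_mul, NNReal.coe_mul]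
    change _ = (NNReal.sqrt ρ.toNNReal * √(2 / (1 + ‖y a‖ ^ 2))) *
      (NNReal.sqrt ρ.toNNReal * √(2 / (1 + ‖y b‖ ^ 2))) * dist a b
    linear_combination
      -(√(2 / (1 + ‖y a‖ ^ 2)) * √(2 / (1 + ‖y b‖ ^ 2)) * dist a b) * hroot

theorem sphericalTransform_subsphere {lam : ℝ} (hlam : 0 < lam)
    (f : EuclideanSpace ℝ (Fin (d + 1)) → ℂ) (ψ : sphere (0 : EuclideanSpace ℝ (Fin d)) 1) {c : ℝ}
    (hc : 0 < c) :
    sphericalTransform f (subsphere lam ψ c) = (((2 * c * Real.tanh lam) ^ (d - 1) : ℝ) : ℂ) *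
      ∫ ω, weightedPullback f (planarPoint (Real.tanh lam) c ψ ω) ∂μHE[d - 1] := by
  have ht := tanh_pos hlam
  have hcont : Continuous (planarPoint (Real.tanh lam) c ψ) :=
    (continuous_planarPoint _ _).comp (.prodMk_right ψ)
  rw [sphericalTransform, ← integral_const_mul]
  refine (setIntegral_range_stereoInv_comp hcont (mul_pos hc ht)
    (dist_planarPoint ht.le hc.le ψ) (d - 1) f).trans (integral_congr_ae (.of_forall fun ω => ?_))
  simp only [weightedPullback, div_pow, Complex.real_smul]
  push_cast
  ring

theorem sphereVolume_pos (k : ℕ) : 0 < sphereVolume k := by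
  have : 0 < Real.Gamma (((k : ℝ) + 1) / 2) := Real.Gamma_pos_of_pos (by positivity)
  rw [sphereVolume]
  positivity

theorem dataCoeff_eq_integral (hd : 2 ≤ d) {lam : ℝ} (hlam : 0 < lam)
    (f : EuclideanSpace ℝ (Fin (d + 1)) → ℂ) (Y : sphere (0 : EuclideanSpace ℝ (Fin d)) 1 → ℂ)
    {c : ℝ} (hc : 0 < c) :
    dataCoeff lam f Y c = 1 / (sphereVolume (d - 2) : ℂ) *
      ∫ ψ, (∫ ω, weightedPullback f (planarPoint (Real.tanh lam) c ψ ω) * conj (Y ψ)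
        ∂(volume : Measure (EuclideanSpace ℝ (Fin d))).toSphere)
        ∂(volume : Measure (EuclideanSpace ℝ (Fin d))).toSphere := by
  obtain ⟨n, rfl⟩ := Nat.exists_eq_add_of_le' (show 1 ≤ d by omega)
  have hscale : (((2 * c * Real.tanh lam) ^ n : ℝ) : ℂ) ≠ 0 :=
    Complex.ofReal_ne_zero.2 (pow_ne_zero _ (by have := tanh_pos hlam; positivity))
  rw [dataCoeff]
  simp_rw [sphericalTransform_subsphere hlam f _ hc, Nat.add_sub_cancel,
    euclideanHausdorffMeasure_sphere (n := n) (by omega), mul_assoc (Complex.ofReal _)]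
  rw [integral_const_mul, ← mul_assoc]
  simp_rw [integral_mul_const]
  rw [Complex.ofReal_mul]
  congr 1
  field

/-- The harmonic coefficient of `weightedPullback f`. -/
noncomputable def weightedCoeff (f : EuclideanSpace ℝ (Fin (d + 1)) → ℂ)
    (Y : sphere (0 : EuclideanSpace ℝ (Fin d)) 1 → ℂ) (r : ℝ) : ℂ :=
  ((1 + r ^ 2) ^ (d - 1))⁻¹ • harmonicCoeff f Y r

theorem weightedCoeff_eq_integral (f : EuclideanSpace ℝ (Fin (d + 1)) → ℂ)
    (Y : sphere (0 : EuclideanSpace ℝ (Fin d)) 1 → ℂ) (r : ℝ) :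
    weightedCoeff f Y r = ∫ ζ, weightedPullback f (r • (ζ : EuclideanSpace ℝ (Fin d))) *
      conj (Y ζ) ∂(volume : Measure (EuclideanSpace ℝ (Fin d))).toSphere := by
  rw [weightedCoeff, harmonicCoeff, ← integral_smul]
  refine integral_congr_ae (.of_forall fun ζ => ?_)
  simp only [weightedPullback, norm_smul, norm_eq_of_mem_sphere, mul_one, Real.norm_eq_abs, sq_abs,
    Complex.real_smul, Complex.ofReal_inv]
  ring

theorem continuous_integral_of_compactSpace {X K E : Type*} [TopologicalSpace X]
    [FirstCountableTopology X] [LocallyCompactSpace X] [TopologicalSpace K] [CompactSpace K]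
    [MeasurableSpace K] [OpensMeasurableSpace K] [SecondCountableTopology K] {μ : Measure K}
    [IsFiniteMeasure μ] [NormedAddCommGroup E] [NormedSpace ℝ E] {F : X → K → E}
    (hF : Continuous (Function.uncurry F)) :
    Continuous fun x => ∫ k, F x k ∂μ := by
  simpa using continuous_parametric_integral_of_continuous (μ := μ) hF isCompact_univ

theorem continuous_harmonicCoeff {f : EuclideanSpace ℝ (Fin (d + 1)) → ℂ}
    (hf : ContinuousOn f (sphere 0 1)) {Y : sphere (0 : EuclideanSpace ℝ (Fin d)) 1 → ℂ}
    (hY : Continuous Y) : Continuous (harmonicCoeff f Y) := by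
  have hsmul : Continuous fun p : ℝ × sphere (0 : EuclideanSpace ℝ (Fin d)) 1 =>
      p.1 • (p.2 : EuclideanSpace ℝ (Fin d)) := by fun_prop
  exact continuous_integral_of_compactSpace (((continuous_comp_stereoInv hf).comp hsmul).mul
    (Complex.continuous_conj.comp (hY.comp continuous_snd)))

theorem integral_weightedPullback_rotate (hd : 2 ≤ d) {m : ℕ}
    {f : EuclideanSpace ℝ (Fin (d + 1)) → ℂ} (hf : ContinuousOn f (sphere 0 1))
    {Y : sphere (0 : EuclideanSpace ℝ (Fin d)) 1 → ℂ} (hY : Y ∈ sphericalHarmonics d m)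
    (e η : sphere (0 : EuclideanSpace ℝ (Fin d)) 1) (r : ℝ) :
    (volume : Measure (EuclideanSpace ℝ (Fin d))).toSphere.real univ •
      ∫ R : OrthGroup d, weightedPullback f ((R⁻¹).1 (r • (η : EuclideanSpace ℝ (Fin d)))) *
        conj (Y (rotate R⁻¹ e)) ∂haarProb d =
    (((gegenbauer (((d : ℝ) - 2) / 2) m).eval
      (inner ℝ (η : EuclideanSpace ℝ (Fin d)) e) : ℝ) : ℂ) * weightedCoeff f Y r := by
  have hG : Continuous fun ζ : sphere (0 : EuclideanSpace ℝ (Fin d)) 1 =>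
      weightedPullback f (r • (ζ : EuclideanSpace ℝ (Fin d))) :=
    (continuous_weightedPullback hf).comp (by fun_prop)
  have havg := integral_eq_haar_average isRotationInvariant_toSphere
    (hG.mul (Complex.continuous_conj.comp (continuous_of_mem_sphericalHarmonics hY))) η
  have hzonal := integral_haarProb_mul_conj_harmonic hd hY hG η e
  simp only [Pi.mul_apply, Function.comp_apply, coe_rotate, ← map_smul] at havg hzonal
  rw [weightedCoeff_eq_integral, havg, hzonal, mul_smul_comm]

theorem integral_integral_planarPoint (t c : ℝ) {G : EuclideanSpace ℝ (Fin d) → ℂ}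
    (hG : Continuous G) {Z : sphere (0 : EuclideanSpace ℝ (Fin d)) 1 → ℂ} (hZ : Continuous Z)
    (e : sphere (0 : EuclideanSpace ℝ (Fin d)) 1) :
    ∫ ψ, (∫ ω, G (planarPoint t c ψ ω) * Z ψ
        ∂(volume : Measure (EuclideanSpace ℝ (Fin d))).toSphere)
        ∂(volume : Measure (EuclideanSpace ℝ (Fin d))).toSphere =
      ∫ ω, ((volume : Measure (EuclideanSpace ℝ (Fin d))).toSphere.real univ •
        ∫ R : OrthGroup d, G ((R⁻¹).1 (planarPoint t c e ω)) * Z (rotate R⁻¹ e) ∂haarProb d)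
        ∂(volume : Measure (EuclideanSpace ℝ (Fin d))).toSphere := by
  set σ := (volume : Measure (EuclideanSpace ℝ (Fin d))).toSphere with hσ
  have hcont : Continuous fun ψ => ∫ ω, G (planarPoint t c ψ ω) * Z ψ ∂σ :=
    continuous_integral_of_compactSpace
      ((hG.comp (continuous_planarPoint t c)).mul (hZ.comp continuous_fst))
  have hrot : ∀ T : OrthGroup d, ∫ ω, G (planarPoint t c (rotate T e) ω) * Z (rotate T e) ∂σ =
      ∫ ω, G (T.1 (planarPoint t c e ω)) * Z (rotate T e) ∂σ := fun T => by
    rw [← (isRotationInvariant_toSphere T).integral_comp (measurableEmbedding_rotate T)]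
    simp only [planarPoint_rotate, hσ]
  have hjoint : Continuous fun p : OrthGroup d × sphere (0 : EuclideanSpace ℝ (Fin d)) 1 =>
      G ((p.1⁻¹).1 (planarPoint t c e p.2)) * Z (rotate p.1⁻¹ e) := by
    refine (hG.comp ?_).mul (hZ.comp ((continuous_rotate_inv_left e).comp continuous_fst))
    exact (continuous_subtype_val.comp (continuous_inv.comp continuous_fst)).clm_apply
      ((continuous_planarPoint t c).comp (continuous_const.prodMk continuous_snd))
  rw [integral_eq_haar_average isRotationInvariant_toSphere hcont e]
  simp_rw [hrot]
  rw [integral_integral_swap (hjoint.integrable_of_hasCompactSupport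
    (HasCompactSupport.of_compactSpace _)), integral_smul]

theorem dataCoeff_eq_integral_kernel (hd : 2 ≤ d) {lam : ℝ} (hlam : 0 < lam) {m : ℕ}
    {f : EuclideanSpace ℝ (Fin (d + 1)) → ℂ} (hf : ContinuousOn f (sphere 0 1))
    {Y : sphere (0 : EuclideanSpace ℝ (Fin d)) 1 → ℂ} (hY : Y ∈ sphericalHarmonics d m)
    {c : ℝ} (hc : 0 < c) :
    dataCoeff lam f Y c =
      ∫ x in Ioi (0 : ℝ), (kernel d m lam x : ℂ) * weightedCoeff f Y (c * x) := by
  obtain ⟨n, rfl⟩ := Nat.exists_eq_add_of_le' (show 1 ≤ d by omega)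
  set t := Real.tanh lam with ht
  let e : sphere (0 : EuclideanSpace ℝ (Fin (n + 1))) 1 :=
    ⟨EuclideanSpace.single (Fin.last n) 1, by simp⟩
  let φ : ℝ → ℂ := fun τ => (((gegenbauer ((((n + 1 : ℕ) : ℝ) - 2) / 2) m).eval
    ((1 + t * τ) / √(1 + t ^ 2 + 2 * t * τ)) : ℝ) : ℂ) *
      weightedCoeff f Y (c * √(1 + t ^ 2 + 2 * t * τ))
  have hω : ∀ ω : sphere (0 : EuclideanSpace ℝ (Fin (n + 1))) 1,
      (volume : Measure (EuclideanSpace ℝ (Fin (n + 1)))).toSphere.real univ •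
        ∫ R : OrthGroup (n + 1), weightedPullback f ((R⁻¹).1 (planarPoint t c e ω)) *
          conj (Y (rotate R⁻¹ e)) ∂haarProb (n + 1) =
      φ ((ω : EuclideanSpace ℝ (Fin (n + 1))) (Fin.last n)) := fun ω => by
    obtain ⟨η, hη, hηe⟩ := exists_planarPoint_eq_smul (tanh_pos hlam).le (Real.tanh_lt_one lam) hc
      e ω (τ := (ω : EuclideanSpace ℝ (Fin (n + 1))) (Fin.last n))
      (by simp [e, EuclideanSpace.inner_single_left])
    rw [hη, integral_weightedPullback_rotate hd hf hY e η, hηe]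
  have hv : (sphereVolume (n - 1) : ℂ) ≠ 0 := Complex.ofReal_ne_zero.2 (sphereVolume_pos _).ne'
  rw [dataCoeff_eq_integral hd hlam f Y hc, integral_integral_planarPoint _ _
    (continuous_weightedPullback hf) (Z := fun ψ => conj (Y ψ)) (Complex.continuous_conj.comp
      (continuous_of_mem_sphericalHarmonics hY)) e, integral_congr_ae (.of_forall hω),
    integral_latitude_toSphere (by omega) φ, integral_kernel_mul m hlam
      (fun x => weightedCoeff f Y (c * x)), show n + 1 - 2 = n - 1 by omega, Complex.real_smul,
    ← mul_assoc, one_div_mul_cancel hv, one_mul,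
    show (((n + 1 : ℕ) : ℝ) - 3) / 2 = ((n : ℝ) - 2) / 2 by push_cast; ring]
  simp only [Complex.real_smul, φ, ht]

end Data

/-! ### Inversion -/

section Inversion

variable {d : ℕ} {f : EuclideanSpace ℝ (Fin (d + 1)) → ℂ}
  {Y : sphere (0 : EuclideanSpace ℝ (Fin d)) 1 → ℂ}

theorem exists_norm_harmonicCoeff_le (hf : ContinuousOn f (sphere 0 1)) (hY : Continuous Y) :
    ∃ M, ∀ r, ‖harmonicCoeff f Y r‖ ≤ M := by
  obtain ⟨B, hB⟩ :=
    (isCompact_sphere (0 : EuclideanSpace ℝ (Fin (d + 1))) 1).exists_bound_of_continuousOn hf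
  have hinteg : Integrable (fun ζ => B * ‖Y ζ‖)
      (volume : Measure (EuclideanSpace ℝ (Fin d))).toSphere :=
    (continuous_const.mul hY.norm).integrable_of_hasCompactSupport
      (HasCompactSupport.of_compactSpace _)
  refine ⟨_, fun r => norm_integral_le_of_norm_le hinteg (.of_forall fun ζ => ?_)⟩
  rw [norm_mul, RCLike.norm_conj]
  exact mul_le_mul_of_nonneg_right (hB _ (by simp [norm_stereoInv])) (norm_nonneg _)

theorem continuous_inv_one_add_sq_pow (k : ℕ) : Continuous fun r : ℝ => ((1 + r ^ 2) ^ k)⁻¹ :=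
  Continuous.inv₀ (by fun_prop) fun r => by positivity

theorem continuous_weightedCoeff (hf : ContinuousOn f (sphere 0 1)) (hY : Continuous Y) :
    Continuous (weightedCoeff f Y) :=
  (continuous_inv_one_add_sq_pow _).smul (continuous_harmonicCoeff hf hY)

theorem mellinConvergent_weightedCoeff (hf : ContinuousOn f (sphere 0 1)) (hY : Continuous Y)
    {s : ℂ} (h0 : 0 < s.re) (h1 : s.re < 2 * (d - 1 : ℕ)) :
    MellinConvergent (weightedCoeff f Y) s := by
  obtain ⟨M, hM⟩ := exists_norm_harmonicCoeff_le hf hY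
  have hM0 : 0 ≤ M := (norm_nonneg _).trans (hM 0)
  have hle : ∀ r, ‖weightedCoeff f Y r‖ ≤ M * ‖((1 + r ^ 2) ^ (d - 1))⁻¹‖ := fun r => by
    rw [weightedCoeff, norm_smul, mul_comm]
    exact mul_le_mul_of_nonneg_right (hM r) (norm_nonneg _)
  refine mellinConvergent_of_isBigO_rpow
    ((continuous_weightedCoeff hf hY).continuousOn.locallyIntegrableOn measurableSet_Ioi)
    (.of_bound M ?_) h1 (b := 0) (.of_bound M (.of_forall fun r => (hle r).trans ?_)) h0
  · filter_upwards [eventually_gt_atTop 0] with r hr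
    refine (hle r).trans (mul_le_mul_of_nonneg_left ?_ hM0)
    rw [Real.rpow_neg hr.le, norm_inv, norm_inv, Real.rpow_mul hr.le, Real.rpow_natCast,
      Real.rpow_two, norm_pow, norm_pow, Real.norm_of_nonneg (by positivity),
      Real.norm_of_nonneg (by positivity)]
    gcongr
    linarith
  · rw [neg_zero, Real.rpow_zero, norm_one, Real.norm_of_nonneg (by positivity)]
    refine mul_le_mul_of_nonneg_left (inv_le_one_of_one_le₀ (one_le_pow₀ ?_)) hM0
    linarith [sq_nonneg r]

theorem one_add_sq_pow_mul_weightedCoeff (f : EuclideanSpace ℝ (Fin (d + 1)) → ℂ)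
    (Y : sphere (0 : EuclideanSpace ℝ (Fin d)) 1 → ℂ) (r : ℝ) :
    (1 + (r : ℂ) ^ 2) ^ (d - 1) * weightedCoeff f Y r = harmonicCoeff f Y r := by
  have h : (1 + r ^ 2) ^ (d - 1) • weightedCoeff f Y r = harmonicCoeff f Y r :=
    smul_inv_smul₀ (by positivity) _
  rw [← h, Complex.real_smul]
  push_cast
  rfl

theorem diniAt_weightedCoeff {r : ℝ} (h : DiniAt (harmonicCoeff f Y) r) :
    DiniAt (weightedCoeff f Y) r :=
  h.smul (continuous_inv_one_add_sq_pow _)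
    (DifferentiableAt.inv (by fun_prop) (by positivity))

variable {m : ℕ} {lam : ℝ}

theorem hasMellin_dataCoeff (hd : 2 ≤ d) (hlam : 0 < lam) (hf : ContinuousOn f (sphere 0 1))
    (hY : Y ∈ sphericalHarmonics d m) {s : ℂ} (h0 : 0 < s.re) (h1 : s.re < 2 * (d - 1 : ℕ)) :
    HasMellin (dataCoeff lam f Y) s
      (mellin (fun x => (kernel d m lam x : ℂ)) (1 - s) * mellin (weightedCoeff f Y) s) := by
  have hYc := continuous_of_mem_sphericalHarmonics hY
  exact hasMellin_convolution (Complex.measurable_ofReal.comp (measurable_kernel m d lam))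
    (continuous_weightedCoeff hf hYc).measurable (mellinConvergent_kernel m hd hlam _)
    (mellinConvergent_weightedCoeff hf hYc h0 h1)
    fun c hc => dataCoeff_eq_integral_kernel hd hlam hf hY hc

theorem ae_mellinQuotient_eq (hd : 2 ≤ d) (hlam : 0 < lam) (hf : ContinuousOn f (sphere 0 1))
    (hY : Y ∈ sphericalHarmonics d m) {ϱ : ℝ} (h0 : 0 < ϱ) (h1 : ϱ < 2 * (d - 1 : ℕ)) :
    ∀ᵐ y : ℝ, mellinQuotient m lam f Y ((ϱ : ℂ) + y * Complex.I) =
      mellin (weightedCoeff f Y) ((ϱ : ℂ) + y * Complex.I) := by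
  filter_upwards [ae_mellin_kernel_ne_zero m hd hlam ϱ] with y hy
  have hre : ((ϱ : ℂ) + y * Complex.I).re = ϱ := by simp
  rw [mellinQuotient, (hasMellin_dataCoeff hd hlam hf hY (by rwa [hre]) (by rwa [hre])).2,
    mul_div_cancel_left₀ _ hy]

end Inversion

end SpheroidTransform

theorem theorem2p1_general (d : ℕ) (hd : 2 ≤ d) (lam : ℝ) (hlam : 0 < lam)
    (f : EuclideanSpace ℝ (Fin (d + 1)) → ℂ) (hf : ContinuousOn f (sphere 0 1)) :
    tangentSubspheres d lam =
      {T | ∃ (ψ : sphere (0 : EuclideanSpace ℝ (Fin d)) 1) (c : ℝ),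
        0 < c ∧ T = subsphere lam ψ c} ∧
    ∀ (m : ℕ), ∀ Y ∈ sphericalHarmonics d m, ∀ ϱ : ℝ, 0 < ϱ → ϱ < 2 * (d - 1 : ℕ) →
      (∀ s : ℂ, s.re = ϱ → MellinConvergent (dataCoeff lam f Y) s ∧
        MellinConvergent (fun x => (kernel d m lam x : ℂ)) (1 - s)) ∧
      (∀ᵐ y : ℝ, mellin (fun x => (kernel d m lam x : ℂ)) (1 - ((ϱ : ℂ) + y * Complex.I)) ≠ 0) ∧
      (∀ r : ℝ, 0 < r →
        IntegrableAtFilter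
          (fun u => (harmonicCoeff f Y u - harmonicCoeff f Y r) / ((u - r : ℝ) : ℂ)) (𝓝 r) →
        Tendsto
          (fun T : ℝ => (1 + (r : ℂ) ^ 2) ^ (d - 1) *
            truncatedMellinInv ϱ (mellinQuotient m lam f Y) r T)
          atTop (𝓝 (harmonicCoeff f Y r))) ∧
      (∀ r : ℝ, 0 < r →
        Tendsto
          (fun T : ℝ => (1 + (r : ℂ) ^ 2) ^ (d - 1) * ((1 / (T : ℂ)) *
            ∫ τ in (0 : ℝ)..T, truncatedMellinInv ϱ (mellinQuotient m lam f Y) r τ))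
          atTop (𝓝 (harmonicCoeff f Y r))) := by
  refine ⟨tangentSubspheres_eq hlam, fun m Y hY ϱ h0 h1 => ?_⟩
  have hYc := continuous_of_mem_sphericalHarmonics hY
  have hQ := ae_mellinQuotient_eq hd hlam hf hY h0 h1
  have hg : MellinConvergent (weightedCoeff f Y) ϱ := mellinConvergent_weightedCoeff hf hYc h0 h1
  refine ⟨fun s hs => ⟨(hasMellin_dataCoeff hd hlam hf hY (hs ▸ h0) (hs ▸ h1)).1,
    mellinConvergent_kernel m hd hlam _⟩, ae_mellin_kernel_ne_zero m hd hlam ϱ,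
    fun r hr hD => ?_, fun r hr => ?_⟩ <;> rw [← one_add_sq_pow_mul_weightedCoeff]
  · exact (tendsto_truncatedMellinInv_of_diniAt hr hQ hg
      (diniAt_weightedCoeff (diniAt_iff.2 hD))).const_mul _
  · exact (tendsto_cesaro_truncatedMellinInv hr hQ hg
      (continuous_weightedCoeff hf hYc).continuousAt).const_mul _

theorem theorem2p1 (d : ℕ) (hd : 2 ≤ d) (lam : ℝ) (hlam : 0 < lam)
    (f : EuclideanSpace ℝ (Fin (d + 1)) → ℂ) (hf : ContinuousOn f (Metric.sphere 0 1))
    (hfint : MeasureTheory.IntegrableOn (fStarStar f) {0}ᶜ)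
    (Y : ∀ m : ℕ, Fin (harmonicDim d m) →
      Metric.sphere (0 : EuclideanSpace ℝ (Fin d)) 1 → ℂ)
    (hY : IsSphericalHarmonicBasis Y) :
    tangentSubspheres d lam =
      {T | ∃ (ψ : Metric.sphere (0 : EuclideanSpace ℝ (Fin d)) 1) (c : ℝ),
        0 < c ∧ T = subsphere lam ψ c} ∧
    ∀ (m : ℕ) (l : Fin (harmonicDim d m)) (ϱ : ℝ), 0 < ϱ → ϱ < 1 →
      (∀ s : ℂ, s.re = ϱ → MellinConvergent (dataCoeff lam f (Y m l)) s ∧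
        MellinConvergent (fun x => (kernel d m lam x : ℂ)) (1 - s)) ∧
      (∀ᵐ y : ℝ, mellin (fun x => (kernel d m lam x : ℂ)) (1 - ((ϱ : ℂ) + y * Complex.I)) ≠ 0) ∧
      (∀ r : ℝ, 0 < r →
        MeasureTheory.IntegrableAtFilter
          (fun u => (harmonicCoeff f (Y m l) u - harmonicCoeff f (Y m l) r) / ((u - r : ℝ) : ℂ))
          (nhds r) →
        Filter.Tendsto
          (fun T : ℝ => (1 + (r : ℂ) ^ 2) ^ (d - 1) *
            truncatedMellinInv ϱ (mellinQuotient m lam f (Y m l)) r T)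
          Filter.atTop (nhds (harmonicCoeff f (Y m l) r))) ∧
      (∀ r : ℝ, 0 < r →
        Filter.Tendsto
          (fun T : ℝ => (1 + (r : ℂ) ^ 2) ^ (d - 1) * ((1 / (T : ℂ)) *
            ∫ τ in (0 : ℝ)..T, truncatedMellinInv ϱ (mellinQuotient m lam f (Y m l)) r τ))
          Filter.atTop (nhds (harmonicCoeff f (Y m l) r))) := by
  obtain ⟨htangent, hinversion⟩ := theorem2p1_general d hd lam hlam f hf
  have hstrip : (1 : ℝ) ≤ 2 * (d - 1 : ℕ) := by exact_mod_cast (by omega : 1 ≤ 2 * (d - 1))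
  exact ⟨htangent, fun m l ϱ h0 h1 => hinversion m (Y m l) (hY.mem m l) ϱ h0 (h1.trans_le hstrip)⟩
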